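/- Let $d\in\mathbb N$, let $Q\in\mathbb R^{d\times d}$ be substochastic ($Q\ge 0$ entrywise, all row sums $\le 1$), and put $R=(I-Q)^T$; assume that $R$ is an $M$-matrix, i.e. $R^{-1}$ exists and has nonnegative entries. Let $\mu\in\mathbb R^d$, $C\in\mathbb R^{d\times d}$ with $\sigma_i^2:=(CC^T)_{ii}>0$ for all $i$, let $\mathbf B$ be a standard $d$-dimensional Brownian motion and $\mathbf X(t)=\mu t+C\mathbf B(t)$. For $\mathbf y\in\mathbb R^d_+$ let $(\mathbf Y(\cdot;\mathbf y),\mathbf L(\cdot;\mathbf y))$ be the solution of the Skorokhod problem $$0\le \mathbf Y(t)=\mathbf y+\mathbf X(t)+R\,\mathbf L(t),\qquad \mathbf L(0)=0,\qquad \mathbf L \text{ continuous, each } L_i \text{ nondecreasing},\qquad \int_0^t Y_i\,dL_i=0 .$$ For $\mathbf y\in\mathbb R_+^d$ let $\mathfrak D(t;\mathbf y)$ be the $d\times d$ matrix of directional derivatives of the RBM with respect to its initial condition, $$\mathfrak D(t;\mathbf y)\,e_j=\lim_{\varepsilon\downarrow0}\frac{\mathbf Y(t;\mathbf y+\varepsilon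 e_j)-\mathbf Y(t;\mathbf y)}{\varepsilon},\qquad j=1,\dots,d .$$ Define $\eta^0=0$ and, for $k\ge1$, $\eta_i^k=\inf\{s>\eta^{k-1}+1:\ Y_i(s;\mathbf y)=0\}$ (with $\inf\emptyset=\infty$) and $\eta^k=\max_i\eta_i^k$. Let $\Gamma(t,\mathbf y)=\{\eta_i^k:\ 1\le i\le d,\ k\ge 1,\ \eta_i^k\le t\}$, a finite set, and $\bar{\mathcal C}(s)=\{j:\ Y_j(s;\mathbf y)\ne0\}$. Let $W$ be the Markov chain on $\{0,1,\dots,d\}$ with transition probabilities $P(i\to j)=Q_{ij}$ and $P(i\to0)=1-\sum_jQ_{ij}$ for $i,j\ge1$, and with $0$ absorbing. Let $\tau(A)=\inf\{n\ge0:W(n)\in A\}$, and for $S\subseteq\{1,\dots,d\}$ let $\Lambda_{ij}(S)=P_i\bigl(\tau(S)<\tau(\{0\}),\,W(\tau(S))=j\bigr)$ for $i,j\in\{1,\dots,d\}$. Products over a finite set of times are ordered with the latest time leftmost. Then each $\Lambda(S)$ is substochastic, almost surely the Skorokhod problem has exactly one solution for every initial value in $\mathbb R_+^d$, and for every $\mathbf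 y\in\mathbb R_+^d$ the following hold, with inequalities between matrices understood entrywise. 1. For every $t\ge0$, almost surely, $\mathfrak D(t;\mathbf y)$ exists and $$\mathfrak D(t;\mathbf y)\ \le\ R^{-1}\prod_{s\in\Gamma(t,\mathbf y)}\Lambda^T\bigl(\bar{\mathcal C}(s)\bigr).$$ 2. Almost surely, simultaneously for all $t\ge0$, $\mathfrak D(t;\mathbf y)$ exists and $$\mathfrak D(t;\mathbf y)\ \le\ R^{-1}\prod_{s\in\Gamma(t,\mathbf y),\ s<t}\Lambda^T\bigl(\bar{\mathcal C}(s)\bigr).$$ -/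

import Mathlib

open MeasureTheory ProbabilityTheory Filter Topology
open scoped NNReal ENNReal Matrix

/-! ### Substochastic matrices, the killed Markov chain and the matrices `Λ(S)` -/

/-- `Q` has nonnegative entries and all its row sums are at most one. -/
structure IsSubstochastic {d : ℕ} (Q : Matrix (Fin d) (Fin d) ℝ) : Prop where
  nonneg : ∀ i j, 0 ≤ Q i j
  row_sum_le_one : ∀ i, ∑ j, Q i j ≤ 1

/-- `R` is an `M`-matrix in the sense used for Skorokhod problems: `R⁻¹` exists and has
nonnegative entries. -/
def HasNonnegInverse {d : ℕ} (R : Matrix (Fin d) (Fin d) ℝ) : Prop :=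
  IsUnit R ∧ ∀ i j, 0 ≤ R⁻¹ i j

/-- Transition probabilities of the chain `W` on `{0, 1, …, d}`: from the state `i ≥ 1` it moves
to `j ≥ 1` with probability `Q i j` and to the absorbing state `0` with the missing mass.
The site `i : Fin d` is the state `i.succ`. -/
noncomputable def killedTransition {d : ℕ} (Q : Matrix (Fin d) (Fin d) ℝ)
    (a b : Fin (d + 1)) : ℝ :=
  Fin.cases (Fin.cases 1 (fun _ => 0) b)
    (fun i => Fin.cases (1 - ∑ j, Q i j) (fun j => Q i j) b) a

theorem sum_killedTransition {d : ℕ} {Q : Matrix (Fin d) (Fin d) ℝ} (hQ : IsSubstochastic Q)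
    (a : Fin (d + 1)) : ∑ b, ENNReal.ofReal (killedTransition Q a b) = 1 := by
  have hnn : ∀ b, 0 ≤ killedTransition Q a b := by
    intro b
    refine Fin.cases ?_ (fun i => ?_) a <;> refine Fin.cases ?_ (fun j => ?_) b <;>
      simp [killedTransition, hQ.nonneg, hQ.row_sum_le_one]
  rw [← ENNReal.ofReal_sum_of_nonneg (fun b _ => hnn b)]
  have : ∑ b, killedTransition Q a b = 1 := by
    rw [Fin.sum_univ_succ]
    refine Fin.cases ?_ (fun i => ?_) a <;> simp [killedTransition]
  simp [this]

/-- The one-step law of `W` from the state `a`. -/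
noncomputable def killedStep {d : ℕ} {Q : Matrix (Fin d) (Fin d) ℝ} (hQ : IsSubstochastic Q)
    (a : Fin (d + 1)) : PMF (Fin (d + 1)) :=
  PMF.ofFintype (fun b => ENNReal.ofReal (killedTransition Q a b)) (sum_killedTransition hQ a)

/-- The transition kernel of `W`. -/
noncomputable def killedKernel {d : ℕ} {Q : Matrix (Fin d) (Fin d) ℝ} (hQ : IsSubstochastic Q) :
    Kernel (Fin (d + 1)) (Fin (d + 1)) where
  toFun a := (killedStep hQ a).toMeasure
  measurable' := measurable_of_countable _

instance {d : ℕ} {Q : Matrix (Fin d) (Fin d) ℝ} (hQ : IsSubstochastic Q) :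
    IsMarkovKernel (killedKernel hQ) :=
  ⟨fun a => inferInstanceAs (IsProbabilityMeasure (killedStep hQ a).toMeasure)⟩

/-- The law `P_a` of the trajectory `(W(n))_{n ≥ 0}` of the Markov chain started from `a`. -/
noncomputable def chainLaw {d : ℕ} {Q : Matrix (Fin d) (Fin d) ℝ} (hQ : IsSubstochastic Q)
    (a : Fin (d + 1)) : Measure (ℕ → Fin (d + 1)) :=
  Kernel.trajMeasure (X := fun _ => Fin (d + 1)) (Measure.dirac a) (fun n =>
    (killedKernel hQ).comap
      (fun w : (k : Finset.Iic n) → Fin (d + 1) => w ⟨n, Finset.mem_Iic.2 le_rfl⟩)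
      (measurable_pi_apply _))

/-- The first time `n ≥ 0` at which the trajectory `w` is in `A` (`⊤` if there is none). -/
noncomputable def chainHit {d : ℕ} (A : Set (Fin (d + 1))) (w : ℕ → Fin (d + 1)) : WithTop ℕ :=
  hittingAfter (fun (n : ℕ) (v : ℕ → Fin (d + 1)) => v n) A 0 w

/-- `Λ(S) i j = P_i (τ(S) < τ({0}), W(τ(S)) = j)`. -/
noncomputable def hitMatrix {d : ℕ} {Q : Matrix (Fin d) (Fin d) ℝ} (hQ : IsSubstochastic Q)
    (S : Set (Fin d)) : Matrix (Fin d) (Fin d) ℝ :=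
  Matrix.of fun i j => (chainLaw hQ i.succ).real
    {w | ∃ n : ℕ, chainHit (Fin.succ '' S) w = n ∧ chainHit (Fin.succ '' S) w < chainHit {0} w ∧
      w n = j.succ}

/-! ### The Skorokhod problem -/

/-- `(Y, L)` solves the Skorokhod problem for the input path `x`, the reflection matrix `R` and
the initial value `y`: `0 ≤ Y = y + x + R L`, `L(0) = 0`, every coordinate of `L` is continuous
and nondecreasing, and `∫₀ᵗ Y_i dL_i = 0` for all `i` and `t`. -/
structure IsSkorokhodSolution {d : ℕ} (R : Matrix (Fin d) (Fin d) ℝ) (y : Fin d → ℝ)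
    (x Y L : ℝ≥0 → Fin d → ℝ) : Prop where
  eq : ∀ t, Y t = y + x t + R *ᵥ L t
  nonneg : ∀ t i, 0 ≤ Y t i
  zero : L 0 = 0
  cont : Continuous L
  mono : ∀ i, Monotone (fun t => L t i)
  compl : ∀ i t, ∫⁻ s in Set.Icc 0 t, ENNReal.ofReal (Y s i) ∂(mono i).stieltjesFunction.measure = 0

open Classical in
/-- The reflected path `Y(· ; y, x)`: the first component of the solution of the Skorokhod
problem (and the constant `0` if there is no solution). -/
noncomputable def reflectedPath {d : ℕ} (R : Matrix (Fin d) (Fin d) ℝ) (y : Fin d → ℝ)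
    (x : ℝ≥0 → Fin d → ℝ) : ℝ≥0 → Fin d → ℝ :=
  if h : ∃ Y L, IsSkorokhodSolution R y x Y L then h.choose else 0

/-- `D` is the matrix of directional derivatives at time `t` of the reflected path with respect to
its initial value: `D e_j = lim_{ε ↓ 0} (Y(t; y + ε e_j, x) - Y(t; y, x)) / ε` for every
coordinate direction `e_j` (an inward direction also when `y` lies on the boundary). -/
def IsDerivativeMatrix {d : ℕ} (R : Matrix (Fin d) (Fin d) ℝ) (y : Fin d → ℝ)
    (x : ℝ≥0 → Fin d → ℝ) (t : ℝ≥0) (D : Matrix (Fin d) (Fin d) ℝ) : Prop :=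
  ∀ j : Fin d, Tendsto
    (fun ε : ℝ => ε⁻¹ •
      (reflectedPath R (y + ε • Pi.single j 1) x t - reflectedPath R y x t))
    (𝓝[>] 0) (𝓝 (D *ᵥ Pi.single j 1))

/-! ### Boundary-hitting epochs -/

/-- `inf {s > a + 1 : Y_i(s) = 0}`, with value `∞` if there is no such `s`. -/
noncomputable def firstZeroAfter {d : ℕ} (Y : ℝ≥0 → Fin d → ℝ) (i : Fin d) (a : ℝ≥0∞) : ℝ≥0∞ :=
  sInf {r | ∃ s : ℝ≥0, r = s ∧ a + 1 < s ∧ Y s i = 0}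

/-- The times `η^k`: `η^0 = 0` and `η^{k+1} = sup_i inf {s > η^k + 1 : Y_i(s) = 0}`. -/
noncomputable def eta {d : ℕ} (Y : ℝ≥0 → Fin d → ℝ) : ℕ → ℝ≥0∞
  | 0 => 0
  | k + 1 => ⨆ i, firstZeroAfter Y i (eta Y k)

/-- The times `η_i^{k+1} = inf {s > η^k + 1 : Y_i(s) = 0}`, `k ≥ 0`. -/
noncomputable def etaCoord {d : ℕ} (Y : ℝ≥0 → Fin d → ℝ) (i : Fin d) (k : ℕ) : ℝ≥0∞ :=
  firstZeroAfter Y i (eta Y k)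

theorem add_one_le_etaCoord {d : ℕ} (Y : ℝ≥0 → Fin d → ℝ) (i : Fin d) (k : ℕ) :
    eta Y k + 1 ≤ etaCoord Y i k := by
  refine le_sInf ?_
  rintro r ⟨s, rfl, h, -⟩
  exact h.le

theorem natCast_le_eta {d : ℕ} (Y : ℝ≥0 → Fin d → ℝ) (i : Fin d) (k : ℕ) :
    (k : ℝ≥0∞) ≤ eta Y k := by
  induction k with
  | zero => simp
  | succ k ih =>
    calc ((k + 1 : ℕ) : ℝ≥0∞) = k + 1 := by push_cast; rfl
      _ ≤ eta Y k + 1 := by gcongr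
      _ ≤ etaCoord Y i k := add_one_le_etaCoord Y i k
      _ ≤ eta Y (k + 1) := le_iSup (fun i => firstZeroAfter Y i (eta Y k)) i

theorem finite_epochs {d : ℕ} (Y : ℝ≥0 → Fin d → ℝ) (t : ℝ≥0) :
    {s : ℝ≥0 | s ≤ t ∧ ∃ i k, (s : ℝ≥0∞) = etaCoord Y i k}.Finite := by
  refine ((Set.finite_univ.prod (Set.finite_Iic ⌈t⌉₊)).image
    (fun p : Fin d × ℕ => (etaCoord Y p.1 p.2).toNNReal)).subset ?_
  rintro s ⟨hst, i, k, h⟩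
  refine ⟨(i, k), ⟨Set.mem_univ _, ?_⟩, by simp [← h]⟩
  have h1 : (k : ℝ≥0∞) ≤ t := by
    calc (k : ℝ≥0∞) ≤ eta Y k := natCast_le_eta Y i k
      _ ≤ eta Y k + 1 := le_self_add
      _ ≤ etaCoord Y i k := add_one_le_etaCoord Y i k
      _ = s := h.symm
      _ ≤ t := by exact_mod_cast hst
  have h2 : (k : ℝ≥0) ≤ t := by exact_mod_cast h1
  exact_mod_cast h2.trans (Nat.le_ceil t)

/-- `Γ(t) = {η_i^k : 1 ≤ i ≤ d, k ≥ 1, η_i^k ≤ t}`, as a finite set of times. -/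
noncomputable def epochs {d : ℕ} (Y : ℝ≥0 → Fin d → ℝ) (t : ℝ≥0) : Finset ℝ≥0 :=
  (finite_epochs Y t).toFinset

/-- `∏_{s ∈ F} Λ(C̄(s))ᵀ` with `C̄(s) = {j : Y_j(s) ≠ 0}`. The factors do not commute: the times
decrease from left to right, so the factor of the earliest time is applied first. -/
noncomputable def epochProduct {d : ℕ} {Q : Matrix (Fin d) (Fin d) ℝ} (hQ : IsSubstochastic Q)
    (Y : ℝ≥0 → Fin d → ℝ) (F : Finset ℝ≥0) : Matrix (Fin d) (Fin d) ℝ :=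
  ((F.sort (· ≥ ·)).map (fun s => (hitMatrix hQ {j | Y s j ≠ 0})ᵀ)).prod

/-! ### The driving Brownian motion -/

/-- `B = (B_1, …, B_d)` is a standard `d`-dimensional Brownian motion: its coordinates are
independent standard real Brownian motions. -/
structure IsStandardBrownian {Ω : Type*} [MeasurableSpace Ω] {d : ℕ}
    (B : Fin d → ℝ≥0 → Ω → ℝ) (P : Measure Ω) : Prop where
  brownian : ∀ i, IsBrownianReal (B i) P
  indep : iIndepFun (fun i ω t => B i t ω) P

/-- The path `t ↦ μ t + C B(t)` at the outcome `ω`. -/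
noncomputable def drivingPath {Ω : Type*} {d : ℕ} (μ : Fin d → ℝ)
    (C : Matrix (Fin d) (Fin d) ℝ) (B : Fin d → ℝ≥0 → Ω → ℝ) (ω : Ω) : ℝ≥0 → Fin d → ℝ :=
  fun t => (t : ℝ) • μ + C *ᵥ (fun i => B i t ω)

/-! The regulator `L` of the Skorokhod problem is characterised by the fixed-point equation `L_i(t)
= sup_{s ≤ t} ((QᵀL(s))_i - y_i - x_i(s))⁺`. Since `Q ≥ 0`, Picard iteration from zero is monotone;
since `R⁻¹ ≥ 0`, the iterates are bounded and the fixed point is unique (`regulator_eq_runMax`,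
`fixedPoint_unique`). Order and convexity properties pass from each iterate to the next. In the
limit, `L` is convex in the initial value along every line, and raising the initial value by `εv ≥
0` lowers both `L` and its increments in time.

Convexity gives the one-sided derivatives pathwise, for all `t` at once. For a direction `v ≥ 0`
write the derivative of the reflected path as `R w(t)`. The potential `w` (`derivPotential`) is
nonnegative and nonincreasing in time, and starts below `R⁻¹v`. As `R w = w - Qᵀw ≤ w`, it is enough
to bound `w`.

Let `s` be a push time: every coordinate that vanishes at `s` has its regulator increase immediately
afterwards. A small positive perturbation does not prevent this increase, so the perturbed
coordinate also reaches zero, and this forces `w_i ≤ (Qᵀw)_i` for the right limit of `w` at `s`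
(`derivPotential_le_of_regulator_lt`). On the coordinates `S` that are nonzero at `s`, `w` is still
at most its earlier bound `R⁻¹u`. The function `R⁻¹Λ(S)ᵀu` solves the corresponding Dirichlet
problem: it equals `R⁻¹u` on `S` and is fixed by `Qᵀ` off `S`. The maximum principle therefore gives
`w ≤ R⁻¹Λ(S)ᵀu` strictly after `s` (`derivPotential_le_hitMatrix`), and iterating over push times
gives the product.

Two probabilistic facts remain. Almost surely every finite epoch is a push time: all epochs belong
to a countable family of stopping times, and just after a stopping time each coordinate of `X` goes
strictly below its current value (`IsStandardBrownian.ae_exists_lt_after`). And a fixed time `t > 0`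
is almost surely not an epoch, because no coordinate of the reflected path vanishes at `t`. This
follows by time reversal, even for singular `C`, by testing the path against a column of a Green
function (`reflection_ne_zero_of_fluctuation`). The second fact removes the restriction `s < t` when
`t` is fixed. -/

/-! ### The running maximum of the positive part -/

/-- The running maximum `sup_{s ≤ t} (g s)⁺`, written as a supremum over countably many times. -/
noncomputable def runMax (g : ℝ≥0 → ℝ) (t : ℝ≥0) : ℝ :=
  ⨆ q : ℚ≥0, max (g (min (q : ℝ≥0) 1 * t)) 0

theorem min_one_mul_le (r t : ℝ≥0) : min r 1 * t ≤ t :=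
  mul_le_of_le_one_left zero_le (min_le_right _ _)

theorem runMax_le {g : ℝ≥0 → ℝ} {t : ℝ≥0} {c : ℝ} (h : ∀ s ≤ t, g s ≤ c) (hc : 0 ≤ c) :
    runMax g t ≤ c :=
  ciSup_le fun _ => max_le (h _ (min_one_mul_le _ _)) hc

theorem runMax_nonneg (g : ℝ≥0 → ℝ) (t : ℝ≥0) : 0 ≤ runMax g t :=
  Real.iSup_nonneg fun _ => le_max_right _ _

theorem denseRange_nnratCast : DenseRange ((↑) : ℚ≥0 → ℝ≥0) := by
  refine dense_of_exists_between fun a b hab => ?_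
  obtain ⟨q, hq1, hq2⟩ := exists_rat_btwn (NNReal.coe_lt_coe.2 hab)
  have hq : (0 : ℚ) ≤ q := by exact_mod_cast a.coe_nonneg.trans hq1.le
  lift q to ℚ≥0 using hq
  exact ⟨q, ⟨q, rfl⟩, by exact_mod_cast hq1, by exact_mod_cast hq2⟩

theorem exists_le_of_continuous {g : ℝ≥0 → ℝ} (hg : Continuous g) (t : ℝ≥0) :
    ∃ C, ∀ s ≤ t, g s ≤ C := by
  obtain ⟨C, hC⟩ := (isCompact_Icc (a := (0 : ℝ≥0)) (b := t)).bddAbove_image hg.continuousOn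
  exact ⟨C, fun s hs => hC ⟨s, ⟨zero_le, hs⟩, rfl⟩⟩

theorem bddAbove_runMax {g : ℝ≥0 → ℝ} (hg : Continuous g) (t : ℝ≥0) :
    BddAbove (Set.range fun q : ℚ≥0 => max (g (min (q : ℝ≥0) 1 * t)) 0) := by
  obtain ⟨C, hC⟩ := exists_le_of_continuous hg t
  refine ⟨max C 0, ?_⟩
  rintro _ ⟨q, rfl⟩
  exact max_le_max (hC _ (min_one_mul_le _ _)) le_rfl

theorem le_runMax {g : ℝ≥0 → ℝ} (hg : Continuous g) {s t : ℝ≥0} (h : s ≤ t) :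
    g s ≤ runMax g t := by
  have hφ : Continuous fun r : ℝ≥0 => g (min r 1 * t) := by fun_prop
  have key : ∀ r : ℝ≥0, g (min r 1 * t) ≤ runMax g t := fun r =>
    denseRange_nnratCast.induction_on (p := fun r => g (min r 1 * t) ≤ runMax g t) r
      (isClosed_le hφ continuous_const)
      fun q => (le_max_left _ _).trans (le_ciSup (bddAbove_runMax hg t) q)
  rcases eq_or_ne t 0 with rfl | ht
  · have : s = 0 := le_antisymm h zero_le
    simpa [this] using key 0
  · have h1 : s / t ≤ 1 := div_le_one_of_le₀ h zero_le
    have := key (s / t)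
    rwa [min_eq_left h1, div_mul_cancel₀ _ ht] at this

theorem exists_runMax_eq {g : ℝ≥0 → ℝ} (hg : Continuous g) (t : ℝ≥0) :
    ∃ s ≤ t, runMax g t = max (g s) 0 := by
  obtain ⟨s, hs, hmax⟩ := (isCompact_Icc (a := (0 : ℝ≥0)) (b := t)).exists_isMaxOn
    ⟨0, zero_le, zero_le⟩ hg.continuousOn
  refine ⟨s, hs.2, le_antisymm (runMax_le (fun u hu => ?_) (le_max_right _ _))
    (max_le (le_runMax hg hs.2) (runMax_nonneg _ _))⟩
  exact (hmax ⟨zero_le, hu⟩).trans (le_max_left _ _)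

theorem runMax_mono_time {g : ℝ≥0 → ℝ} (hg : Continuous g) : Monotone (runMax g) :=
  fun _ _ hst => runMax_le (fun _ hu => le_runMax hg (hu.trans hst)) (runMax_nonneg _ _)

theorem runMax_zero_time (g : ℝ≥0 → ℝ) : runMax g 0 = max (g 0) 0 := by
  simp [runMax]

theorem continuous_runMax {g : ℝ≥0 → ℝ} (hg : Continuous g) : Continuous (runMax g) := by
  have h : runMax g = fun t =>
      sSup ((fun t c : ℝ≥0 => max (g (c * t)) 0) t '' Set.Icc 0 1) := by
    funext t
    have hb : BddAbove ((fun c : ℝ≥0 => max (g (c * t)) 0) '' Set.Icc 0 1) :=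
      isCompact_Icc.bddAbove_image (by fun_prop)
    refine le_antisymm (ciSup_le fun q => ?_) (csSup_le ⟨_, 0, by simp, rfl⟩ ?_)
    · exact le_csSup hb ⟨min q 1, ⟨zero_le, min_le_right _ _⟩, rfl⟩
    · rintro _ ⟨c, hc, rfl⟩
      exact max_le (le_runMax hg (mul_le_of_le_one_left zero_le hc.2)) (runMax_nonneg _ _)
  rw [h]
  exact isCompact_Icc.continuous_sSup (by fun_prop)

theorem runMax_le_runMax_add {g g' : ℝ≥0 → ℝ} (hg' : Continuous g') {t : ℝ≥0} {c : ℝ}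
    (hc : 0 ≤ c) (h : ∀ s ≤ t, g s ≤ g' s + c) : runMax g t ≤ runMax g' t + c :=
  runMax_le (fun s hs => (h s hs).trans (by gcongr; exact le_runMax hg' hs))
    (add_nonneg (runMax_nonneg _ _) hc)

theorem runMax_mono {g g' : ℝ≥0 → ℝ} (hg' : Continuous g') {t : ℝ≥0}
    (h : ∀ s ≤ t, g s ≤ g' s) : runMax g t ≤ runMax g' t := by
  simpa using runMax_le_runMax_add hg' le_rfl (fun s hs => by simpa using h s hs)

theorem runMax_le_add_of_increment {g : ℝ≥0 → ℝ} (hg : Continuous g) {s t : ℝ≥0} {c : ℝ}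
    (hc : 0 ≤ c) (h : ∀ u, s ≤ u → u ≤ t → g u ≤ g s + c) :
    runMax g t ≤ runMax g s + c := by
  refine runMax_le (fun u hu => ?_) (add_nonneg (runMax_nonneg _ _) hc)
  rcases le_total s u with h1 | h1
  · exact (h u h1 hu).trans (by gcongr; exact le_runMax hg le_rfl)
  · exact (le_runMax hg h1).trans (by linarith)

/-- If `g - g'` is nonnegative and nondecreasing, so is the difference of the running maxima. -/
theorem runMax_sub_monotone {g g' : ℝ≥0 → ℝ} (hg : Continuous g) (hg' : Continuous g')
    (h0 : ∀ s, g' s ≤ g s) (hm : Monotone fun s => g s - g' s) :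
    Monotone fun t => runMax g t - runMax g' t := by
  intro s t hst
  change runMax g s - runMax g' s ≤ runMax g t - runMax g' t
  obtain ⟨u, hut, hu⟩ := exists_runMax_eq hg' t
  have hmg := runMax_mono_time hg hst
  have hmg' := runMax_mono_time hg' hst
  -- If the maximum of `g'` does not grow on `[s, t]`, only that of `g` can change. Otherwise it is
  -- attained at some `u ≥ s`, and the gap at time `s` is at most `g s - g' s ≤ g u - g' u`, which
  -- is at most the gap at time `t`.
  by_cases hle : runMax g' t ≤ runMax g' s
  · linarith
  · push Not at hle
    have hsu : s ≤ u := by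
      by_contra! hus
      have := le_runMax hg' hus.le
      have h3 := runMax_nonneg g' s
      rw [hu] at hle
      rcases max_cases (g' u) 0 with h | h <;> linarith
    have hpos : runMax g' t = g' u := by
      rw [hu]
      refine max_eq_left ?_
      by_contra! hneg
      rw [hu, max_eq_right hneg.le] at hle
      exact absurd (runMax_nonneg g' s) (not_le.2 hle)
    have h1 : g u ≤ runMax g t := le_runMax hg hut
    have h2 : g s - g' s ≤ g u - g' u := hm hsu
    have h3 : runMax g s ≤ runMax g' s + (g s - g' s) :=
      runMax_le_runMax_add hg' (sub_nonneg.2 (h0 s)) fun v hv => by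
        have : g v - g' v ≤ g s - g' s := hm hv
        linarith
    linarith

/-- The running maximum does not increase while it is above `g`. -/
theorem runMax_eq_of_lt {g : ℝ≥0 → ℝ} (hg : Continuous g) {a b : ℝ≥0} (hab : a ≤ b)
    (h : ∀ u, a ≤ u → u ≤ b → g u < runMax g u) : runMax g a = runMax g b := by
  refine le_antisymm (runMax_mono_time hg hab) ?_
  obtain ⟨u, hub, hu⟩ := exists_runMax_eq hg b
  rcases max_cases (g u) 0 with h' | h'
  · rw [hu, h'.1]
    rcases le_total u a with hua | hau
    · exact le_runMax hg hua
    · have h2 := runMax_mono_time hg hub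
      rw [hu, h'.1] at h2
      exact absurd (h u hau hub) (not_lt.2 h2)
  · rw [hu, h'.1]
    exact runMax_nonneg _ _

theorem runMax_convex {g₀ g₁ g : ℝ≥0 → ℝ} (h0 : Continuous g₀) (h1 : Continuous g₁)
    {a b : ℝ} (ha : 0 ≤ a) (hb : 0 ≤ b) (t : ℝ≥0)
    (h : ∀ s ≤ t, g s ≤ a * g₀ s + b * g₁ s) :
    runMax g t ≤ a * runMax g₀ t + b * runMax g₁ t := by
  refine runMax_le (fun s hs => (h s hs).trans ?_) ?_
  · gcongr
    · exact le_runMax h0 hs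
    · exact le_runMax h1 hs
  · have := runMax_nonneg g₀ t
    have := runMax_nonneg g₁ t
    positivity

/-! ### Comparison principles for `M`-matrices -/

theorem mulVec_reflection {d : ℕ} {Q R : Matrix (Fin d) (Fin d) ℝ} (hRQ : R = (1 - Q)ᵀ)
    (v : Fin d → ℝ) (i : Fin d) : (R *ᵥ v) i = v i - (Qᵀ *ᵥ v) i := by
  simp [hRQ, Matrix.transpose_sub, Matrix.sub_mulVec]

theorem mulVec_mono {d : ℕ} {M : Matrix (Fin d) (Fin d) ℝ} (hM : ∀ i j, 0 ≤ M i j)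
    {v w : Fin d → ℝ} (h : ∀ i, v i ≤ w i) (i : Fin d) : (M *ᵥ v) i ≤ (M *ᵥ w) i := by
  simp only [Matrix.mulVec, dotProduct]
  exact Finset.sum_le_sum fun j _ => mul_le_mul_of_nonneg_left (h j) (hM i j)

theorem mulVec_nonneg_of_nonneg {d : ℕ} {M : Matrix (Fin d) (Fin d) ℝ} (hM : ∀ i j, 0 ≤ M i j)
    {v : Fin d → ℝ} (h : ∀ i, 0 ≤ v i) (i : Fin d) : 0 ≤ (M *ᵥ v) i := by
  simpa using mulVec_mono (v := 0) hM h i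

theorem HasNonnegInverse.inv_mulVec_mulVec {d : ℕ} {R : Matrix (Fin d) (Fin d) ℝ}
    (hR : HasNonnegInverse R) (v : Fin d → ℝ) : R⁻¹ *ᵥ (R *ᵥ v) = v := by
  rw [Matrix.mulVec_mulVec, Matrix.nonsing_inv_mul _ ((Matrix.isUnit_iff_isUnit_det _).1 hR.1),
    Matrix.one_mulVec]

theorem HasNonnegInverse.mulVec_inv_mulVec {d : ℕ} {R : Matrix (Fin d) (Fin d) ℝ}
    (hR : HasNonnegInverse R) (v : Fin d → ℝ) : R *ᵥ (R⁻¹ *ᵥ v) = v := by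
  rw [Matrix.mulVec_mulVec, Matrix.mul_nonsing_inv _ ((Matrix.isUnit_iff_isUnit_det _).1 hR.1),
    Matrix.one_mulVec]

theorem HasNonnegInverse.le_inv_mulVec {d : ℕ} {Q R : Matrix (Fin d) (Fin d) ℝ}
    (hRQ : R = (1 - Q)ᵀ) (hR : HasNonnegInverse R) {v b : Fin d → ℝ}
    (h : ∀ i, v i ≤ (Qᵀ *ᵥ v) i + b i) (i : Fin d) : v i ≤ (R⁻¹ *ᵥ b) i := by
  have := mulVec_mono hR.2 (v := R *ᵥ v) (w := b)
    (fun i => by rw [mulVec_reflection hRQ]; linarith [h i]) i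
  rwa [hR.inv_mulVec_mulVec] at this

/-- The maximum principle: apply `R⁻¹ ≥ 0` to `R v ≤ 0`. It yields both the uniqueness of the
regulator and the comparison with the Dirichlet problem for `Λ(S)`. -/
theorem HasNonnegInverse.nonpos_of_le {d : ℕ} {Q R : Matrix (Fin d) (Fin d) ℝ}
    (hRQ : R = (1 - Q)ᵀ) (hR : HasNonnegInverse R) {v : Fin d → ℝ}
    (h : ∀ i, v i ≤ (Qᵀ *ᵥ v) i) (i : Fin d) : v i ≤ 0 := by
  simpa using hR.le_inv_mulVec hRQ (b := 0) (by simpa using h) i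

theorem HasNonnegInverse.inv_mulVec_eq {d : ℕ} {Q R : Matrix (Fin d) (Fin d) ℝ}
    (hRQ : R = (1 - Q)ᵀ) (hR : HasNonnegInverse R) (b : Fin d → ℝ) (i : Fin d) :
    (R⁻¹ *ᵥ b) i = (Qᵀ *ᵥ (R⁻¹ *ᵥ b)) i + b i := by
  have := congrFun (hR.mulVec_inv_mulVec b) i
  rw [mulVec_reflection hRQ] at this
  linarith

theorem IsSubstochastic.transpose_nonneg {d : ℕ} {Q : Matrix (Fin d) (Fin d) ℝ}
    (hQ : IsSubstochastic Q) (i j : Fin d) : 0 ≤ Qᵀ i j := hQ.nonneg j i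

/-! ### Picard iteration for the Skorokhod problem -/

/-- The Picard iterates `Lⁿ⁺¹_i(t) = sup_{s ≤ t} ((Qᵀ Lⁿ(s))_i - y_i - x_i(s))⁺`. -/
noncomputable def picard {d : ℕ} (Q : Matrix (Fin d) (Fin d) ℝ) (y : Fin d → ℝ)
    (x : ℝ≥0 → Fin d → ℝ) : ℕ → ℝ≥0 → Fin d → ℝ
  | 0 => 0
  | n + 1 => fun t i => runMax (fun s => (Qᵀ *ᵥ picard Q y x n s) i - y i - x s i) t

theorem picard_succ_apply {d : ℕ} (Q : Matrix (Fin d) (Fin d) ℝ) (y : Fin d → ℝ)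
    (x : ℝ≥0 → Fin d → ℝ) (n : ℕ) (t : ℝ≥0) (i : Fin d) :
    picard Q y x (n + 1) t i =
      runMax (fun s => (Qᵀ *ᵥ picard Q y x n s) i - y i - x s i) t := by
  rw [picard]

/-- The least solution of `L_i(t) = sup_{s ≤ t} ((Qᵀ L(s))_i - y_i - x_i(s))⁺`. -/
noncomputable def regulator {d : ℕ} (Q : Matrix (Fin d) (Fin d) ℝ) (y : Fin d → ℝ)
    (x : ℝ≥0 → Fin d → ℝ) (t : ℝ≥0) (i : Fin d) : ℝ :=
  ⨆ n, picard Q y x n t i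

section Picard

variable {d : ℕ} {Q R : Matrix (Fin d) (Fin d) ℝ} {x : ℝ≥0 → Fin d → ℝ}

theorem continuous_obstacle (Q : Matrix (Fin d) (Fin d) ℝ) (y : Fin d → ℝ) (hx : Continuous x)
    {L : ℝ≥0 → Fin d → ℝ} (hL : Continuous L) (i : Fin d) :
    Continuous fun s => (Qᵀ *ᵥ L s) i - y i - x s i := by
  have : Continuous fun s => Qᵀ *ᵥ L s := Continuous.matrix_mulVec continuous_const hL
  fun_prop

theorem continuous_picard (Q : Matrix (Fin d) (Fin d) ℝ) (y : Fin d → ℝ) (hx : Continuous x)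
    (n : ℕ) : Continuous (picard Q y x n) := by
  induction n with
  | zero => exact continuous_const
  | succ n ih =>
    exact continuous_pi fun i => continuous_runMax (continuous_obstacle Q y hx ih i)

theorem picard_nonneg (Q : Matrix (Fin d) (Fin d) ℝ) (y : Fin d → ℝ) (x : ℝ≥0 → Fin d → ℝ)
    (n : ℕ) (t : ℝ≥0) (i : Fin d) : 0 ≤ picard Q y x n t i := by
  cases n with
  | zero => exact le_rfl
  | succ n => rw [picard_succ_apply]; exact runMax_nonneg _ _

theorem picard_le_succ (hQ : IsSubstochastic Q) (y : Fin d → ℝ) (hx : Continuous x)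
    (n : ℕ) (t : ℝ≥0) (i : Fin d) : picard Q y x n t i ≤ picard Q y x (n + 1) t i := by
  induction n generalizing t i with
  | zero => exact picard_nonneg _ _ _ _ _ _
  | succ n ih =>
    rw [picard_succ_apply, picard_succ_apply]
    refine runMax_mono (continuous_obstacle Q y hx (continuous_picard Q y hx _) i) fun s _ => ?_
    gcongr
    exact mulVec_mono hQ.transpose_nonneg (fun j => ih s j) i

theorem picard_mono (hQ : IsSubstochastic Q) (y : Fin d → ℝ) (hx : Continuous x)
    (t : ℝ≥0) (i : Fin d) : Monotone fun n => picard Q y x n t i :=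
  monotone_nat_of_le_succ fun n => picard_le_succ hQ y hx n t i

theorem picard_monotone_time (Q : Matrix (Fin d) (Fin d) ℝ) (y : Fin d → ℝ) (hx : Continuous x)
    (n : ℕ) (i : Fin d) : Monotone fun t => picard Q y x n t i := by
  cases n with
  | zero => exact monotone_const
  | succ n => exact runMax_mono_time (continuous_obstacle Q y hx (continuous_picard Q y hx _) i)

/-- `R⁻¹b` solves `z = Qᵀz + b`, so it is a constant supersolution of the iteration and bounds all
iterates uniformly in `n`. -/
theorem picard_le_inv (hQ : IsSubstochastic Q) (hRQ : R = (1 - Q)ᵀ) (hR : HasNonnegInverse R)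
    {y b : Fin d → ℝ} {t : ℝ≥0} (hb : ∀ i, 0 ≤ b i)
    (h : ∀ s ≤ t, ∀ i, -(y i) - x s i ≤ b i) (n : ℕ) :
    ∀ s ≤ t, ∀ i, picard Q y x n s i ≤ (R⁻¹ *ᵥ b) i := by
  induction n with
  | zero => exact fun s _ i => mulVec_nonneg_of_nonneg hR.2 hb i
  | succ n ih =>
    intro s hs i
    rw [picard_succ_apply]
    refine runMax_le (fun u hu => ?_) (mulVec_nonneg_of_nonneg hR.2 hb i)
    rw [hR.inv_mulVec_eq hRQ b i]
    have := mulVec_mono hQ.transpose_nonneg (fun j => ih u (hu.trans hs) j) i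
    linarith [h u (hu.trans hs) i]

theorem exists_obstacle_bound (y : Fin d → ℝ) (hx : Continuous x) (t : ℝ≥0) :
    ∃ b : Fin d → ℝ, (∀ i, 0 ≤ b i) ∧ ∀ s ≤ t, ∀ i, -(y i) - x s i ≤ b i := by
  have : ∀ i, ∃ C, ∀ s ≤ t, -(y i) - x s i ≤ C := fun i =>
    exists_le_of_continuous (by fun_prop) t
  choose C hC using this
  exact ⟨fun i => max (C i) 0, fun i => le_max_right _ _,
    fun s hs i => (hC i s hs).trans (le_max_left _ _)⟩

theorem bddAbove_picard (hQ : IsSubstochastic Q) (hRQ : R = (1 - Q)ᵀ) (hR : HasNonnegInverse R)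
    (y : Fin d → ℝ) (hx : Continuous x) (t : ℝ≥0) (i : Fin d) :
    BddAbove (Set.range fun n => picard Q y x n t i) := by
  obtain ⟨b, hb, h⟩ := exists_obstacle_bound y hx t
  refine ⟨(R⁻¹ *ᵥ b) i, ?_⟩
  rintro _ ⟨n, rfl⟩
  exact picard_le_inv hQ hRQ hR hb h n t le_rfl i

theorem tendsto_picard (hQ : IsSubstochastic Q) (hRQ : R = (1 - Q)ᵀ) (hR : HasNonnegInverse R)
    (y : Fin d → ℝ) (hx : Continuous x) (t : ℝ≥0) (i : Fin d) :
    Tendsto (fun n => picard Q y x n t i) atTop (𝓝 (regulator Q y x t i)) :=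
  tendsto_atTop_ciSup (picard_mono hQ y hx t i) (bddAbove_picard hQ hRQ hR y hx t i)

theorem picard_le_regulator (hQ : IsSubstochastic Q) (hRQ : R = (1 - Q)ᵀ)
    (hR : HasNonnegInverse R) (y : Fin d → ℝ) (hx : Continuous x) (n : ℕ) (t : ℝ≥0) (i : Fin d) :
    picard Q y x n t i ≤ regulator Q y x t i :=
  le_ciSup (bddAbove_picard hQ hRQ hR y hx t i) n

theorem tendsto_mulVec_picard (hQ : IsSubstochastic Q) (hRQ : R = (1 - Q)ᵀ)
    (hR : HasNonnegInverse R) (y : Fin d → ℝ) (hx : Continuous x) (t : ℝ≥0) (i : Fin d) :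
    Tendsto (fun n => (Qᵀ *ᵥ picard Q y x n t) i) atTop
      (𝓝 ((Qᵀ *ᵥ regulator Q y x t) i)) := by
  simp only [Matrix.mulVec, dotProduct]
  exact tendsto_finsetSum _ fun j _ => (tendsto_picard hQ hRQ hR y hx t j).const_mul _

theorem regulator_nonneg (Q : Matrix (Fin d) (Fin d) ℝ) (y : Fin d → ℝ) (x : ℝ≥0 → Fin d → ℝ)
    (t : ℝ≥0) (i : Fin d) : 0 ≤ regulator Q y x t i :=
  Real.iSup_nonneg fun _ => picard_nonneg _ _ _ _ _ _

theorem regulator_monotone_time (hQ : IsSubstochastic Q) (hRQ : R = (1 - Q)ᵀ)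
    (hR : HasNonnegInverse R) (y : Fin d → ℝ) (hx : Continuous x) (i : Fin d) :
    Monotone fun t => regulator Q y x t i := fun s t hst =>
  le_of_tendsto_of_tendsto' (tendsto_picard hQ hRQ hR y hx s i)
    (tendsto_picard hQ hRQ hR y hx t i) fun n => picard_monotone_time Q y hx n i hst

/-- The supersolution argument applied to increments: if `b` bounds the drops of `x` after `s`, the
iterates grow by at most `R⁻¹b`. Uniformity in `n` is what makes the limit continuous. -/
theorem picard_increment_le (hQ : IsSubstochastic Q) (hRQ : R = (1 - Q)ᵀ)
    (hR : HasNonnegInverse R) (y : Fin d → ℝ) (hx : Continuous x) {b : Fin d → ℝ}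
    (hb : ∀ i, 0 ≤ b i) {s t : ℝ≥0}
    (h : ∀ u, s ≤ u → u ≤ t → ∀ i, x s i - x u i ≤ b i) (n : ℕ) :
    ∀ u, s ≤ u → u ≤ t → ∀ i, picard Q y x n u i ≤ picard Q y x n s i + (R⁻¹ *ᵥ b) i := by
  induction n with
  | zero => intro u _ _ i; simpa [picard] using mulVec_nonneg_of_nonneg hR.2 hb i
  | succ n ih =>
    intro u hsu hut i
    refine runMax_le_add_of_increment (continuous_obstacle Q y hx (continuous_picard Q y hx _) i)
      (mulVec_nonneg_of_nonneg hR.2 hb i) fun v hsv hvu => ?_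
    rw [hR.inv_mulVec_eq hRQ b i]
    have h1 := mulVec_mono (w := picard Q y x n s + R⁻¹ *ᵥ b) hQ.transpose_nonneg
      (fun j => ih v hsv (hvu.trans hut) j) i
    rw [Matrix.mulVec_add, Pi.add_apply] at h1
    linarith [h v hsv (hvu.trans hut) i]

theorem regulator_increment_le (hQ : IsSubstochastic Q) (hRQ : R = (1 - Q)ᵀ)
    (hR : HasNonnegInverse R) (y : Fin d → ℝ) (hx : Continuous x) {b : Fin d → ℝ}
    (hb : ∀ i, 0 ≤ b i) {s t : ℝ≥0} (hst : s ≤ t)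
    (h : ∀ u, s ≤ u → u ≤ t → ∀ i, x s i - x u i ≤ b i) (i : Fin d) :
    regulator Q y x t i ≤ regulator Q y x s i + (R⁻¹ *ᵥ b) i :=
  le_of_tendsto_of_tendsto' (tendsto_picard hQ hRQ hR y hx t i)
    ((tendsto_picard hQ hRQ hR y hx s i).add_const _) fun n =>
      picard_increment_le hQ hRQ hR y hx hb h n t hst le_rfl i

theorem continuous_regulator (hQ : IsSubstochastic Q) (hRQ : R = (1 - Q)ᵀ)
    (hR : HasNonnegInverse R) (y : Fin d → ℝ) (hx : Continuous x) :
    Continuous (regulator Q y x) := by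
  refine continuous_pi fun i => ?_
  set K : ℝ := (R⁻¹ *ᵥ fun _ => (1 : ℝ)) i with hK
  have hK0 : 0 ≤ K := mulVec_nonneg_of_nonneg hR.2 (fun _ => zero_le_one) i
  have hmon := regulator_monotone_time hQ hRQ hR y hx i
  have hscale : ∀ ε : ℝ, (R⁻¹ *ᵥ fun _ => ε) i = ε * K := fun ε => by
    rw [hK, show (fun _ : Fin d => ε) = ε • (fun _ => (1 : ℝ)) by ext; simp,
      Matrix.mulVec_smul, Pi.smul_apply, smul_eq_mul]
  rw [Metric.continuous_iff]
  intro t ε hε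
  -- An oscillation `η` of `x` is amplified by `R⁻¹` to at most `ηK`; using `K + 1` in the
  -- denominator covers `K = 0`.
  have hη : 0 < ε / (2 * (K + 1)) := by positivity
  obtain ⟨δ, hδ, hx'⟩ := Metric.continuous_iff.1 hx t (ε / (2 * (K + 1)) / 2) (by positivity)
  have hosc : ∀ u v : ℝ≥0, dist u t < δ → dist v t < δ → ∀ j, x u j - x v j ≤ ε / (2 * (K + 1)) := by
    intro u v hu hv j
    have h1 := (dist_le_pi_dist (x u) (x t) j).trans_lt (hx' u hu)
    have h2 := (dist_le_pi_dist (x v) (x t) j).trans_lt (hx' v hv)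
    rw [Real.dist_eq, abs_lt] at h1 h2
    linarith [h1.1, h1.2, h2.1, h2.2]
  have hfin : ε / (2 * (K + 1)) * K < ε := by
    rw [div_mul_eq_mul_div, div_lt_iff₀ (by positivity)]
    nlinarith
  have key : ∀ a b : ℝ≥0, a ≤ b → dist a t < δ → dist b t < δ →
      regulator Q y x b i ≤ regulator Q y x a i + ε / (2 * (K + 1)) * K := by
    intro a b hab ha hb
    rw [← hscale]
    refine regulator_increment_le hQ hRQ hR y hx (fun _ => hη.le) hab (fun u hau hub j => ?_) i
    refine hosc a u ha ?_ j
    rw [NNReal.dist_eq, abs_lt] at *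
    have h1 : (a : ℝ) ≤ u := hau
    have h2 : (u : ℝ) ≤ b := hub
    constructor <;> linarith [ha.1, hb.2]
  refine ⟨δ, hδ, fun s hs => ?_⟩
  rw [Real.dist_eq, abs_lt]
  have htt : dist t t < δ := by simpa using hδ
  rcases le_total s t with h | h
  · have h1 := key s t h hs htt
    have h2 : regulator Q y x s i ≤ regulator Q y x t i := hmon h
    constructor <;> linarith
  · have h1 := key t s h htt hs
    have h2 : regulator Q y x t i ≤ regulator Q y x s i := hmon h
    constructor <;> linarith

/-- The regulator is a fixed point of the Picard operator. -/
theorem regulator_eq_runMax (hQ : IsSubstochastic Q) (hRQ : R = (1 - Q)ᵀ)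
    (hR : HasNonnegInverse R) (y : Fin d → ℝ) (hx : Continuous x) (t : ℝ≥0) (i : Fin d) :
    regulator Q y x t i =
      runMax (fun s => (Qᵀ *ᵥ regulator Q y x s) i - y i - x s i) t := by
  refine le_antisymm (ciSup_le fun n => (picard_le_succ hQ y hx n t i).trans ?_)
    (runMax_le (fun s hs => ?_) (regulator_nonneg _ _ _ _ _))
  · rw [picard_succ_apply]
    refine runMax_mono (continuous_obstacle Q y hx (continuous_regulator hQ hRQ hR y hx) i)
      fun s _ => ?_
    gcongr
    exact mulVec_mono hQ.transpose_nonneg (picard_le_regulator hQ hRQ hR y hx n s) i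
  · refine le_of_tendsto' (((tendsto_mulVec_picard hQ hRQ hR y hx s i).sub_const _).sub_const _)
      fun n => le_trans ?_ (picard_le_regulator hQ hRQ hR y hx (n + 1) t i)
    exact le_runMax (continuous_obstacle Q y hx (continuous_picard Q y hx _) i) hs

/-! ### Monotonicity and convexity in the initial value -/

/-- The two claims need a joint induction: the running maximum preserves monotonicity of a
difference only if that difference is also nonnegative (`runMax_sub_monotone`). -/
theorem picard_comparison (hQ : IsSubstochastic Q) {y y' : Fin d → ℝ} (hyy : ∀ i, y i ≤ y' i)
    (hx : Continuous x) (n : ℕ) (i : Fin d) :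
    (∀ t, picard Q y' x n t i ≤ picard Q y x n t i) ∧
    (Monotone fun t => picard Q y x n t i - picard Q y' x n t i) := by
  induction n generalizing i with
  | zero => exact ⟨fun _ => le_rfl, fun _ _ _ => by simp [picard]⟩
  | succ n ih =>
    have hc := continuous_obstacle Q y hx (continuous_picard Q y hx n) i
    have hc' := continuous_obstacle Q y' hx (continuous_picard Q y' hx n) i
    have h0 : ∀ s, (Qᵀ *ᵥ picard Q y' x n s) i - y' i - x s i ≤
        (Qᵀ *ᵥ picard Q y x n s) i - y i - x s i := fun s => by
      gcongr
      · exact mulVec_mono hQ.transpose_nonneg (fun j => (ih j).1 s) i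
      · exact hyy i
    refine ⟨fun t => runMax_mono hc fun s _ => h0 s, runMax_sub_monotone hc hc' h0 ?_⟩
    intro s t hst
    have h1 := mulVec_mono (v := picard Q y x n s - picard Q y' x n s)
      (w := picard Q y x n t - picard Q y' x n t) hQ.transpose_nonneg (fun j => (ih j).2 hst) i
    rw [Matrix.mulVec_sub, Matrix.mulVec_sub, Pi.sub_apply, Pi.sub_apply] at h1
    change _ - _ ≤ _ - _
    linarith

theorem regulator_antitone (hQ : IsSubstochastic Q) (hRQ : R = (1 - Q)ᵀ)
    (hR : HasNonnegInverse R) {y y' : Fin d → ℝ} (hyy : ∀ i, y i ≤ y' i)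
    (hx : Continuous x) (t : ℝ≥0) (i : Fin d) :
    regulator Q y' x t i ≤ regulator Q y x t i :=
  le_of_tendsto_of_tendsto' (tendsto_picard hQ hRQ hR y' hx t i)
    (tendsto_picard hQ hRQ hR y hx t i) fun n => (picard_comparison hQ hyy hx n i).1 t

/-- Raising the initial value lowers the increments of the regulator. -/
theorem regulator_sub_monotone (hQ : IsSubstochastic Q) (hRQ : R = (1 - Q)ᵀ)
    (hR : HasNonnegInverse R) {y y' : Fin d → ℝ} (hyy : ∀ i, y i ≤ y' i)
    (hx : Continuous x) (i : Fin d) :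
    Monotone fun t => regulator Q y x t i - regulator Q y' x t i := fun s t hst =>
  le_of_tendsto_of_tendsto'
    ((tendsto_picard hQ hRQ hR y hx s i).sub (tendsto_picard hQ hRQ hR y' hx s i))
    ((tendsto_picard hQ hRQ hR y hx t i).sub (tendsto_picard hQ hRQ hR y' hx t i))
    fun n => (picard_comparison hQ hyy hx n i).2 hst

/-- The reflected path is nondecreasing in the initial value. -/
theorem regulator_sub_le (hQ : IsSubstochastic Q) (hRQ : R = (1 - Q)ᵀ)
    (hR : HasNonnegInverse R) {y y' : Fin d → ℝ} (hyy : ∀ i, y i ≤ y' i)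
    (hx : Continuous x) (t : ℝ≥0) (i : Fin d) :
    regulator Q y x t i - regulator Q y' x t i ≤
      (Qᵀ *ᵥ (regulator Q y x t - regulator Q y' x t)) i + (y' i - y i) := by
  rw [regulator_eq_runMax hQ hRQ hR y hx, regulator_eq_runMax hQ hRQ hR y' hx, sub_le_iff_le_add']
  have hnn : 0 ≤ (Qᵀ *ᵥ (regulator Q y x t - regulator Q y' x t)) i :=
    mulVec_nonneg_of_nonneg hQ.transpose_nonneg
      (fun j => sub_nonneg.2 (regulator_antitone hQ hRQ hR hyy hx t j)) i
  refine runMax_le_runMax_add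
    (continuous_obstacle Q y' hx (continuous_regulator hQ hRQ hR y' hx) i)
    (add_nonneg hnn (sub_nonneg.2 (hyy i))) fun s hs => ?_
  have h1 := mulVec_mono (v := regulator Q y x s - regulator Q y' x s)
    (w := regulator Q y x t - regulator Q y' x t) hQ.transpose_nonneg
    (fun j => regulator_sub_monotone hQ hRQ hR hyy hx j hs) i
  rw [Matrix.mulVec_sub, Pi.sub_apply] at h1
  linarith

/-- The obstacle is affine in the initial value, and both `Qᵀ ≥ 0` and the running maximum preserve
convexity. The domain is the whole line, including `ε < 0` where `y + εv` may leave the orthant, so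
that `0` is an interior point and the right derivative there exists. -/
theorem picard_convex (hQ : IsSubstochastic Q) (y v : Fin d → ℝ) (hx : Continuous x) (n : ℕ)
    (t : ℝ≥0) (i : Fin d) :
    ConvexOn ℝ Set.univ fun ε : ℝ => picard Q (y + ε • v) x n t i := by
  refine ⟨convex_univ, fun e _ f _ a b ha hb hab => ?_⟩
  induction n generalizing t i with
  | zero => simp [picard]
  | succ n ih =>
    simp only [picard_succ_apply, smul_eq_mul] at ih ⊢
    refine runMax_convex (continuous_obstacle Q _ hx (continuous_picard Q _ hx n) i)
      (continuous_obstacle Q _ hx (continuous_picard Q _ hx n) i) ha hb t fun s _ => ?_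
    have h1 := mulVec_mono
      (w := a • picard Q (y + e • v) x n s + b • picard Q (y + f • v) x n s)
      hQ.transpose_nonneg (fun j => ih s j) i
    rw [Matrix.mulVec_add, Matrix.mulVec_smul, Matrix.mulVec_smul] at h1
    simp only [Pi.add_apply, Pi.smul_apply, smul_eq_mul] at h1 ⊢
    have hb' : b = 1 - a := by linarith
    subst hb'
    linarith

theorem regulator_convex (hQ : IsSubstochastic Q) (hRQ : R = (1 - Q)ᵀ)
    (hR : HasNonnegInverse R) (y v : Fin d → ℝ) (hx : Continuous x) (t : ℝ≥0) (i : Fin d) :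
    ConvexOn ℝ Set.univ fun ε : ℝ => regulator Q (y + ε • v) x t i := by
  refine ⟨convex_univ, fun e _ f _ a b ha hb hab => ?_⟩
  exact le_of_tendsto_of_tendsto' (tendsto_picard hQ hRQ hR _ hx t i)
    (((tendsto_picard hQ hRQ hR _ hx t i).const_mul a).add
      ((tendsto_picard hQ hRQ hR _ hx t i).const_mul b))
    fun n => (picard_convex hQ y v hx n t i).2 trivial trivial ha hb hab

end Picard

/-! ### Existence and uniqueness for the Skorokhod problem -/

theorem stieltjesFunction_apply_of_continuous {ℓ : ℝ≥0 → ℝ} (hm : Monotone ℓ)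
    (hc : Continuous ℓ) (t : ℝ≥0) : hm.stieltjesFunction t = ℓ t := by
  rw [hm.stieltjesFunction_eq]
  exact hc.continuousAt.continuousWithinAt.rightLim_eq

theorem stieltjes_Icc_of_continuous {ℓ : ℝ≥0 → ℝ} (hm : Monotone ℓ) (hc : Continuous ℓ)
    (a b : ℝ≥0) : hm.stieltjesFunction.measure (Set.Icc a b) = ENNReal.ofReal (ℓ b - ℓ a) := by
  have : (hm.stieltjesFunction : ℝ≥0 → ℝ) = ℓ :=
    funext (stieltjesFunction_apply_of_continuous hm hc)
  rw [StieltjesFunction.measure_Icc, this, hc.continuousAt.continuousWithinAt.leftLim_eq]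

theorem eq_of_lintegral_stieltjes_eq_zero {ℓ f : ℝ≥0 → ℝ} (hm : Monotone ℓ) (hc : Continuous ℓ)
    (hf : Continuous f)
    (h : ∀ t, ∫⁻ s in Set.Icc 0 t, ENNReal.ofReal (f s) ∂hm.stieltjesFunction.measure = 0)
    {a b : ℝ≥0} (hab : a ≤ b) (hpos : ∀ u, a ≤ u → u ≤ b → 0 < f u) : ℓ a = ℓ b := by
  refine le_antisymm (hm hab) ?_
  have h1 := (lintegral_eq_zero_iff (by fun_prop)).1 (h b)
  rw [EventuallyEq, ae_restrict_iff' measurableSet_Icc] at h1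
  have h2 : hm.stieltjesFunction.measure (Set.Icc a b) = 0 := by
    refine measure_mono_null (fun u hu => ?_) h1
    simp only [Set.mem_compl_iff, Set.mem_ofPred_eq, not_forall]
    exact ⟨⟨zero_le, hu.2⟩, by simpa using hpos u hu.1 hu.2⟩
  rw [stieltjes_Icc_of_continuous hm hc, ENNReal.ofReal_eq_zero] at h2
  linarith

/-- Each point of `{f > 0}` has an interval around it on which `f > 0`; there `ℓ` is flat, so the
interval is null. Hence `{f > 0}` is locally null, and therefore null. -/
theorem lintegral_stieltjes_eq_zero {ℓ f : ℝ≥0 → ℝ} (hm : Monotone ℓ) (hc : Continuous ℓ)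
    (hf : Continuous f)
    (h : ∀ a b : ℝ≥0, a ≤ b → (∀ u, a ≤ u → u ≤ b → 0 < f u) → ℓ a = ℓ b) (t : ℝ≥0) :
    ∫⁻ s in Set.Icc 0 t, ENNReal.ofReal (f s) ∂hm.stieltjesFunction.measure = 0 := by
  rw [lintegral_eq_zero_iff (by fun_prop)]
  refine ae_restrict_of_ae ?_
  change hm.stieltjesFunction.measure _ = 0
  refine measure_null_of_locally_null _ fun s hs => ?_
  have hs' : 0 < f s := by
    by_contra! hneg
    exact hs (by simpa using hneg)
  have hopen : IsOpen {u | 0 < f u} := isOpen_lt continuous_const hf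
  obtain ⟨ε, hε, hball⟩ := Metric.isOpen_iff.1 hopen s hs'
  have hpos : ∀ u, s - (ε / 2).toNNReal ≤ u → u ≤ s + (ε / 2).toNNReal → 0 < f u := by
    intro u h1 h2
    refine hball ?_
    rw [Metric.mem_ball, NNReal.dist_eq, abs_lt]
    rw [tsub_le_iff_right] at h1
    have h1' : (s : ℝ) ≤ u + (ε / 2).toNNReal := h1
    have h2' : (u : ℝ) ≤ s + (ε / 2).toNNReal := h2
    rw [Real.coe_toNNReal _ (by positivity)] at h1' h2'
    constructor <;> linarith
  refine ⟨Set.Icc (s - (ε / 2).toNNReal) (s + (ε / 2).toNNReal), mem_nhdsWithin_of_mem_nhds ?_, ?_⟩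
  · refine mem_of_superset (Metric.ball_mem_nhds s (half_pos hε)) fun u hu => ?_
    rw [Metric.mem_ball, NNReal.dist_eq, abs_lt] at hu
    have h3 : ((ε / 2).toNNReal : ℝ) = ε / 2 := Real.coe_toNNReal _ (by positivity)
    rw [Set.mem_Icc, tsub_le_iff_right, ← NNReal.coe_le_coe, ← NNReal.coe_le_coe, NNReal.coe_add,
      NNReal.coe_add, h3]
    constructor <;> linarith [hu.1, hu.2]
  · rw [stieltjes_Icc_of_continuous hm hc, h _ _ (tsub_le_self.trans le_self_add) hpos]
    simp

section Skorokhod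

variable {d : ℕ} {Q R : Matrix (Fin d) (Fin d) ℝ} {x : ℝ≥0 → Fin d → ℝ} {y : Fin d → ℝ}

theorem IsSkorokhodSolution.continuous_path {Y L : ℝ≥0 → Fin d → ℝ}
    (h : IsSkorokhodSolution R y x Y L) (hx : Continuous x) : Continuous Y := by
  rw [show Y = fun t => y + x t + R *ᵥ L t from funext h.eq]
  have : Continuous fun s => R *ᵥ L s := Continuous.matrix_mulVec continuous_const h.cont
  fun_prop

theorem IsSkorokhodSolution.flat {Y L : ℝ≥0 → Fin d → ℝ} (h : IsSkorokhodSolution R y x Y L)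
    (hx : Continuous x) {i : Fin d} {a b : ℝ≥0} (hab : a ≤ b)
    (hpos : ∀ u, a ≤ u → u ≤ b → 0 < Y u i) : L a i = L b i :=
  eq_of_lintegral_stieltjes_eq_zero (h.mono i) ((continuous_apply i).comp h.cont)
    ((continuous_apply i).comp (h.continuous_path hx)) (h.compl i) hab hpos

theorem IsSkorokhodSolution.eq_apply {Y L : ℝ≥0 → Fin d → ℝ} (h : IsSkorokhodSolution R y x Y L)
    (hRQ : R = (1 - Q)ᵀ) (t : ℝ≥0) (i : Fin d) :
    Y t i = L t i - ((Qᵀ *ᵥ L t) i - y i - x t i) := by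
  rw [h.eq t, Pi.add_apply, Pi.add_apply, mulVec_reflection hRQ]
  ring

/-- Nonnegativity of `Y` keeps `L_i` above the obstacle. Complementarity keeps it from exceeding the
running maximum, since while `L_i` is strictly above the obstacle `Y_i` is positive and `L_i` is
flat. -/
theorem IsSkorokhodSolution.eq_runMax {Y L : ℝ≥0 → Fin d → ℝ}
    (h : IsSkorokhodSolution R y x Y L) (hRQ : R = (1 - Q)ᵀ) (hx : Continuous x) (t : ℝ≥0)
    (i : Fin d) : L t i = runMax (fun s => (Qᵀ *ᵥ L s) i - y i - x s i) t := by
  have hg := continuous_obstacle Q y hx h.cont i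
  have h0 : L 0 i = 0 := by rw [h.zero]; rfl
  have hmono : ∀ {a b : ℝ≥0}, a ≤ b → L a i ≤ L b i := fun hab => h.mono i hab
  refine le_antisymm ?_ (runMax_le (fun s hs => ?_) (h0 ▸ hmono zero_le))
  · by_contra! hlt
    set M := runMax (fun s => (Qᵀ *ᵥ L s) i - y i - x s i) t
    have hM : 0 ≤ M := runMax_nonneg _ _
    -- If `L t i > M`, then `L_i` passes the midpoint at some time `a`. From `a` to `t` it stays
    -- above `M`, so it cannot have grown from the midpoint to `L t i`.
    obtain ⟨a, ha, hLa⟩ : (M + L t i) / 2 ∈ (fun s => L s i) '' Set.Icc 0 t :=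
      intermediate_value_Icc zero_le ((continuous_apply i).comp h.cont).continuousOn
        ⟨by simp only [Function.comp_apply]; linarith, by simp only [Function.comp_apply]; linarith⟩
    have hflat : L a i = L t i := h.flat hx ha.2 fun u hau hut => by
      have h1 := le_runMax hg hut
      have h2 := hmono hau
      simp only at hLa h1
      rw [h.eq_apply hRQ]
      linarith
    simp only at hLa
    linarith
  · have h1 := h.nonneg s i
    rw [h.eq_apply hRQ] at h1
    linarith [hmono hs]

theorem fixedPoint_unique (hQ : IsSubstochastic Q) (hRQ : R = (1 - Q)ᵀ) (hR : HasNonnegInverse R)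
    (hx : Continuous x) {L L' : ℝ≥0 → Fin d → ℝ} (hL : Continuous L) (hL' : Continuous L')
    (h : ∀ t i, L t i = runMax (fun s => (Qᵀ *ᵥ L s) i - y i - x s i) t)
    (h' : ∀ t i, L' t i = runMax (fun s => (Qᵀ *ᵥ L' s) i - y i - x s i) t) : L = L' := by
  funext t i
  have hc : ∀ i, Continuous fun s => |L s i - L' s i| := fun i => by fun_prop
  set δ : Fin d → ℝ := fun i => runMax (fun s => |L s i - L' s i|) t
  have hδ0 : ∀ i, 0 ≤ (Qᵀ *ᵥ δ) i :=
    mulVec_nonneg_of_nonneg hQ.transpose_nonneg fun i => runMax_nonneg _ _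
  have hle : ∀ s ≤ t, ∀ i, |(Qᵀ *ᵥ L s) i - (Qᵀ *ᵥ L' s) i| ≤ (Qᵀ *ᵥ δ) i := by
    intro s hs i
    have h1 := mulVec_mono (v := L s - L' s) (w := δ) hQ.transpose_nonneg
      (fun j => (le_abs_self _).trans (le_runMax (hc j) hs)) i
    have h2 := mulVec_mono (v := L' s - L s) (w := δ) hQ.transpose_nonneg
      (fun j => (neg_sub (L s j) (L' s j) ▸ neg_le_abs _).trans (le_runMax (hc j) hs)) i
    rw [Matrix.mulVec_sub, Pi.sub_apply] at h1 h2
    rw [abs_le]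
    constructor <;> linarith
  -- The running maximum is 1-Lipschitz in the supremum norm, so the distance vector `δ` of two
  -- fixed points satisfies `δ ≤ Qᵀδ` and vanishes by the maximum principle.
  have hkey : ∀ i, δ i ≤ (Qᵀ *ᵥ δ) i := by
    refine fun i => runMax_le (fun s hs => ?_) (hδ0 i)
    have h1 : L s i ≤ L' s i + (Qᵀ *ᵥ δ) i := by
      rw [h, h']
      refine runMax_le_runMax_add (continuous_obstacle Q y hx hL' i) (hδ0 i) fun u hu => ?_
      linarith [(abs_le.1 (hle u (hu.trans hs) i)).2]
    have h2 : L' s i ≤ L s i + (Qᵀ *ᵥ δ) i := by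
      rw [h, h']
      refine runMax_le_runMax_add (continuous_obstacle Q y hx hL i) (hδ0 i) fun u hu => ?_
      linarith [(abs_le.1 (hle u (hu.trans hs) i)).1]
    rw [abs_le]
    constructor <;> linarith
  have h0 := (le_runMax (hc i) le_rfl).trans (hR.nonpos_of_le hRQ hkey i)
  exact sub_eq_zero.1 (abs_nonpos_iff.1 h0)

/-- The path `y + x + R L` reflected by the regulator `L`. -/
noncomputable def reflection (Q : Matrix (Fin d) (Fin d) ℝ) (y : Fin d → ℝ)
    (x : ℝ≥0 → Fin d → ℝ) (t : ℝ≥0) : Fin d → ℝ :=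
  y + x t + (1 - Q)ᵀ *ᵥ regulator Q y x t

/-- Everything is read off the fixed-point equation: `L` dominates the obstacle, which gives `Y ≥
0`, and is flat where it is strictly above it, which is complementarity. `x 0 = 0` and `y ≥ 0` serve
to get `L(0) = 0`. -/
theorem isSkorokhodSolution_reflection (hQ : IsSubstochastic Q) (hRQ : R = (1 - Q)ᵀ)
    (hR : HasNonnegInverse R) (hx : Continuous x) (hx0 : x 0 = 0) (hy : ∀ i, 0 ≤ y i) :
    IsSkorokhodSolution R y x (reflection Q y x) (regulator Q y x) := by
  have hYeq : ∀ t i, reflection Q y x t i = regulator Q y x t i -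
      ((Qᵀ *ᵥ regulator Q y x t) i - y i - x t i) := fun t i => by
    rw [reflection, Pi.add_apply, Pi.add_apply, mulVec_reflection rfl]; ring
  have hcont := continuous_regulator hQ hRQ hR y hx
  have hYc : Continuous (reflection Q y x) := by
    have : Continuous fun s => (1 - Q)ᵀ *ᵥ regulator Q y x s :=
      Continuous.matrix_mulVec continuous_const hcont
    exact (continuous_const.add hx).add this
  refine ⟨fun t => by rw [hRQ]; rfl, fun t i => ?_, ?_, hcont,
    regulator_monotone_time hQ hRQ hR y hx, fun i t => ?_⟩
  · rw [hYeq, regulator_eq_runMax hQ hRQ hR y hx]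
    exact sub_nonneg.2 (le_runMax (continuous_obstacle Q y hx hcont i) le_rfl)
  · funext i
    have hp : ∀ n, picard Q y x n 0 = 0 := by
      intro n
      induction n with
      | zero => rfl
      | succ n ih =>
        funext j
        rw [picard_succ_apply, runMax_zero_time, ih, hx0]
        simpa using hy j
    simp [regulator, hp]
  · refine lintegral_stieltjes_eq_zero _ ((continuous_apply i).comp hcont)
      ((continuous_apply i).comp hYc) (fun a b hab hpos => ?_) t
    simp only [Function.comp_apply] at hpos ⊢
    rw [regulator_eq_runMax hQ hRQ hR y hx, regulator_eq_runMax hQ hRQ hR y hx]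
    refine runMax_eq_of_lt (continuous_obstacle Q y hx hcont i) hab fun u hau hub => ?_
    have := hpos u hau hub
    rw [hYeq] at this
    rw [← regulator_eq_runMax hQ hRQ hR y hx]
    linarith

theorem IsSkorokhodSolution.eq_regulator (hQ : IsSubstochastic Q) (hRQ : R = (1 - Q)ᵀ)
    (hR : HasNonnegInverse R) (hx : Continuous x) {Y L : ℝ≥0 → Fin d → ℝ}
    (h : IsSkorokhodSolution R y x Y L) : L = regulator Q y x :=
  fixedPoint_unique hQ hRQ hR hx h.cont (continuous_regulator hQ hRQ hR y hx)
    (h.eq_runMax hRQ hx) (regulator_eq_runMax hQ hRQ hR y hx)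

theorem IsSkorokhodSolution.eq_reflection (hQ : IsSubstochastic Q) (hRQ : R = (1 - Q)ᵀ)
    (hR : HasNonnegInverse R) (hx : Continuous x) {Y L : ℝ≥0 → Fin d → ℝ}
    (h : IsSkorokhodSolution R y x Y L) : Y = reflection Q y x := by
  funext t
  rw [h.eq t, h.eq_regulator hQ hRQ hR hx, reflection, hRQ]

theorem existsUnique_skorokhodSolution (hQ : IsSubstochastic Q) (hRQ : R = (1 - Q)ᵀ)
    (hR : HasNonnegInverse R) (hx : Continuous x) (hx0 : x 0 = 0) (hy : ∀ i, 0 ≤ y i) :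
    ∃! p : (ℝ≥0 → Fin d → ℝ) × (ℝ≥0 → Fin d → ℝ), IsSkorokhodSolution R y x p.1 p.2 :=
  ⟨(reflection Q y x, regulator Q y x), isSkorokhodSolution_reflection hQ hRQ hR hx hx0 hy,
    fun _ hp => Prod.ext (hp.eq_reflection hQ hRQ hR hx) (hp.eq_regulator hQ hRQ hR hx)⟩

theorem reflectedPath_eq_reflection (hQ : IsSubstochastic Q) (hRQ : R = (1 - Q)ᵀ)
    (hR : HasNonnegInverse R) (hx : Continuous x) (hx0 : x 0 = 0) (hy : ∀ i, 0 ≤ y i) :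
    reflectedPath R y x = reflection Q y x := by
  have h : ∃ Y L, IsSkorokhodSolution R y x Y L :=
    ⟨_, _, isSkorokhodSolution_reflection hQ hRQ hR hx hx0 hy⟩
  rw [reflectedPath, dif_pos h]
  exact h.choose_spec.choose_spec.eq_reflection hQ hRQ hR hx

end Skorokhod

/-! ### Green functions of the chain killed outside a set -/

open Classical in
/-- The matrix `Q` with the rows outside `A` replaced by zero. -/
noncomputable def rowRestrict {d : ℕ} (Q : Matrix (Fin d) (Fin d) ℝ) (A : Set (Fin d)) :
    Matrix (Fin d) (Fin d) ℝ :=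
  Matrix.of fun i j => if i ∈ A then Q i j else 0

/-- The series `∑ₙ Mⁿ`. -/
noncomputable def greenSeries {d : ℕ} (M : Matrix (Fin d) (Fin d) ℝ) : Matrix (Fin d) (Fin d) ℝ :=
  ∑' n, M ^ n

open Classical in
/-- `N i k` is the expected number of visits to `k ∈ A` of the chain started from `i`
before it leaves `A`. -/
noncomputable def greenOn {d : ℕ} (Q : Matrix (Fin d) (Fin d) ℝ) (A : Set (Fin d)) :
    Matrix (Fin d) (Fin d) ℝ :=
  Matrix.of fun i k => if k ∈ A then greenSeries (rowRestrict Q A) i k else 0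

section Green

variable {d : ℕ} {Q R : Matrix (Fin d) (Fin d) ℝ}

theorem matrix_pow_nonneg {M : Matrix (Fin d) (Fin d) ℝ} (hM : ∀ i j, 0 ≤ M i j) (n : ℕ)
    (i j : Fin d) : 0 ≤ (M ^ n) i j := by
  induction n generalizing j with
  | zero => rw [pow_zero, Matrix.one_apply]; split <;> norm_num
  | succ n ih =>
    rw [pow_succ, Matrix.mul_apply]
    exact Finset.sum_nonneg fun k _ => mul_nonneg (ih k) (hM k j)

theorem matrix_pow_le_pow {M N : Matrix (Fin d) (Fin d) ℝ} (hM : ∀ i j, 0 ≤ M i j)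
    (h : ∀ i j, M i j ≤ N i j) (n : ℕ) (i j : Fin d) : (M ^ n) i j ≤ (N ^ n) i j := by
  induction n generalizing j with
  | zero => rw [pow_zero, pow_zero]
  | succ n ih =>
    rw [pow_succ, pow_succ, Matrix.mul_apply, Matrix.mul_apply]
    exact Finset.sum_le_sum fun k _ => mul_le_mul (ih k) (h k j) (hM k j)
      ((matrix_pow_nonneg hM n i k).trans (ih k))

/-- The transpose `G` of `R⁻¹` inverts `1 - Q`, so the geometric sum is `G - QᵐG` with `QᵐG ≥ 0`.
This replaces any spectral radius argument. -/
theorem sum_pow_le_inv (hQ : IsSubstochastic Q) (hRQ : R = (1 - Q)ᵀ) (hR : HasNonnegInverse R)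
    (m : ℕ) (i j : Fin d) : ∑ n ∈ Finset.range m, (Q ^ n) i j ≤ R⁻¹ j i := by
  have hG : (1 - Q) * R⁻¹ᵀ = 1 := by
    rw [← Matrix.transpose_transpose (1 - Q), ← hRQ, ← Matrix.transpose_mul,
      Matrix.nonsing_inv_mul _ ((Matrix.isUnit_iff_isUnit_det _).1 hR.1), Matrix.transpose_one]
  have h1 : ∑ n ∈ Finset.range m, Q ^ n = R⁻¹ᵀ - Q ^ m * R⁻¹ᵀ := by
    calc ∑ n ∈ Finset.range m, Q ^ n
        = (∑ n ∈ Finset.range m, Q ^ n) * ((1 - Q) * R⁻¹ᵀ) := by rw [hG, mul_one]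
      _ = R⁻¹ᵀ - Q ^ m * R⁻¹ᵀ := by rw [← mul_assoc, geom_sum_mul_neg, sub_mul, one_mul]
  have h2 : 0 ≤ (Q ^ m * R⁻¹ᵀ) i j := by
    rw [Matrix.mul_apply]
    exact Finset.sum_nonneg fun k _ =>
      mul_nonneg (matrix_pow_nonneg hQ.nonneg m i k) (hR.2 j k)
  have h3 := congrFun (congrFun h1 i) j
  rw [Matrix.sum_apply, Matrix.sub_apply, Matrix.transpose_apply] at h3
  linarith

theorem rowRestrict_nonneg (hQ : IsSubstochastic Q) (A : Set (Fin d)) (i j : Fin d) :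
    0 ≤ rowRestrict Q A i j := by
  simp only [rowRestrict, Matrix.of_apply]
  split
  exacts [hQ.nonneg i j, le_rfl]

theorem rowRestrict_le (hQ : IsSubstochastic Q) (A : Set (Fin d)) (i j : Fin d) :
    rowRestrict Q A i j ≤ Q i j := by
  simp only [rowRestrict, Matrix.of_apply]
  split
  exacts [le_rfl, hQ.nonneg i j]

theorem summable_rowRestrict_pow (hQ : IsSubstochastic Q) (hRQ : R = (1 - Q)ᵀ)
    (hR : HasNonnegInverse R) (A : Set (Fin d)) : Summable fun n => rowRestrict Q A ^ n := by
  refine Pi.summable.2 fun i => Pi.summable.2 fun j => ?_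
  refine summable_of_sum_range_le (c := R⁻¹ j i)
    (fun n => matrix_pow_nonneg (rowRestrict_nonneg hQ A) n i j) fun m => ?_
  exact (Finset.sum_le_sum fun n _ => matrix_pow_le_pow (rowRestrict_nonneg hQ A)
    (rowRestrict_le hQ A) n i j).trans (sum_pow_le_inv hQ hRQ hR m i j)

theorem greenSeries_apply {M : Matrix (Fin d) (Fin d) ℝ} (hM : Summable fun n => M ^ n)
    (i j : Fin d) : HasSum (fun n => (M ^ n) i j) (greenSeries M i j) :=
  Pi.hasSum.1 (Pi.hasSum.1 hM.hasSum i) j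

theorem greenSeries_eq_add_mul {M : Matrix (Fin d) (Fin d) ℝ} (hM : Summable fun n => M ^ n) :
    greenSeries M = 1 + greenSeries M * M := by
  have h := hM.tsum_eq_zero_add
  simp only [pow_succ, pow_zero, hM.tsum_mul_right] at h
  exact h

theorem greenSeries_eq_add_mul' {M : Matrix (Fin d) (Fin d) ℝ} (hM : Summable fun n => M ^ n) :
    greenSeries M = 1 + M * greenSeries M := by
  have h := hM.tsum_eq_zero_add
  simp only [pow_succ', pow_zero, hM.tsum_mul_left] at h
  exact h

theorem greenOn_apply_of_notMem (Q : Matrix (Fin d) (Fin d) ℝ) {A : Set (Fin d)} (i : Fin d)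
    {k : Fin d} (hk : k ∉ A) : greenOn Q A i k = 0 := by
  simp [greenOn, hk]

theorem greenOn_apply_of_mem (Q : Matrix (Fin d) (Fin d) ℝ) {A : Set (Fin d)} (i : Fin d)
    {k : Fin d} (hk : k ∈ A) : greenOn Q A i k = greenSeries (rowRestrict Q A) i k := by
  simp [greenOn, hk]

/-- Deleting rows of the right factor outside `A` has the same effect as deleting the matching
columns of the left factor. -/
theorem greenSeries_eq_one_add_greenOn_mul {A : Set (Fin d)}
    (hM : Summable fun n => rowRestrict Q A ^ n) :
    greenSeries (rowRestrict Q A) = 1 + greenOn Q A * Q := by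
  conv_lhs => rw [greenSeries_eq_add_mul hM]
  congr 1
  ext i j
  rw [Matrix.mul_apply, Matrix.mul_apply]
  refine Finset.sum_congr rfl fun k _ => ?_
  by_cases hk : k ∈ A <;> simp [greenOn, rowRestrict, hk]

theorem greenOn_row_eq_zero {A : Set (Fin d)}
    (hM : Summable fun n => rowRestrict Q A ^ n) {i k : Fin d} (hi : i ∉ A) (hk : k ∈ A) :
    greenOn Q A i k = 0 := by
  have hik : i ≠ k := fun h => hi (h ▸ hk)
  rw [greenOn_apply_of_mem Q i hk, greenSeries_eq_add_mul' hM, Matrix.add_apply,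
    Matrix.one_apply_ne hik, Matrix.mul_apply]
  simp [rowRestrict, hi]

theorem greenOn_row_eq {A : Set (Fin d)}
    (hM : Summable fun n => rowRestrict Q A ^ n) {i k : Fin d} (hi : i ∈ A) (hk : k ∈ A) :
    greenOn Q A i k = (1 : Matrix (Fin d) (Fin d) ℝ) i k + ∑ l, Q i l * greenOn Q A l k := by
  rw [greenOn_apply_of_mem Q i hk, greenSeries_eq_add_mul' hM, Matrix.add_apply,
    Matrix.mul_apply]
  congr 1
  refine Finset.sum_congr rfl fun l _ => ?_
  rw [greenOn_apply_of_mem Q l hk]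
  simp [rowRestrict, hi]

theorem greenOn_nonneg (hQ : IsSubstochastic Q) (hRQ : R = (1 - Q)ᵀ) (hR : HasNonnegInverse R)
    (A : Set (Fin d)) (i k : Fin d) : 0 ≤ greenOn Q A i k := by
  simp only [greenOn, Matrix.of_apply]
  split
  · exact (greenSeries_apply (summable_rowRestrict_pow hQ hRQ hR A) i k).nonneg
      fun n => matrix_pow_nonneg (rowRestrict_nonneg hQ A) n i k
  · exact le_rfl

end Green

/-! ### The hitting matrices of the killed chain -/

section Chain

variable {d : ℕ} {Q R : Matrix (Fin d) (Fin d) ℝ}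

instance (hQ : IsSubstochastic Q) (a : Fin (d + 1)) : IsProbabilityMeasure (chainLaw hQ a) :=
  inferInstanceAs (IsProbabilityMeasure (Kernel.trajMeasure _ _))

theorem chainLaw_map_zero (hQ : IsSubstochastic Q) (a : Fin (d + 1)) :
    (chainLaw hQ a).map (fun w => w 0) = Measure.dirac a := by
  have hg : Measurable fun v : (k : Finset.Iic 0) → Fin (d + 1) => v ⟨0, Finset.mem_Iic.2 le_rfl⟩ :=
    measurable_pi_apply _
  have hf : Measurable (Preorder.frestrictLe (π := fun _ : ℕ => Fin (d + 1)) 0) :=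
    Preorder.measurable_frestrictLe 0
  have h : (chainLaw hQ a).map (Preorder.frestrictLe (π := fun _ : ℕ => Fin (d + 1)) 0) =
      (Measure.dirac a).map
        (MeasurableEquiv.piUnique (fun _ : Finset.Iic 0 => Fin (d + 1))).symm := by
    rw [chainLaw, Kernel.trajMeasure, Measure.map_comp _ _ hf,
      Kernel.traj_map_frestrictLe, Kernel.partialTraj_self, Measure.id_comp]
  have h2 := Measure.map_map (μ := chainLaw hQ a) hg hf
  rw [h, Measure.map_map hg (MeasurableEquiv.measurable _)] at h2
  refine h2.symm.trans ?_
  exact Measure.map_id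

theorem killedKernel_real_succ (hQ : IsSubstochastic Q) (i j : Fin d) :
    (killedKernel hQ i.succ) {j.succ} = ENNReal.ofReal (Q i j) := by
  change (killedStep hQ i.succ).toMeasure {j.succ} = _
  rw [PMF.toMeasure_apply_singleton _ _ (MeasurableSet.singleton _)]
  simp [killedStep, killedTransition]

/-- The Markov property of the chain at time `n`. -/
theorem chainLaw_real_inter_step (hQ : IsSubstochastic Q) (a : Fin (d + 1)) (n : ℕ)
    (E : Set ((k : Finset.Iic n) → Fin (d + 1))) (i j : Fin d)
    (hE : ∀ w ∈ E, w ⟨n, Finset.mem_Iic.2 le_rfl⟩ = i.succ) :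
    (chainLaw hQ a).real {w | Preorder.frestrictLe n w ∈ E ∧ w (n + 1) = j.succ} =
      (chainLaw hQ a).real {w | Preorder.frestrictLe n w ∈ E} * Q i j := by
  have hEm : MeasurableSet E := MeasurableSet.of_discrete
  have hf : Measurable (Preorder.frestrictLe (π := fun _ : ℕ => Fin (d + 1)) n) :=
    Preorder.measurable_frestrictLe n
  have hj : MeasurableSet ({j.succ} : Set (Fin (d + 1))) := MeasurableSet.singleton _
  set κ : (n : ℕ) → Kernel ((k : Finset.Iic n) → Fin (d + 1)) (Fin (d + 1)) := fun n =>
    (killedKernel hQ).comap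
      (fun w : (k : Finset.Iic n) → Fin (d + 1) => w ⟨n, Finset.mem_Iic.2 le_rfl⟩)
      (measurable_pi_apply _) with hκ
  have key := congrArg (fun ν => ν (E ×ˢ {j.succ}))
    (Kernel.map_frestrictLe_trajMeasure_compProd_eq_map_trajMeasure
      (X := fun _ => Fin (d + 1)) (μ₀ := Measure.dirac a) (κ := κ) (a := n))
  rw [Measure.compProd_apply_prod hEm hj, Measure.map_apply (by fun_prop) (hEm.prod hj)] at key
  have hc : ∀ w ∈ E, κ n w {j.succ} = ENNReal.ofReal (Q i j) := fun w hw => by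
    rw [hκ, Kernel.comap_apply, hE w hw, killedKernel_real_succ]
  rw [setLIntegral_congr_fun hEm hc, setLIntegral_const, Measure.map_apply hf hEm] at key
  have key' := congrArg ENNReal.toReal key
  rw [ENNReal.toReal_mul, ENNReal.toReal_ofReal (hQ.nonneg i j), mul_comm] at key'
  exact key'.symm

/-- The trajectories that stay in `A` before time `n` and are at `j` at time `n`. -/
def stayThenAt (A : Set (Fin d)) (n : ℕ) (j : Fin d) : Set (ℕ → Fin (d + 1)) :=
  {w | w n = j.succ ∧ ∀ m < n, ∃ k ∈ A, w m = k.succ}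

theorem measurableSet_stayThenAt (A : Set (Fin d)) (n : ℕ) (j : Fin d) :
    MeasurableSet (stayThenAt A n j) := by
  have h : ∀ (m : ℕ) (s : Set (Fin (d + 1))), MeasurableSet {w : ℕ → Fin (d + 1) | w m ∈ s} :=
    fun m s => measurable_pi_apply m (MeasurableSet.of_discrete (s := s))
  have : stayThenAt A n j = {w | w n ∈ ({j.succ} : Set (Fin (d + 1)))} ∩
      ⋂ m, ⋂ _ : m < n, {w | w m ∈ {b : Fin (d + 1) | ∃ k ∈ A, b = k.succ}} := by
    ext w
    simp [stayThenAt]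
  rw [this]
  exact (h _ _).inter (MeasurableSet.iInter fun m => MeasurableSet.iInter fun _ => h _ _)

theorem chainLaw_real_stayThenAt (hQ : IsSubstochastic Q) (A : Set (Fin d)) (i : Fin d) (n : ℕ)
    (j : Fin d) :
    (chainLaw hQ i.succ).real (stayThenAt A n j) = (rowRestrict Q A ^ n) i j := by
  classical
  induction n generalizing j with
  | zero =>
    have h : stayThenAt A 0 j = (fun w : ℕ → Fin (d + 1) => w 0) ⁻¹' {j.succ} := by
      ext w; simp [stayThenAt]
    rw [h, ← map_measureReal_apply (measurable_pi_apply 0) (MeasurableSet.singleton _),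
      chainLaw_map_zero, pow_zero, Matrix.one_apply]
    by_cases hij : i = j <;> simp [hij, Measure.real]
  | succ n ih =>
    have hsplit : stayThenAt A (n + 1) j = ⋃ l ∈ (Finset.univ.filter (· ∈ A)),
        (stayThenAt A n l ∩ {w | w (n + 1) = j.succ}) := by
      ext w
      simp only [stayThenAt, Set.mem_ofPred_eq, Finset.mem_filter, Finset.mem_univ, true_and,
        Set.mem_iUnion, Set.mem_inter_iff, exists_prop]
      constructor
      · rintro ⟨h1, h2⟩
        obtain ⟨k, hk, hw⟩ := h2 n (Nat.lt_succ_self n)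
        exact ⟨k, hk, ⟨hw, fun m hm => h2 m (hm.trans (Nat.lt_succ_self n))⟩, h1⟩
      · rintro ⟨k, hk, ⟨hw, h2⟩, h1⟩
        refine ⟨h1, fun m hm => ?_⟩
        rcases Nat.lt_succ_iff_lt_or_eq.1 hm with h | rfl
        exacts [h2 m h, ⟨k, hk, hw⟩]
    have hmeas : ∀ l, MeasurableSet (stayThenAt A n l ∩ {w | w (n + 1) = j.succ}) := fun l =>
      (measurableSet_stayThenAt A n l).inter
        (measurableSet_eq_fun (measurable_pi_apply (n + 1)) measurable_const)
    rw [hsplit, measureReal_biUnion_finset ?_ fun l _ => hmeas l]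
    · rw [pow_succ, Matrix.mul_apply, Finset.sum_filter]
      refine Finset.sum_congr rfl fun l _ => ?_
      by_cases hl : l ∈ A
      · have hstep := chainLaw_real_inter_step hQ i.succ n
          {v | v ⟨n, Finset.mem_Iic.2 le_rfl⟩ = l.succ ∧
            ∀ m, ∀ hm : m < n, ∃ k ∈ A, v ⟨m, Finset.mem_Iic.2 hm.le⟩ = k.succ} l j
          fun v hv => hv.1
        rw [if_pos hl, ← ih l, rowRestrict, Matrix.of_apply, if_pos hl]
        exact hstep
      · simp [hl, rowRestrict]
    · intro l _ l' _ hne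
      refine Set.disjoint_left.2 ?_
      rintro w ⟨h1, -⟩ ⟨h2, -⟩
      exact hne (Fin.succ_injective _ (h1.1.symm.trans h2.1))

theorem chainHit_le_iff {A : Set (Fin (d + 1))} {w : ℕ → Fin (d + 1)} {n : ℕ} :
    chainHit A w ≤ (n : WithTop ℕ) ↔ ∃ m ≤ n, w m ∈ A := by
  refine (hittingAfter_le_iff (u := fun (n : ℕ) (v : ℕ → Fin (d + 1)) => v n) (i := n)).trans ?_
  simp

theorem chainHit_lt_iff {A : Set (Fin (d + 1))} {w : ℕ → Fin (d + 1)} {n : ℕ} :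
    chainHit A w < (n : WithTop ℕ) ↔ ∃ m < n, w m ∈ A := by
  refine (hittingAfter_lt_iff (u := fun (n : ℕ) (v : ℕ → Fin (d + 1)) => v n) (i := n)).trans ?_
  simp

/-- Avoiding both `S` and the cemetery `0` before time `n` means being at a site of `Sᶜ` at each
earlier time. -/
theorem chainHit_event_eq (S : Set (Fin d)) (j : Fin d) :
    {w : ℕ → Fin (d + 1) | ∃ n : ℕ, chainHit (Fin.succ '' S) w = n ∧
      chainHit (Fin.succ '' S) w < chainHit {0} w ∧ w n = j.succ} =
    ⋃ n, {w | w ∈ stayThenAt Sᶜ n j ∧ j ∈ S} := by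
  ext w
  simp only [Set.mem_ofPred_eq, Set.mem_iUnion]
  refine exists_congr fun n => ?_
  constructor
  · rintro ⟨h1, h2, h3⟩
    have hj : j ∈ S := by
      have h4 : chainHit (Fin.succ '' S) w ≤ (n : WithTop ℕ) := h1.le
      obtain ⟨m, hm, hmS⟩ := chainHit_le_iff.1 h4
      have h5 : chainHit (Fin.succ '' S) w ≤ (m : WithTop ℕ) := chainHit_le_iff.2 ⟨m, le_rfl, hmS⟩
      rw [h1] at h5
      have h6 : n ≤ m := by exact_mod_cast h5
      obtain rfl := le_antisymm h6 hm
      rw [h3] at hmS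
      obtain ⟨k, hk, hkj⟩ := hmS
      exact Fin.succ_injective _ hkj ▸ hk
    refine ⟨⟨h3, fun m hm => ?_⟩, hj⟩
    have h5 : w m ∉ Fin.succ '' S := fun h =>
      lt_irrefl _ (h1.symm.trans_lt (chainHit_lt_iff.2 ⟨m, hm, h⟩))
    have h6 : w m ≠ 0 := fun h =>
      lt_asymm h2 ((chainHit_lt_iff.2 ⟨m, hm, h⟩).trans_eq h1.symm)
    obtain ⟨k, hk⟩ := Fin.exists_succ_eq.2 h6
    exact ⟨k, fun hkS => h5 ⟨k, hkS, hk⟩, hk.symm⟩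
  · rintro ⟨⟨h3, h4⟩, hj⟩
    have h1 : chainHit (Fin.succ '' S) w = n := by
      refine le_antisymm (chainHit_le_iff.2 ⟨n, le_rfl, j, hj, h3.symm⟩) ?_
      by_contra! hlt
      obtain ⟨m, hm, k, hk, hkm⟩ := chainHit_lt_iff.1 hlt
      obtain ⟨k', hk', hkm'⟩ := h4 m hm
      exact hk' (Fin.succ_injective _ (hkm.trans hkm') ▸ hk)
    refine ⟨h1, ?_, h3⟩
    rw [h1]
    by_contra! hle
    obtain ⟨m, hm, hm0⟩ := chainHit_le_iff.1 hle
    rcases hm.lt_or_eq with h | rfl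
    · obtain ⟨k', -, hk'⟩ := h4 m h
      exact Fin.succ_ne_zero k' (hk'.symm.trans hm0)
    · exact Fin.succ_ne_zero j (h3.symm.trans hm0)

theorem hitMatrix_apply_of_notMem (hQ : IsSubstochastic Q) {S : Set (Fin d)} (i : Fin d)
    {j : Fin d} (hj : j ∉ S) : hitMatrix hQ S i j = 0 := by
  rw [hitMatrix, Matrix.of_apply, chainHit_event_eq]
  simp [hj]

theorem hitMatrix_apply_of_mem (hQ : IsSubstochastic Q) (hRQ : R = (1 - Q)ᵀ)
    (hR : HasNonnegInverse R) {S : Set (Fin d)} (i : Fin d) {j : Fin d} (hj : j ∈ S) :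
    hitMatrix hQ S i j = greenSeries (rowRestrict Q Sᶜ) i j := by
  rw [hitMatrix, Matrix.of_apply, chainHit_event_eq]
  simp only [hj, and_true, Set.ofPred_mem_eq]
  have hdisj : Pairwise (Function.onFun Disjoint fun n => stayThenAt Sᶜ n j) := by
    have : ∀ m n, m < n → Disjoint (stayThenAt Sᶜ m j) (stayThenAt Sᶜ n j) := by
      refine fun m n hmn => Set.disjoint_left.2 ?_
      rintro w ⟨h1, -⟩ ⟨-, h2⟩
      obtain ⟨k, hk, hwk⟩ := h2 m hmn
      exact hk (Fin.succ_injective _ (h1.symm.trans hwk) ▸ hj)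
    intro m n hne
    rcases hne.lt_or_gt with h | h
    exacts [this m n h, (this n m h).symm]
  have h := (greenSeries_apply (summable_rowRestrict_pow hQ hRQ hR Sᶜ) i j).tsum_eq
  rw [← h, Measure.real, measure_iUnion hdisj fun n => measurableSet_stayThenAt _ _ _,
    ENNReal.tsum_toReal_eq fun n => measure_ne_top _ _]
  exact tsum_congr fun n => chainLaw_real_stayThenAt hQ Sᶜ i n j

/-- With the rows in `S` erased the chain stops on `S`, so the Green series counts the single
arrival in columns `j ∈ S` and the visits `N` in the other columns. Thus `Λ(S)` is the series minus
`N`, and the series is `1 + NQ`. Transposing gives `R⁻¹Λ(S)ᵀ = R⁻¹ - Nᵀ`. -/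
theorem hitMatrix_eq (hQ : IsSubstochastic Q) (hRQ : R = (1 - Q)ᵀ) (hR : HasNonnegInverse R)
    (S : Set (Fin d)) : hitMatrix hQ S = 1 - greenOn Q Sᶜ * (1 - Q) := by
  have h := greenSeries_eq_one_add_greenOn_mul (summable_rowRestrict_pow hQ hRQ hR Sᶜ)
  have h2 : hitMatrix hQ S = greenSeries (rowRestrict Q Sᶜ) - greenOn Q Sᶜ := by
    ext i j
    by_cases hj : j ∈ S
    · rw [hitMatrix_apply_of_mem hQ hRQ hR i hj, Matrix.sub_apply,
        greenOn_apply_of_notMem Q i (by simpa using hj), sub_zero]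
    · rw [hitMatrix_apply_of_notMem hQ i hj, Matrix.sub_apply,
        greenOn_apply_of_mem Q i (by simpa using hj), sub_self]
  rw [h2, h, mul_sub, mul_one]
  abel

theorem isSubstochastic_hitMatrix (hQ : IsSubstochastic Q) (S : Set (Fin d)) :
    IsSubstochastic (hitMatrix hQ S) := by
  refine ⟨fun i j => measureReal_nonneg, fun i => ?_⟩
  simp only [hitMatrix, Matrix.of_apply]
  rw [← measureReal_biUnion_finset]
  · exact measureReal_le_one
  · intro j _ j' _ hne
    refine Set.disjoint_left.2 ?_
    rintro w ⟨n, h1, -, h2⟩ ⟨n', h1', -, h2'⟩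
    have hn : n = n' := by exact_mod_cast h1.symm.trans h1'
    subst hn
    exact hne (Fin.succ_injective _ (h2.symm.trans h2'))
  · intro j _
    rw [chainHit_event_eq]
    exact MeasurableSet.iUnion fun n => (measurableSet_stayThenAt _ n j).inter (.const _)

/-- The operator `R⁻¹ Λ(S)ᵀ R` leaves the coordinates in `S` unchanged. -/
theorem inv_mulVec_hitMatrix_apply (hQ : IsSubstochastic Q) (hRQ : R = (1 - Q)ᵀ)
    (hR : HasNonnegInverse R) {S : Set (Fin d)} (u : Fin d → ℝ) {i : Fin d} (hi : i ∈ S) :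
    (R⁻¹ *ᵥ ((hitMatrix hQ S)ᵀ *ᵥ u)) i = (R⁻¹ *ᵥ u) i := by
  have h1 : (hitMatrix hQ S)ᵀ = 1 - R * (greenOn Q Sᶜ)ᵀ := by
    rw [hitMatrix_eq hQ hRQ hR, Matrix.transpose_sub, Matrix.transpose_one, Matrix.transpose_mul,
      hRQ]
  rw [h1, Matrix.sub_mulVec, Matrix.one_mulVec, ← Matrix.mulVec_mulVec, Matrix.mulVec_sub,
    hR.inv_mulVec_mulVec, Pi.sub_apply]
  simp [Matrix.mulVec, dotProduct, greenOn_apply_of_notMem Q _ (show i ∉ Sᶜ by simpa using hi)]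

/-- Complements `inv_mulVec_hitMatrix_apply`: because `Λ(S)ᵀu` vanishes off `S`, the vector `w =
R⁻¹Λ(S)ᵀu` satisfies `w = Qᵀw` there. -/
theorem hitMatrix_transpose_mulVec_apply (hQ : IsSubstochastic Q) {S : Set (Fin d)}
    (u : Fin d → ℝ) {i : Fin d} (hi : i ∉ S) : ((hitMatrix hQ S)ᵀ *ᵥ u) i = 0 := by
  simp [Matrix.mulVec, dotProduct, hitMatrix_apply_of_notMem hQ _ hi]

end Chain

/-! ### Directional derivatives of the reflected path -/

section Derivative

variable {d : ℕ} {Q R : Matrix (Fin d) (Fin d) ℝ} {x : ℝ≥0 → Fin d → ℝ} {y v : Fin d → ℝ}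

/-- The right derivative at `ε = 0` of the regulator started from `y + ε v`. -/
noncomputable def regulatorDeriv (Q : Matrix (Fin d) (Fin d) ℝ) (y : Fin d → ℝ)
    (x : ℝ≥0 → Fin d → ℝ) (v : Fin d → ℝ) (t : ℝ≥0) (i : Fin d) : ℝ :=
  derivWithin (fun ε : ℝ => regulator Q (y + ε • v) x t i) (Set.Ioi 0) 0

/-- `R⁻¹` applied to the difference quotient of the reflected path in the direction `v`. -/
noncomputable def quotientPotential (Q R : Matrix (Fin d) (Fin d) ℝ) (y : Fin d → ℝ)
    (x : ℝ≥0 → Fin d → ℝ) (v : Fin d → ℝ) (ε : ℝ) (t : ℝ≥0) : Fin d → ℝ :=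
  R⁻¹ *ᵥ v - ε⁻¹ • (regulator Q y x t - regulator Q (y + ε • v) x t)

/-- `R⁻¹` applied to the derivative of the reflected path in the direction `v`. -/
noncomputable def derivPotential (Q R : Matrix (Fin d) (Fin d) ℝ) (y : Fin d → ℝ)
    (x : ℝ≥0 → Fin d → ℝ) (v : Fin d → ℝ) (t : ℝ≥0) : Fin d → ℝ :=
  R⁻¹ *ᵥ v + regulatorDeriv Q y x v t

theorem tendsto_quotientPotential (hQ : IsSubstochastic Q) (hRQ : R = (1 - Q)ᵀ)
    (hR : HasNonnegInverse R) (hx : Continuous x) (y v : Fin d → ℝ) (t : ℝ≥0) :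
    Tendsto (fun ε => quotientPotential Q R y x v ε t) (𝓝[>] 0)
      (𝓝 (derivPotential Q R y x v t)) := by
  rw [tendsto_pi_nhds]
  intro i
  have h1 := (regulator_convex hQ hRQ hR y v hx t i).differentiableWithinAt_Ioi_of_mem_interior
    (x := 0) (by simp) |>.hasDerivWithinAt
  rw [hasDerivWithinAt_iff_tendsto_slope' (by simp)] at h1
  refine (h1.const_add ((R⁻¹ *ᵥ v) i)).congr fun ε => ?_
  simp [quotientPotential, slope_def_field]
  ring

theorem reflection_sub_reflection (hRQ : R = (1 - Q)ᵀ) (hR : HasNonnegInverse R)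
    {ε : ℝ} (hε : ε ≠ 0) (t : ℝ≥0) :
    reflection Q (y + ε • v) x t - reflection Q y x t =
      ε • (R *ᵥ quotientPotential Q R y x v ε t) := by
  rw [quotientPotential, Matrix.mulVec_sub, hR.mulVec_inv_mulVec, Matrix.mulVec_smul, smul_sub,
    smul_smul, mul_inv_cancel₀ hε, one_smul, reflection, reflection, ← hRQ, Matrix.mulVec_sub]
  abel

/-- The drop `z` of the regulator satisfies `z ≤ Qᵀz + εv`, hence `z ≤ ε R⁻¹v` by the comparison
principle. -/
theorem quotientPotential_nonneg (hQ : IsSubstochastic Q) (hRQ : R = (1 - Q)ᵀ)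
    (hR : HasNonnegInverse R) (hx : Continuous x) (hv : ∀ i, 0 ≤ v i) {ε : ℝ} (hε : 0 < ε)
    (t : ℝ≥0) (i : Fin d) : 0 ≤ quotientPotential Q R y x v ε t i := by
  have h1 := hR.le_inv_mulVec hRQ (v := regulator Q y x t - regulator Q (y + ε • v) x t)
    (b := ε • v) (fun i => by
      have := regulator_sub_le hQ hRQ hR (y := y) (y' := y + ε • v)
        (fun i => by simpa using mul_nonneg hε.le (hv i)) hx t i
      simpa using this) i
  rw [Matrix.mulVec_smul, Pi.smul_apply, smul_eq_mul] at h1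
  simp only [quotientPotential, Pi.sub_apply, Pi.smul_apply, smul_eq_mul] at h1 ⊢
  rw [sub_nonneg, inv_mul_le_iff₀ hε]
  exact h1

theorem quotientPotential_antitone (hQ : IsSubstochastic Q) (hRQ : R = (1 - Q)ᵀ)
    (hR : HasNonnegInverse R) (hx : Continuous x) (hv : ∀ i, 0 ≤ v i) {ε : ℝ} (hε : 0 < ε)
    (i : Fin d) : Antitone fun t => quotientPotential Q R y x v ε t i := by
  intro s t hst
  have h1 := regulator_sub_monotone hQ hRQ hR (y := y) (y' := y + ε • v)
    (fun i => by simpa using mul_nonneg hε.le (hv i)) hx i hst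
  simp only [quotientPotential, Pi.sub_apply, Pi.smul_apply, smul_eq_mul] at h1 ⊢
  have := mul_le_mul_of_nonneg_left h1 (inv_nonneg.2 hε.le)
  linarith

theorem derivPotential_nonneg (hQ : IsSubstochastic Q) (hRQ : R = (1 - Q)ᵀ)
    (hR : HasNonnegInverse R) (hx : Continuous x) (hv : ∀ i, 0 ≤ v i) (t : ℝ≥0) (i : Fin d) :
    0 ≤ derivPotential Q R y x v t i :=
  ge_of_tendsto (tendsto_pi_nhds.1 (tendsto_quotientPotential hQ hRQ hR hx y v t) i) <|
    eventually_nhdsWithin_of_forall fun _ hε =>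
      quotientPotential_nonneg hQ hRQ hR hx hv hε t i

theorem derivPotential_antitone (hQ : IsSubstochastic Q) (hRQ : R = (1 - Q)ᵀ)
    (hR : HasNonnegInverse R) (hx : Continuous x) (hv : ∀ i, 0 ≤ v i) (i : Fin d) :
    Antitone fun t => derivPotential Q R y x v t i := fun s t hst =>
  le_of_tendsto_of_tendsto
    (tendsto_pi_nhds.1 (tendsto_quotientPotential hQ hRQ hR hx y v t) i)
    (tendsto_pi_nhds.1 (tendsto_quotientPotential hQ hRQ hR hx y v s) i) <|
    eventually_nhdsWithin_of_forall fun _ hε =>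
      quotientPotential_antitone hQ hRQ hR hx hv hε i hst

theorem derivPotential_le_inv (hQ : IsSubstochastic Q) (hRQ : R = (1 - Q)ᵀ)
    (hR : HasNonnegInverse R) (hx : Continuous x) (hv : ∀ i, 0 ≤ v i) (t : ℝ≥0) (i : Fin d) :
    derivPotential Q R y x v t i ≤ (R⁻¹ *ᵥ v) i := by
  refine le_of_tendsto (tendsto_pi_nhds.1 (tendsto_quotientPotential hQ hRQ hR hx y v t) i) <|
    eventually_nhdsWithin_of_forall fun ε (hε : 0 < ε) => ?_
  have h1 := regulator_antitone hQ hRQ hR (y := y) (y' := y + ε • v)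
    (fun i => by simpa using mul_nonneg hε.le (hv i)) hx t i
  simp only [quotientPotential, Pi.sub_apply, Pi.smul_apply, smul_eq_mul]
  have := mul_nonneg (inv_nonneg.2 hε.le) (sub_nonneg.2 h1)
  linarith

/-- If `L_i` increases on `[r, t]`, then during that time the mass at the site `i` is
redistributed according to `Q`. -/
theorem derivPotential_le_of_regulator_lt (hQ : IsSubstochastic Q) (hRQ : R = (1 - Q)ᵀ)
    (hR : HasNonnegInverse R) (hx : Continuous x) (hx0 : x 0 = 0) (hy : ∀ i, 0 ≤ y i)
    (hv : ∀ i, 0 ≤ v i) {r t : ℝ≥0} (hrt : r ≤ t) {i : Fin d}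
    (hlt : regulator Q y x r i < regulator Q y x t i) :
    derivPotential Q R y x v t i ≤ (Qᵀ *ᵥ derivPotential Q R y x v r) i := by
  have hlim : Tendsto (fun ε => (Qᵀ *ᵥ quotientPotential Q R y x v ε r) i) (𝓝[>] 0)
      (𝓝 ((Qᵀ *ᵥ derivPotential Q R y x v r) i)) := by
    simp only [Matrix.mulVec, dotProduct]
    exact tendsto_finsetSum _ fun j _ =>
      (tendsto_pi_nhds.1 (tendsto_quotientPotential hQ hRQ hR hx y v r) j).const_mul _
  have hsmall : ∀ᶠ ε : ℝ in 𝓝[>] 0,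
      ε * (R⁻¹ *ᵥ v) i < regulator Q y x t i - regulator Q y x r i := by
    have : Tendsto (fun ε : ℝ => ε * (R⁻¹ *ᵥ v) i) (𝓝[>] 0) (𝓝 (0 * (R⁻¹ *ᵥ v) i)) :=
      (tendsto_id.mul_const _).mono_left nhdsWithin_le_nhds
    rw [zero_mul] at this
    exact this.eventually_lt_const (sub_pos.2 hlt)
  refine le_of_tendsto_of_tendsto
    (tendsto_pi_nhds.1 (tendsto_quotientPotential hQ hRQ hR hx y v t) i) hlim ?_
  filter_upwards [hsmall, self_mem_nhdsWithin] with ε hsm (hε : 0 < ε)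
  have hyy : ∀ i, y i ≤ (y + ε • v) i := fun i => by simpa using mul_nonneg hε.le (hv i)
  have hsol := isSkorokhodSolution_reflection hQ hRQ hR hx hx0 hy
  have hsol' := isSkorokhodSolution_reflection hQ hRQ hR hx hx0 fun i => (hy i).trans (hyy i)
  -- The perturbed regulator is at most `L_i(r)` at time `r` and at least `L_i(t) - ε(R⁻¹v)_i` at
  -- time `t`, so for small `ε` it still increases on `[r, t]`.
  have hincr : regulator Q (y + ε • v) x r i ≠ regulator Q (y + ε • v) x t i := by
    have h1 := regulator_antitone hQ hRQ hR hyy hx r i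
    have h2 := quotientPotential_nonneg (y := y) hQ hRQ hR hx hv hε t i
    simp only [quotientPotential, Pi.sub_apply, Pi.smul_apply, smul_eq_mul] at h2
    rw [sub_nonneg, inv_mul_le_iff₀ hε] at h2
    intro h
    linarith
  -- The increase forces the perturbed path to touch zero at some `s`. The unperturbed one is
  -- nonnegative, so the difference quotient is nonpositive at `s`; monotonicity of the potential
  -- carries this from `s` to `t` on the left and to `r` on the right.
  obtain ⟨s, hrs, hst, hs⟩ : ∃ s, r ≤ s ∧ s ≤ t ∧ reflection Q (y + ε • v) x s i ≤ 0 := by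
    by_contra! hcon
    exact hincr (hsol'.flat hx hrt hcon)
  have h3 : (R *ᵥ quotientPotential Q R y x v ε s) i ≤ 0 := by
    have h4 := congrFun (reflection_sub_reflection (x := x) (y := y) (v := v) hRQ hR hε.ne' s) i
    simp only [Pi.sub_apply, Pi.smul_apply, smul_eq_mul] at h4
    have h5 := hsol.nonneg s i
    by_contra! hpos
    have := mul_pos hε hpos
    linarith
  rw [mulVec_reflection hRQ] at h3
  calc quotientPotential Q R y x v ε t i ≤ quotientPotential Q R y x v ε s i :=
        quotientPotential_antitone hQ hRQ hR hx hv hε i hst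
    _ ≤ (Qᵀ *ᵥ quotientPotential Q R y x v ε s) i := by linarith
    _ ≤ (Qᵀ *ᵥ quotientPotential Q R y x v ε r) i :=
        mulVec_mono hQ.transpose_nonneg
          (fun j => quotientPotential_antitone hQ hRQ hR hx hv hε j hrs) i

/-- At time `s`, every coordinate at zero is about to be pushed. -/
def IsPushTime (Q : Matrix (Fin d) (Fin d) ℝ) (y : Fin d → ℝ) (x : ℝ≥0 → Fin d → ℝ)
    (s : ℝ≥0) : Prop :=
  ∀ i, reflection Q y x s i = 0 → ∀ t, s < t → regulator Q y x s i < regulator Q y x t i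

/-- One factor of the product. The maximum principle compares the right limit `ζ` of the potential
at `s` with the solution `w` of the Dirichlet problem. -/
theorem derivPotential_le_hitMatrix (hQ : IsSubstochastic Q) (hRQ : R = (1 - Q)ᵀ)
    (hR : HasNonnegInverse R) (hx : Continuous x) (hx0 : x 0 = 0) (hy : ∀ i, 0 ≤ y i)
    (hv : ∀ i, 0 ≤ v i) {s t : ℝ≥0} (hst : s < t) (hs : IsPushTime Q y x s)
    {u : Fin d → ℝ} (hu : ∀ i, derivPotential Q R y x v s i ≤ (R⁻¹ *ᵥ u) i) (i : Fin d) :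
    derivPotential Q R y x v t i ≤
      (R⁻¹ *ᵥ ((hitMatrix hQ {j | reflection Q y x s j ≠ 0})ᵀ *ᵥ u)) i := by
  set S : Set (Fin d) := {j | reflection Q y x s j ≠ 0}
  set w := R⁻¹ *ᵥ ((hitMatrix hQ S)ᵀ *ᵥ u)
  have hanti := fun i => derivPotential_antitone (y := y) hQ hRQ hR hx hv i
  set ζ : Fin d → ℝ := fun i => ⨆ r : Set.Ioi s, derivPotential Q R y x v r i
  have hbdd : ∀ i, BddAbove (Set.range fun r : Set.Ioi s => derivPotential Q R y x v r i) := by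
    refine fun i => ⟨derivPotential Q R y x v s i, ?_⟩
    rintro _ ⟨r, rfl⟩
    exact hanti i (le_of_lt r.2)
  have hle : ∀ r, s < r → ∀ i, derivPotential Q R y x v r i ≤ ζ i := fun r hr i =>
    le_ciSup (hbdd i) ⟨r, hr⟩
  have : Nonempty (Set.Ioi s) := ⟨⟨t, hst⟩⟩
  have hin : ∀ i ∈ S, ζ i ≤ w i := fun i hi => ciSup_le fun r => by
    exact ((hanti i (le_of_lt r.2)).trans (hu i)).trans_eq
      (inv_mulVec_hitMatrix_apply hQ hRQ hR u hi).symm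
  have hout : ∀ i ∉ S, ζ i ≤ (Qᵀ *ᵥ ζ) i := fun i hi => ciSup_le fun r => by
    have hi0 : reflection Q y x s i = 0 := by simpa [S] using hi
    have hlt := hs i hi0 r r.2
    have hcont : Continuous fun r => regulator Q y x r i :=
      (continuous_apply i).comp (continuous_regulator hQ hRQ hR y hx)
    have hev : ∀ᶠ q in 𝓝[>] s, regulator Q y x q i < regulator Q y x r i :=
      (hcont.tendsto s).mono_left nhdsWithin_le_nhds |>.eventually_lt_const hlt
    -- The comparison starts at some `q > s`, because `ζ` bounds the potential only strictly after
    -- `s`; continuity of `L_i` leaves part of the increase in `[q, r]`.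
    obtain ⟨q, ⟨hq1, hq2⟩, hsq⟩ :=
      ((hev.and (Ioo_mem_nhdsGT (show s < r from r.2))).and self_mem_nhdsWithin).exists
    exact (derivPotential_le_of_regulator_lt hQ hRQ hR hx hx0 hy hv hq2.2.le hq1).trans
      (mulVec_mono hQ.transpose_nonneg (fun j => hle q hsq j) i)
  have hwout : ∀ i ∉ S, w i = (Qᵀ *ᵥ w) i := fun i hi => by
    have := hR.inv_mulVec_eq hRQ ((hitMatrix hQ S)ᵀ *ᵥ u) i
    rwa [hitMatrix_transpose_mulVec_apply hQ u hi, add_zero] at this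
  -- The positive part of `ζ - w` vanishes on `S` and is at most its image under `Qᵀ` off `S`.
  have hmax := hR.nonpos_of_le hRQ (v := fun i => max (ζ i - w i) 0) fun i => by
    have hnn : 0 ≤ (Qᵀ *ᵥ fun i => max (ζ i - w i) 0) i :=
      mulVec_nonneg_of_nonneg hQ.transpose_nonneg (fun _ => le_max_right _ _) i
    refine max_le ?_ hnn
    by_cases hi : i ∈ S
    · exact (sub_nonpos.2 (hin i hi)).trans hnn
    · have h1 := mulVec_mono (v := ζ - w) (w := fun i => max (ζ i - w i) 0)
        hQ.transpose_nonneg (fun j => le_max_left _ _) i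
      rw [Matrix.mulVec_sub, Pi.sub_apply] at h1
      linarith [hout i hi, hwout i hi]
  exact (hle t hst i).trans (sub_nonpos.1 ((le_max_left _ _).trans (hmax i)))

theorem derivPotential_le_prod (hQ : IsSubstochastic Q) (hRQ : R = (1 - Q)ᵀ)
    (hR : HasNonnegInverse R) (hx : Continuous x) (hx0 : x 0 = 0) (hy : ∀ i, 0 ≤ y i)
    (hv : ∀ i, 0 ≤ v i) (l : List ℝ≥0) (hl : l.Pairwise (· > ·))
    (hpush : ∀ s ∈ l, IsPushTime Q y x s) {t : ℝ≥0} (ht : ∀ s ∈ l, s < t) (i : Fin d) :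
    derivPotential Q R y x v t i ≤
      (R⁻¹ *ᵥ ((l.map fun s => (hitMatrix hQ {j | reflection Q y x s j ≠ 0})ᵀ).prod *ᵥ v)) i := by
  induction l generalizing t i with
  | nil => simpa using derivPotential_le_inv hQ hRQ hR hx hv t i
  | cons s l ih =>
    rw [List.pairwise_cons] at hl
    rw [List.map_cons, List.prod_cons, ← Matrix.mulVec_mulVec]
    exact derivPotential_le_hitMatrix hQ hRQ hR hx hx0 hy hv (ht s (by simp))
      (hpush s (by simp)) (fun i => ih hl.2 (fun r hr => hpush r (by simp [hr]))
        (fun r hr => hl.1 r hr) i) i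

/-- The derivative matrix of the reflected path exists and is dominated by the product of the
hitting matrices over any finite set of earlier push times. -/
theorem exists_isDerivativeMatrix_le (hQ : IsSubstochastic Q) (hRQ : R = (1 - Q)ᵀ)
    (hR : HasNonnegInverse R) (hx : Continuous x) (hx0 : x 0 = 0) (hy : ∀ i, 0 ≤ y i)
    (F : Finset ℝ≥0) (hF : ∀ s ∈ F, IsPushTime Q y x s) {t : ℝ≥0} (ht : ∀ s ∈ F, s < t) :
    ∃ D : Matrix (Fin d) (Fin d) ℝ, IsDerivativeMatrix R y x t D ∧
      ∀ i j, D i j ≤ (R⁻¹ * epochProduct hQ (reflectedPath R y x) F) i j := by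
  have hsing : ∀ j i : Fin d, (0 : ℝ) ≤ (Pi.single j 1 : Fin d → ℝ) i := fun j i => by
    rw [Pi.single_apply]; split <;> norm_num
  have hrefl := reflectedPath_eq_reflection hQ hRQ hR hx hx0 hy
  set D : Matrix (Fin d) (Fin d) ℝ :=
    Matrix.of fun i j => (R *ᵥ derivPotential Q R y x (Pi.single j 1) t) i with hD
  have hcol : ∀ j, D *ᵥ Pi.single j 1 = R *ᵥ derivPotential Q R y x (Pi.single j 1) t :=
    fun j => by rw [Matrix.mulVec_single_one]; rfl
  refine ⟨D, fun j => ?_, fun i j => ?_⟩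
  · rw [hcol]
    have hlim : Tendsto (fun ε => R *ᵥ quotientPotential Q R y x (Pi.single j 1) ε t) (𝓝[>] 0)
        (𝓝 (R *ᵥ derivPotential Q R y x (Pi.single j 1) t)) :=
      ((Continuous.matrix_mulVec continuous_const continuous_id).tendsto _).comp
        (tendsto_quotientPotential hQ hRQ hR hx y _ t)
    refine hlim.congr' ?_
    filter_upwards [self_mem_nhdsWithin] with ε (hε : 0 < ε)
    rw [hrefl, reflectedPath_eq_reflection hQ hRQ hR hx hx0 fun i => ?_,
      reflection_sub_reflection hRQ hR hε.ne', smul_smul, inv_mul_cancel₀ hε.ne', one_smul]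
    have := mul_nonneg hε.le (hsing j i)
    simpa using add_nonneg (hy i) this
  · have h1 := derivPotential_le_prod hQ hRQ hR hx hx0 hy (hsing j) (F.sort (· ≥ ·))
      (Finset.sortedGT_sort F).pairwise (fun s hs => hF s ((Finset.mem_sort _).1 hs))
      (fun s hs => ht s ((Finset.mem_sort _).1 hs)) i
    -- The derivative is `w - Qᵀw`; the second term is dropped, and the bound on `w` remains.
    have h2 : (0 : ℝ) ≤ (Qᵀ *ᵥ derivPotential Q R y x (Pi.single j 1) t) i :=
      mulVec_nonneg_of_nonneg hQ.transpose_nonneg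
        (derivPotential_nonneg hQ hRQ hR hx (hsing j) t) i
    rw [Matrix.mulVec_mulVec, Matrix.mulVec_single_one] at h1
    rw [hD, Matrix.of_apply, mulVec_reflection hRQ, hrefl]
    have h3 : ∀ M : Matrix (Fin d) (Fin d) ℝ, M.col j i = M i j := fun _ => rfl
    rw [h3] at h1
    rw [epochProduct]
    linarith

end Derivative

/-! ### Push times and interior times from the fluctuations of the driving path -/

section Fluctuation

variable {d : ℕ} {Q R : Matrix (Fin d) (Fin d) ℝ} {x : ℝ≥0 → Fin d → ℝ} {y : Fin d → ℝ}

/-- Without a push at `i`, the increments of the regulator could only lower `Y_i`, through `-Qᵀ`. A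
drop of `x_i` below its value at `s` would then make `Y_i` negative. -/
theorem isPushTime_of_fluctuation (hQ : IsSubstochastic Q) (hRQ : R = (1 - Q)ᵀ)
    (hR : HasNonnegInverse R) (hx : Continuous x) (hx0 : x 0 = 0) (hy : ∀ i, 0 ≤ y i)
    {s : ℝ≥0} (h : ∀ i, ∀ t, s < t → ∃ u, s ≤ u ∧ u ≤ t ∧ x u i < x s i) :
    IsPushTime Q y x s := by
  intro i hi t hst
  by_contra! hle
  have hsol := isSkorokhodSolution_reflection hQ hRQ hR hx hx0 hy
  obtain ⟨u, hsu, hut, hxu⟩ := h i t hst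
  have hL : regulator Q y x u i ≤ regulator Q y x s i := (hsol.mono i hut).trans hle
  have hLQ := mulVec_mono hQ.transpose_nonneg (fun j => hsol.mono j hsu) i
  have h1 := hsol.nonneg u i
  rw [hsol.eq_apply hRQ] at h1 hi
  simp only at hLQ
  linarith

/-- Replaces invertibility of `C`. If `CᵀN = 0`, then `Cᵀ` times the Green series `1 + NQ` is `Cᵀ`;
in a column `i ∈ A` the series agrees with `N`, so row `i` of `C` vanishes. -/
theorem exists_greenOn_ne_zero (hQ : IsSubstochastic Q) (hRQ : R = (1 - Q)ᵀ)
    (hR : HasNonnegInverse R) {C : Matrix (Fin d) (Fin d) ℝ} {A : Set (Fin d)} {i : Fin d}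
    (hi : i ∈ A) (hC : C i ≠ 0) : ∃ k ∈ A, Cᵀ *ᵥ (greenOn Q A).col k ≠ 0 := by
  by_contra! hcon
  have hzero : Cᵀ * greenOn Q A = 0 := by
    ext l k
    by_cases hk : k ∈ A
    · exact congrFun (hcon k hk) l
    · rw [Matrix.mul_apply]
      simp [greenOn_apply_of_notMem Q _ hk]
  have h1 := greenSeries_eq_one_add_greenOn_mul (summable_rowRestrict_pow hQ hRQ hR A)
  have h2 : Cᵀ * greenSeries (rowRestrict Q A) = Cᵀ := by
    rw [h1, mul_add, mul_one, ← mul_assoc, hzero, zero_mul, add_zero]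
  apply hC
  funext l
  have h3 : (Cᵀ * greenOn Q A) l i = (Cᵀ * greenSeries (rowRestrict Q A)) l i := by
    rw [Matrix.mul_apply, Matrix.mul_apply]
    exact Finset.sum_congr rfl fun k _ => by rw [greenOn_apply_of_mem Q k hi]
  rw [hzero, h2] at h3
  exact h3.symm

/-- Let `A` be the set of coordinates vanishing at `t`, and `v ≥ 0` a Green column supported in `A`.
Just before `t` the regulator is flat off `A`, and `(1 - Q)v ≥ 0` on `A`, so reflection can only
increase `v ⬝ᵥ Y`. Hence `v ⬝ᵥ Y` would strictly increase up to `t` whenever `v ⬝ᵥ x` does, yet it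
is zero at `t` and nonnegative before. -/
theorem reflection_ne_zero_of_fluctuation (hQ : IsSubstochastic Q) (hRQ : R = (1 - Q)ᵀ)
    (hR : HasNonnegInverse R) (hx : Continuous x) (hx0 : x 0 = 0) (hy : ∀ i, 0 ≤ y i)
    {C : Matrix (Fin d) (Fin d) ℝ} (hC : ∀ i, C i ≠ 0) {t : ℝ≥0} (ht : 0 < t)
    (h : ∀ A : Set (Fin d), ∀ k, Cᵀ *ᵥ (greenOn Q A).col k ≠ 0 →
      ∀ r < t, ∃ u, r ≤ u ∧ u ≤ t ∧ 0 < (greenOn Q A).col k ⬝ᵥ (x t - x u))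
    (i : Fin d) : reflection Q y x t i ≠ 0 := by
  intro hi
  have hsol := isSkorokhodSolution_reflection hQ hRQ hR hx hx0 hy
  have hYc := hsol.continuous_path hx
  set A : Set (Fin d) := {k | reflection Q y x t k = 0} with hA
  obtain ⟨k, hk, hkC⟩ := exists_greenOn_ne_zero hQ hRQ hR (show i ∈ A from hi) (hC i)
  set v := (greenOn Q A).col k with hv
  have hv0 : ∀ l, 0 ≤ v l := fun l => greenOn_nonneg hQ hRQ hR A l k
  have hM := summable_rowRestrict_pow hQ hRQ hR A
  have hev : ∀ᶠ u in 𝓝 t, ∀ l, l ∉ A → 0 < reflection Q y x u l := by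
    rw [eventually_all]
    intro l
    by_cases hl : l ∈ A
    · simp [hl]
    · have hpos : 0 < reflection Q y x t l := lt_of_le_of_ne (hsol.nonneg t l) (Ne.symm hl)
      filter_upwards [(((continuous_apply l).comp hYc).tendsto t).eventually_const_lt hpos]
        with u hu _ using hu
  obtain ⟨r, hrt, hr⟩ : ∃ r < t, ∀ u, r < u → u ≤ t → ∀ l, l ∉ A → 0 < reflection Q y x u l := by
    obtain ⟨r, hr, hsub⟩ := exists_Ioc_subset_of_mem_nhds hev ⟨0, ht⟩
    exact ⟨r, hr, fun u h1 h2 => hsub ⟨h1, h2⟩⟩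
  obtain ⟨r', hr', hrt'⟩ := exists_between hrt
  obtain ⟨u, hru, hut, hpos⟩ := h A k hkC r' hrt'
  have hflat : ∀ l ∉ A, regulator Q y x u l = regulator Q y x t l := fun l hl =>
    hsol.flat hx hut fun w h1 h2 => hr w (hr'.trans_le (hru.trans h1)) h2 l hl
  have h1 : v ⬝ᵥ (reflection Q y x t - reflection Q y x u) =
      v ⬝ᵥ (x t - x u) + ((1 - Q) *ᵥ v) ⬝ᵥ (regulator Q y x t - regulator Q y x u) := by
    rw [← Matrix.vecMul_transpose, ← Matrix.dotProduct_mulVec, ← dotProduct_add, reflection,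
      reflection, Matrix.mulVec_sub]
    congr 1
    abel
  have h2 : 0 ≤ ((1 - Q) *ᵥ v) ⬝ᵥ (regulator Q y x t - regulator Q y x u) := by
    refine Finset.sum_nonneg fun l _ => ?_
    by_cases hl : l ∈ A
    · have h3 : ((1 - Q) *ᵥ v) l = (1 : Matrix (Fin d) (Fin d) ℝ) l k := by
        have := greenOn_row_eq (Q := Q) hM hl hk
        rw [Matrix.sub_mulVec, Matrix.one_mulVec, Pi.sub_apply]
        simp only [Matrix.mulVec, dotProduct, hv, Matrix.col_apply]
        linarith
      rw [h3, Matrix.one_apply]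
      have h4 : regulator Q y x u l ≤ regulator Q y x t l := hsol.mono l hut
      refine mul_nonneg (by split <;> norm_num) (sub_nonneg.2 h4)
    · rw [Pi.sub_apply, hflat l hl, sub_self, mul_zero]
  have h3 : v ⬝ᵥ (reflection Q y x t - reflection Q y x u) ≤ 0 := by
    refine Finset.sum_nonpos fun l _ => ?_
    by_cases hl : l ∈ A
    · have h5 : reflection Q y x t l = 0 := hl
      rw [Pi.sub_apply, h5]
      exact mul_nonpos_of_nonneg_of_nonpos (hv0 l) (by linarith [hsol.nonneg u l])
    · have : v l = 0 := greenOn_row_eq_zero hM hl hk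
      rw [this, zero_mul]
  linarith

end Fluctuation

/-! ### Reduction of the epochs to first hitting times after rational times -/

/-- `inf {s ≥ q : Y_i(s) = 0}`, with value `∞` if there is no such `s`. -/
noncomputable def zeroTime {d : ℕ} (Y : ℝ≥0 → Fin d → ℝ) (i : Fin d) (q : ℝ≥0) : ℝ≥0∞ :=
  sInf {r | ∃ s : ℝ≥0, r = s ∧ q ≤ s ∧ Y s i = 0}

/-- Natural numbers, and zero times after rational times shifted by natural numbers. -/
def IsShiftedZeroTime {d : ℕ} (Y : ℝ≥0 → Fin d → ℝ) (r : ℝ≥0∞) : Prop :=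
  (∃ n : ℕ, r = n) ∨ ∃ (i : Fin d) (q : ℚ≥0) (n : ℕ), r = zeroTime Y i q + n

section Epochs

variable {d : ℕ} {Y : ℝ≥0 → Fin d → ℝ}

theorem IsShiftedZeroTime.add_one {r : ℝ≥0∞} (h : IsShiftedZeroTime Y r) :
    IsShiftedZeroTime Y (r + 1) := by
  rcases h with ⟨n, rfl⟩ | ⟨i, q, n, rfl⟩
  · exact Or.inl ⟨n + 1, by push_cast; rfl⟩
  · exact Or.inr ⟨i, q, n + 1, by push_cast; rw [add_assoc]⟩

/-- Either the infimum is `a + 1` itself, or a rational `q` fits strictly between; no zero lies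
between `a + 1` and `q`, so the infimum is the first zero after `q`. This reduces all epochs to
countably many stopping times. -/
theorem isShiftedZeroTime_firstZeroAfter {a : ℝ≥0∞} (ha : IsShiftedZeroTime Y a) (i : Fin d) :
    IsShiftedZeroTime Y (firstZeroAfter Y i a) := by
  have hle : a + 1 ≤ firstZeroAfter Y i a := by
    refine le_sInf ?_
    rintro r ⟨s, rfl, h, -⟩
    exact h.le
  rcases hle.eq_or_lt with h | h
  · exact h ▸ ha.add_one
  · obtain ⟨q, hq0, hq1, hq2⟩ := ENNReal.lt_iff_exists_rat_btwn.1 h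
    lift q to ℚ≥0 using hq0
    have hcast : Real.toNNReal ((q : ℚ) : ℝ) = (q : ℝ≥0) := by
      ext
      exact (Real.coe_toNNReal _ (by positivity)).trans (by norm_cast)
    rw [hcast] at hq1 hq2
    refine Or.inr ⟨i, q, 0, ?_⟩
    rw [Nat.cast_zero, add_zero]
    refine le_antisymm (le_sInf ?_) (le_sInf ?_)
    · rintro _ ⟨s, rfl, h1, h2⟩
      exact sInf_le ⟨s, rfl, hq1.trans_le (ENNReal.coe_le_coe.2 h1), h2⟩
    · rintro _ ⟨s, rfl, h1, h2⟩
      refine sInf_le ⟨s, rfl, ?_, h2⟩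
      exact ENNReal.coe_le_coe.1 (hq2.le.trans (sInf_le ⟨s, rfl, h1, h2⟩))

theorem isShiftedZeroTime_eta (Y : ℝ≥0 → Fin d → ℝ) (k : ℕ) : IsShiftedZeroTime Y (eta Y k) := by
  induction k with
  | zero => exact Or.inl ⟨0, by simp [eta]⟩
  | succ k ih =>
    rw [eta]
    rcases isEmpty_or_nonempty (Fin d) with h | h
    -- For `d = 0` the supremum over coordinates is empty and equals `0`.
    · exact Or.inl ⟨0, by simp⟩
    · obtain ⟨i, hi⟩ := exists_eq_ciSup_of_finite (f := fun i => firstZeroAfter Y i (eta Y k))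
      rw [← hi]
      exact isShiftedZeroTime_firstZeroAfter ih i

theorem isShiftedZeroTime_etaCoord (Y : ℝ≥0 → Fin d → ℝ) (i : Fin d) (k : ℕ) :
    IsShiftedZeroTime Y (etaCoord Y i k) :=
  isShiftedZeroTime_firstZeroAfter (isShiftedZeroTime_eta Y k) i

/-- The infimum may equal `η^k + 1`, which the strict inequality excludes, so in general `s` is only
a limit of zeros from the right. -/
theorem apply_eq_zero_of_eq_etaCoord (hY : Continuous Y) {s : ℝ≥0} {i : Fin d} {k : ℕ}
    (h : (s : ℝ≥0∞) = etaCoord Y i k) : Y s i = 0 := by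
  have hcl : IsClosed {u | Y u i = 0} :=
    isClosed_eq ((continuous_apply i).comp hY) continuous_const
  refine hcl.closure_subset_iff.2 (fun u (hu : u ∈ {u : ℝ≥0 | s ≤ u ∧ Y u i = 0}) => hu.2) ?_
  rw [Metric.mem_closure_iff]
  intro ε hε
  have hlt : etaCoord Y i k < s + ENNReal.ofReal ε := by
    rw [← h]
    exact ENNReal.lt_add_right ENNReal.coe_ne_top (by simpa using hε)
  obtain ⟨_, ⟨u, rfl, h1, h2⟩, h3⟩ := sInf_lt_iff.1 hlt
  have hsu : s ≤ u := by
    rw [← ENNReal.coe_le_coe, h]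
    exact sInf_le ⟨u, rfl, h1, h2⟩
  refine ⟨u, ⟨hsu, h2⟩, ?_⟩
  have h4 : u < s + ε.toNNReal := by
    rw [ENNReal.ofReal, ← ENNReal.coe_add] at h3
    exact ENNReal.coe_lt_coe.1 h3
  have h5 : (u : ℝ) < s + ε.toNNReal := by exact_mod_cast h4
  rw [Real.coe_toNNReal _ hε.le] at h5
  have h6 : (s : ℝ) ≤ u := hsu
  rw [NNReal.dist_eq, abs_lt]
  constructor <;> linarith

/-- A description of `{zeroTime ≤ r}` by countably many values of a continuous path. -/
theorem zeroTime_le_iff (hY : Continuous Y) (h0 : ∀ t i, 0 ≤ Y t i) (i : Fin d) (q r : ℝ≥0) :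
    zeroTime Y i q ≤ r ↔
      q ≤ r ∧ ∀ m : ℕ, ∃ u : ℚ≥0, Y (max q (min u r)) i < 1 / ((m : ℝ) + 1) := by
  have hYi : Continuous fun s => Y s i := (continuous_apply i).comp hY
  constructor
  · intro h
    obtain ⟨s, hqs, hsr, hs⟩ : ∃ s, q ≤ s ∧ s ≤ r ∧ Y s i = 0 := by
      by_contra! hcon
      have hne : ∀ s ∈ {s : ℝ≥0 | q ≤ s ∧ Y s i = 0}, r < s := fun s hs => by
        by_contra! hle
        exact hcon s hs.1 hle hs.2
      have hcl : IsClosed {s : ℝ≥0 | q ≤ s ∧ Y s i = 0} :=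
        isClosed_Ici.inter (isClosed_eq hYi continuous_const)
      rcases Set.eq_empty_or_nonempty {s : ℝ≥0 | q ≤ s ∧ Y s i = 0} with he | hn
      · have : zeroTime Y i q = ⊤ := by
          refine sInf_eq_top.2 ?_
          rintro _ ⟨s, rfl, hs⟩
          exact absurd (show s ∈ {s : ℝ≥0 | q ≤ s ∧ Y s i = 0} from hs) (he ▸ Set.notMem_empty s)
        rw [this] at h
        exact absurd h (by simp)
      · have hmem := hcl.csInf_mem hn (OrderBot.bddBelow _)
        have hlow : ((sInf {s : ℝ≥0 | q ≤ s ∧ Y s i = 0} : ℝ≥0) : ℝ≥0∞) ≤ zeroTime Y i q := by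
          refine le_sInf ?_
          rintro _ ⟨s, rfl, hs⟩
          exact ENNReal.coe_le_coe.2 (csInf_le (OrderBot.bddBelow _) hs)
        exact absurd (ENNReal.coe_le_coe.1 (hlow.trans h)) (not_le.2 (hne _ hmem))
    refine ⟨hqs.trans hsr, fun m => ?_⟩
    have hopen : IsOpen {u : ℝ≥0 | Y (max q (min u r)) i < 1 / ((m : ℝ) + 1)} :=
      isOpen_lt (by fun_prop) continuous_const
    have hne : {u : ℝ≥0 | Y (max q (min u r)) i < 1 / ((m : ℝ) + 1)}.Nonempty := ⟨s, by
      simp only [Set.mem_ofPred_eq, min_eq_left hsr, max_eq_right hqs, hs]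
      positivity⟩
    obtain ⟨u, hu⟩ := denseRange_nnratCast.exists_mem_open hopen hne
    exact ⟨u, hu⟩
  · rintro ⟨hqr, h⟩
    obtain ⟨s, hs, hmin⟩ := (isCompact_Icc (a := q) (b := r)).exists_isMinOn
      ⟨q, le_rfl, hqr⟩ hYi.continuousOn
    have hs0 : Y s i = 0 := by
      by_contra hne
      obtain ⟨m, hm⟩ := exists_nat_one_div_lt (lt_of_le_of_ne (h0 s i) (Ne.symm hne))
      obtain ⟨u, hu⟩ := h m
      have : Y s i ≤ Y (max q (min u r)) i :=
        hmin ⟨le_max_left _ _, max_le hqr (min_le_right _ _)⟩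
      linarith
    have hle : zeroTime Y i q ≤ s := sInf_le ⟨s, rfl, hs.1, hs0⟩
    exact hle.trans (ENNReal.coe_le_coe.2 hs.2)

end Epochs

/-! ### Fluctuations of Brownian motion -/

section Fluctuations

variable {Ω : Type*} [MeasurableSpace Ω] {P : Measure Ω} {V : ℝ≥0 → Ω → ℝ}

theorem gaussianReal_Iio_neg_sqrt (v : ℝ≥0) (hv : v ≠ 0) :
    gaussianReal 0 v (Set.Iio (-√(v : ℝ))) = gaussianReal 0 1 (Set.Iio (-1)) := by
  have hpos : 0 < √(v : ℝ) := Real.sqrt_pos.2 (by positivity)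
  have hmap : (gaussianReal 0 1).map (√(v : ℝ) * ·) = gaussianReal 0 v := by
    rw [gaussianReal_map_const_mul]
    congr 1
    · simp
    · ext; simp
  rw [← hmap, Measure.map_apply (by fun_prop) measurableSet_Iio]
  congr 1
  ext z
  simp only [Set.mem_preimage, Set.mem_Iio]
  constructor
  · intro h; nlinarith
  · intro h; nlinarith

theorem gaussianReal_Iio_ne_zero (a : ℝ) : gaussianReal 0 1 (Set.Iio a) ≠ 0 := by
  intro h
  have := gaussianReal_absolutelyContinuous' 0 one_ne_zero h
  simp at this

/-- The values at integer times of a pre-Brownian motion are unbounded from below. -/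
theorem ProbabilityTheory.IsPreBrownianReal.ae_unbounded_below (hV : IsPreBrownianReal V P) :
    ∀ᵐ ω ∂P, ∀ K : ℝ, ∀ N : ℕ, ∃ n : ℕ, N ≤ n ∧ V n ω < K := by
  -- Only countably many times matter, so measurable versions may be used; the second Borel–Cantelli
  -- lemma needs measurable events.
  wlog hmeas : ∀ t, Measurable (V t) generalizing V
  · have hae : ∀ t, V t =ᵐ[P] (hV.aemeasurable t).mk (V t) := fun t => (hV.aemeasurable t).ae_eq_mk
    have h := this (hV.congr hae) fun t => (hV.aemeasurable t).measurable_mk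
    filter_upwards [h, ae_all_iff.2 fun n : ℕ => hae n] with ω h1 h2 K N
    obtain ⟨n, hn, hlt⟩ := h1 K N
    exact ⟨n, hn, by rwa [h2 n]⟩
  have : IsProbabilityMeasure P := hV.isGaussianProcess.isProbabilityMeasure
  -- Times so sparse that the increment over `[T m, T (m + 1)]` has variance `v m ≥ 4 ^ m * T m`,
  -- far above the variance of `V (T m)`. Independent increments fall below `-√(v m)` infinitely
  -- often, while by Chebyshev `|V (T m)| < √(v m) / 2` eventually.
  set T : ℕ → ℕ := fun m => 2 ^ (m ^ 2) with hT
  have hTpos : ∀ m, 0 < T m := fun m => by positivity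
  have hTsucc : ∀ m, T (m + 1) = T m * (2 * 4 ^ m) := fun m => by
    simp only [hT]
    rw [show (m + 1) ^ 2 = m ^ 2 + (1 + 2 * m) by ring, pow_add, pow_add, pow_one, pow_mul]
    norm_num
  have hTle : ∀ m, 2 * T m ≤ T (m + 1) := fun m => by
    rw [hTsucc]
    have : 1 ≤ 4 ^ m := Nat.one_le_pow _ _ (by norm_num)
    nlinarith [hTpos m]
  have hTmono : Monotone fun m => (T m : ℝ≥0) := monotone_nat_of_le_succ fun m => by
    exact_mod_cast (by linarith [hTle m, hTpos m] : T m ≤ T (m + 1))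
  have hindep := hV.hasIndepIncrements.nat hTmono
  set v : ℕ → ℝ≥0 := fun m => nndist ((T (m + 1) : ℝ≥0) : ℝ) ((T m : ℝ≥0) : ℝ) with hv
  have hv_eq : ∀ m, (v m : ℝ) = T (m + 1) - T m := fun m => by
    have h1 : (T m : ℝ) ≤ T (m + 1) := by exact_mod_cast (by linarith [hTle m, hTpos m])
    simp only [hv, coe_nndist, Real.dist_eq, NNReal.coe_natCast]
    exact abs_of_nonneg (sub_nonneg.2 h1)
  have hv_ge : ∀ m, (T m : ℝ) * 4 ^ m ≤ v m := fun m => by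
    rw [hv_eq, hTsucc]
    push_cast
    have h1 : (1 : ℝ) ≤ 4 ^ m := one_le_pow₀ (by norm_num)
    have h2 : (0 : ℝ) < T m := by exact_mod_cast hTpos m
    nlinarith
  have hv_pos : ∀ m, 0 < (v m : ℝ) := fun m =>
    lt_of_lt_of_le (by have := hTpos m; positivity) (hv_ge m)
  set A : ℕ → Set Ω := fun m => {ω | V (T (m + 1)) ω - V (T m) ω < -√(v m : ℝ)} with hA
  have hAm : ∀ m, MeasurableSet (A m) := fun m =>
    measurableSet_lt ((hmeas _).sub (hmeas _)) measurable_const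
  have hAP : ∀ m, P (A m) = gaussianReal 0 1 (Set.Iio (-1)) := fun m => by
    have hlaw := hV.hasLaw_sub (T (m + 1)) (T m)
    rw [← gaussianReal_Iio_neg_sqrt (v m) (fun h => (hv_pos m).ne' (by rw [h]; rfl))]
    exact hlaw.measure_eq (p := (· < -√(v m : ℝ))) measurableSet_Iio
  have hAindep : iIndepSet A P := by
    rw [iIndepSet_iff_meas_biInter hAm]
    intro S
    refine hindep.meas_biInter fun m _ => ?_
    refine ⟨Set.Iio (-√(v m : ℝ)), measurableSet_Iio, ?_⟩
    ext ω
    simp [hA]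
  have hAio : ∀ᵐ ω ∂P, ∃ᶠ m in atTop, ω ∈ A m := by
    have h1 := measure_limsup_eq_one hAm hAindep (by
      simp only [hAP]
      exact ENNReal.tsum_const_eq_top_of_ne_zero (gaussianReal_Iio_ne_zero _))
    have h2 : ∀ᵐ ω ∂P, ω ∈ limsup A atTop :=
      (mem_ae_iff_prob_eq_one (MeasurableSet.measurableSet_limsup hAm)).2 h1
    filter_upwards [h2] with ω hω
    exact mem_limsup_iff_frequently_mem.1 hω
  set E : ℕ → Set Ω := fun m => {ω | √(v m : ℝ) / 2 ≤ |V (T m) ω|} with hE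
  have hEP : ∀ m, P (E m) ≤ ENNReal.ofReal (4 * (1 / 4) ^ m) := fun m => by
    have hlaw := hV.hasLaw_eval (T m)
    have h1 := meas_ge_le_variance_div_sq (μ := P) (X := V (T m)) hlaw.hasGaussianLaw.memLp_two
      (c := √(v m : ℝ) / 2) (by have := Real.sqrt_pos.2 (hv_pos m); positivity)
    rw [hV.integral_eval, hlaw.variance_eq, variance_id_gaussianReal] at h1
    simp only [sub_zero] at h1
    refine h1.trans (ENNReal.ofReal_le_ofReal ?_)
    rw [div_pow, Real.sq_sqrt (hv_pos m).le, one_div, inv_pow]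
    have h4 : (0 : ℝ) < 4 ^ m := by positivity
    have h5 := hv_ge m
    have h6 := hv_pos m
    rw [NNReal.coe_natCast, ← div_eq_mul_inv, div_le_div_iff₀ (by positivity) h4]
    linarith
  have hEev : ∀ᵐ ω ∂P, ∀ᶠ m in atTop, ω ∉ E m := by
    refine ae_eventually_notMem (ne_top_of_le_ne_top ?_ (ENNReal.tsum_le_tsum hEP))
    exact ((summable_geometric_of_lt_one (by norm_num) (by norm_num)).mul_left 4).tsum_ofReal_ne_top
  have hgrow : Tendsto (fun m => √(v m : ℝ) / 2) atTop atTop := by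
    refine Tendsto.atTop_div_const (by norm_num) (Real.tendsto_sqrt_atTop.comp ?_)
    refine tendsto_atTop_mono (fun m => ?_)
      (tendsto_pow_atTop_atTop_of_one_lt (show (1 : ℝ) < 4 by norm_num))
    have h1 : (1 : ℝ) ≤ T m := by exact_mod_cast hTpos m
    have h4 : (0 : ℝ) < 4 ^ m := by positivity
    nlinarith [hv_ge m]
  filter_upwards [hAio, hEev] with ω h1 h2 K N
  obtain ⟨m, hmA, hmE, hmK, hmN⟩ := (h1.and_eventually (h2.and
    ((hgrow.eventually_gt_atTop (-K)).and (eventually_ge_atTop N)))).exists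
  refine ⟨T (m + 1), ?_, ?_⟩
  · have : m < T m := lt_of_le_of_lt (by nlinarith) (Nat.lt_two_pow_self (n := m ^ 2))
    linarith [hTle m]
  · simp only [hE, Set.mem_ofPred_eq, not_le] at hmE
    simp only [hA, Set.mem_ofPred_eq] at hmA
    have := (abs_lt.1 hmE).2
    linarith

/-- A pre-Brownian motion goes below every line through the origin at times arbitrarily close
to zero. -/
theorem ProbabilityTheory.IsPreBrownianReal.ae_exists_lt_near_zero (hV : IsPreBrownianReal V P) :
    ∀ᵐ ω ∂P, ∀ K : ℝ, ∀ N : ℕ, ∃ n : ℕ, N ≤ n ∧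
      V (1 / ((n : ℝ≥0) + 1)) ω < K * (1 / ((n : ℝ) + 1)) := by
  -- Time inversion `t V(1/t)` moves the behaviour at infinity to zero; asking for `n ≥ N + 1`
  -- allows `n = m + 1`.
  filter_upwards [hV.inv.ae_unbounded_below] with ω h K N
  obtain ⟨n, hn, hlt⟩ := h K (N + 1)
  obtain ⟨m, rfl⟩ := Nat.exists_eq_add_of_le' (show 1 ≤ n by linarith)
  refine ⟨m, by linarith, ?_⟩
  push_cast at hlt
  rw [mul_one_div, lt_div_iff₀ (by positivity), mul_comm]
  exact hlt

/-- The time reversal of a pre-Brownian motion at time `t`, continued beyond `t`. -/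
theorem ProbabilityTheory.IsPreBrownianReal.reversal (hV : IsPreBrownianReal V P) (t : ℝ≥0) :
    IsPreBrownianReal (fun u ω => V (max t u) ω - V (t - u) ω) P := by
  have := hV.isGaussianProcess.isProbabilityMeasure
  have hL2 : ∀ t, MemLp (V t) 2 P := fun t => (hV.hasLaw_eval t).hasGaussianLaw.memLp_two
  have hint : ∀ t, Integrable (V t) P := hV.integrable_eval
  refine IsGaussianProcess.isPreBrownianReal_of_covariance ?_ (fun u => ?_) (fun s u hsu => ?_)
  · classical
    exact hV.isGaussianProcess.of_isGaussianProcess fun u => ⟨{max t u, t - u},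
      { toFun x := x ⟨max t u, by simp⟩ - x ⟨t - u, by simp⟩
        map_add' x y := by simp; abel
        map_smul' c x := by simp; ring }, by simp⟩
  · rw [integral_sub (hint _) (hint _), hV.integral_eval, hV.integral_eval, sub_zero]
  · rw [covariance_fun_sub_fun_sub (hL2 _) (hL2 _) (hL2 _) (hL2 _),
      hV.covariance_eval, hV.covariance_eval, hV.covariance_eval, hV.covariance_eval]
    have h1 : min (max t s) (max t u) = max t s := min_eq_left (max_le_max le_rfl hsu)
    have h2 : min (max t s) (t - u) = t - u :=
      min_eq_right (tsub_le_self.trans (le_max_left _ _))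
    have h3 : min (t - s) (max t u) = t - s :=
      min_eq_left (tsub_le_self.trans (le_max_left _ _))
    have h4 : min (t - s) (t - u) = t - u := min_eq_right (tsub_le_tsub_left hsu t)
    -- With truncated subtraction the four covariances reduce to `max t s - (t - s) = s`, also for
    -- `s > t`.
    have h5 : max t s = (t - s) + s := by
      rcases le_total s t with h | h
      · rw [max_eq_left h, tsub_add_cancel_of_le h]
      · rw [max_eq_right h, tsub_eq_zero_of_le h, zero_add]
    rw [h1, h2, h3, h4, h5]
    push_cast
    ring

end Fluctuations

/-! ### Linear combinations of the coordinates of a Brownian motion -/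

section Past

variable {Ω : Type*} {d : ℕ}

/-- The observation of `B` at the rational times up to `q`. -/
def observation (B : Fin d → ℝ≥0 → Ω → ℝ) (q : ℚ≥0) (ω : Ω) (p : Fin d × {u : ℚ≥0 // u ≤ q}) : ℝ :=
  B p.1 (p.2.1 : ℝ≥0) ω

/-- The information in the values of `B` at the rational times up to `q`. -/
abbrev pastAlgebra (B : Fin d → ℝ≥0 → Ω → ℝ) (q : ℚ≥0) : MeasurableSpace Ω :=
  MeasurableSpace.comap (observation B q) inferInstance

theorem measurable_pastAlgebra_apply (B : Fin d → ℝ≥0 → Ω → ℝ) {u q : ℚ≥0} (h : u ≤ q)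
    (i : Fin d) : Measurable[pastAlgebra B q] (B i (u : ℝ≥0)) :=
  (measurable_pi_apply (⟨i, ⟨u, h⟩⟩ : Fin d × {u : ℚ≥0 // u ≤ q})).comp
    (comap_measurable (observation B q))

theorem pastAlgebra_mono (B : Fin d → ℝ≥0 → Ω → ℝ) : Monotone (pastAlgebra B) := by
  intro q r hqr
  have : Measurable[pastAlgebra B r] (observation B q) :=
    @measurable_pi_lambda _ _ _ (pastAlgebra B r) _ _ fun p =>
      measurable_pastAlgebra_apply B (p.2.2.trans hqr) p.1
  exact this.comap_le

end Past

/-! ### Joint Gaussianity and independence of increments from the past -/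

section Multidimensional

variable {Ω : Type*} [MeasurableSpace Ω] {P : Measure Ω} {d : ℕ} {B : Fin d → ℝ≥0 → Ω → ℝ}

theorem IsStandardBrownian.aemeasurable_observation (hB : IsStandardBrownian B P) (q : ℚ≥0) :
    AEMeasurable (observation B q) P :=
  aemeasurable_pi_lambda _ fun p => (hB.brownian p.1).toIsPreBrownianReal.aemeasurable _

theorem IsStandardBrownian.nullMeasurableSet (hB : IsStandardBrownian B P) {q : ℚ≥0} {G : Set Ω}
    (hG : MeasurableSet[pastAlgebra B q] G) : NullMeasurableSet G P := by
  obtain ⟨G', hG', rfl⟩ := hG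
  exact (hB.aemeasurable_observation q).nullMeasurableSet_preimage hG'

theorem IsStandardBrownian.memLp (hB : IsStandardBrownian B P) (i : Fin d) (t : ℝ≥0) :
    MemLp (B i t) 2 P :=
  ((hB.brownian i).toIsPreBrownianReal.hasLaw_eval t).hasGaussianLaw.memLp_two

theorem IsStandardBrownian.isGaussianProcess [IsProbabilityMeasure P]
    (hB : IsStandardBrownian B P) :
    IsGaussianProcess (fun (p : Fin d × ℝ≥0) ω => B p.1 p.2 ω) P where
  hasGaussianLaw I := by
    classical
    have h1 : iIndepFun (fun i ω (t : I.image Prod.snd) => B i t ω) P :=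
      hB.indep.comp (fun _ b (t : I.image Prod.snd) => b t) fun _ => by fun_prop
    have h2 := h1.hasGaussianLaw fun i => by
      have hi := (hB.brownian i).toIsPreBrownianReal
      exact hi.isGaussianProcess.hasGaussianLaw (I.image Prod.snd)
    let L : (Fin d → I.image Prod.snd → ℝ) →L[ℝ] (I → ℝ) :=
      { toFun x p := x p.1.1 ⟨p.1.2, Finset.mem_image_of_mem _ p.2⟩
        map_add' x y := by ext; simp
        map_smul' c x := by ext; simp }
    exact h2.map L

theorem IsStandardBrownian.covariance_eq [IsProbabilityMeasure P] (hB : IsStandardBrownian B P)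
    (i j : Fin d) (s t : ℝ≥0) :
    cov[B i s, B j t; P] = if i = j then ((min s t : ℝ≥0) : ℝ) else 0 := by
  split
  · next h =>
    subst h
    exact (hB.brownian i).toIsPreBrownianReal.covariance_eval s t
  · next h =>
    have := (hB.indep.indepFun h).comp (measurable_pi_apply s) (measurable_pi_apply t)
    exact this.covariance_eq_zero (hB.memLp i s) (hB.memLp j t)

/-- The linear combination `∑ₖ wₖ Bₖ`. -/
def linearCombination (B : Fin d → ℝ≥0 → Ω → ℝ) (w : Fin d → ℝ) (t : ℝ≥0) (ω : Ω) : ℝ :=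
  ∑ k, w k * B k t ω

theorem IsStandardBrownian.covariance_linearCombination_left [IsProbabilityMeasure P]
    (hB : IsStandardBrownian B P) (w : Fin d → ℝ) (j : Fin d) (s t : ℝ≥0) :
    cov[linearCombination B w s, B j t; P] = w j * (min s t : ℝ≥0) := by
  unfold linearCombination
  rw [covariance_fun_sum_left (fun k => (hB.memLp k s).const_mul _) (hB.memLp j t)]
  simp_rw [covariance_const_mul_left]
  rw [Finset.sum_eq_single j (fun k _ hk => by rw [hB.covariance_eq, if_neg hk, mul_zero]) (by simp),
    hB.covariance_eq, if_pos rfl]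

theorem IsStandardBrownian.memLp_linearCombination (hB : IsStandardBrownian B P)
    (w : Fin d → ℝ) (t : ℝ≥0) : MemLp (linearCombination B w t) 2 P :=
  memLp_finsetSum _ fun k _ => (hB.memLp k t).const_mul _

theorem IsStandardBrownian.covariance_linearCombination [IsProbabilityMeasure P]
    (hB : IsStandardBrownian B P) (w : Fin d → ℝ) (s t : ℝ≥0) :
    cov[linearCombination B w s, linearCombination B w t; P] = (w ⬝ᵥ w) * (min s t : ℝ≥0) := by
  conv_lhs => rw [show linearCombination B w t = fun ω => ∑ k, w k * B k t ω from rfl]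
  rw [covariance_fun_sum_right (fun k => (hB.memLp k t).const_mul _)
    (hB.memLp_linearCombination w s)]
  simp_rw [covariance_const_mul_right, hB.covariance_linearCombination_left, dotProduct,
    Finset.sum_mul, mul_assoc]

/-- The normalised linear combination `|w|⁻¹ ∑ₖ wₖ Bₖ`. -/
noncomputable def unitCombination (B : Fin d → ℝ≥0 → Ω → ℝ) (w : Fin d → ℝ) (t : ℝ≥0) (ω : Ω) :
    ℝ :=
  (√(w ⬝ᵥ w))⁻¹ * linearCombination B w t ω

theorem dotProduct_self_pos_of_ne_zero {w : Fin d → ℝ} (hw : w ≠ 0) : 0 < w ⬝ᵥ w := by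
  have h : 0 ≤ w ⬝ᵥ w := Finset.sum_nonneg fun i _ => mul_self_nonneg _
  exact lt_of_le_of_ne h fun h0 => hw (dotProduct_self_eq_zero.1 h0.symm)

theorem IsStandardBrownian.isPreBrownianReal_unitCombination [IsProbabilityMeasure P]
    (hB : IsStandardBrownian B P) {w : Fin d → ℝ} (hw : w ≠ 0) :
    IsPreBrownianReal (unitCombination B w) P := by
  classical
  refine IsGaussianProcess.isPreBrownianReal_of_covariance ?_ (fun t => ?_) (fun s t hst => ?_)
  · exact hB.isGaussianProcess.of_isGaussianProcess fun t => ⟨Finset.univ.image fun k => (k, t),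
      { toFun x := (√(w ⬝ᵥ w))⁻¹ * ∑ k, w k * x ⟨(k, t), by simp⟩
        map_add' x y := by simp only [Pi.add_apply, mul_add, Finset.sum_add_distrib]
        map_smul' c x := by
          simp only [Pi.smul_apply, smul_eq_mul, RingHom.id_apply, Finset.mul_sum]
          exact Finset.sum_congr rfl fun k _ => by ring },
      fun ω => rfl⟩
  · simp only [unitCombination, linearCombination]
    rw [integral_const_mul, integral_finsetSum _ fun k _ =>
      ((hB.brownian k).toIsPreBrownianReal.integrable_eval t).const_mul _]
    simp [integral_const_mul, (hB.brownian _).toIsPreBrownianReal.integral_eval]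
  · have hpos := dotProduct_self_pos_of_ne_zero hw
    unfold unitCombination
    rw [covariance_const_mul_left, covariance_const_mul_right, hB.covariance_linearCombination,
      min_eq_left hst, ← mul_assoc, ← mul_assoc, ← mul_inv, Real.mul_self_sqrt hpos.le,
      inv_mul_cancel₀ hpos.ne', one_mul]

/-- The increments after time `q` are independent of the past. -/
theorem IsStandardBrownian.indepFun_shift [IsProbabilityMeasure P] (hB : IsStandardBrownian B P)
    (w : Fin d → ℝ) (q : ℚ≥0) :
    IndepFun (fun ω t => unitCombination B w (q + t) ω - unitCombination B w q ω)
      (observation B q) P := by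
  classical
  have hL2 : ∀ t, MemLp (unitCombination B w t) 2 P := fun t =>
    (hB.memLp_linearCombination w t).const_mul _
  refine IsGaussianProcess.indepFun_of_covariance_eq_zero
    (X := fun (t : ℝ≥0) ω => unitCombination B w (q + t) ω - unitCombination B w q ω)
    (Y := fun (p : Fin d × {u : ℚ≥0 // u ≤ q}) ω => B p.1 (p.2.1 : ℝ≥0) ω) ?_ ?_ ?_ ?_
  · refine hB.isGaussianProcess.of_isGaussianProcess ?_
    rintro (t | p)
    · exact ⟨(Finset.univ.image fun k => (k, (q : ℝ≥0) + t)) ∪ Finset.univ.image fun k => (k, (q : ℝ≥0)),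
        { toFun x := (√(w ⬝ᵥ w))⁻¹ * ∑ k, w k * x ⟨(k, q + t), by simp⟩ -
            (√(w ⬝ᵥ w))⁻¹ * ∑ k, w k * x ⟨(k, q), by simp⟩
          map_add' x y := by
            simp only [Pi.add_apply, mul_add, Finset.sum_add_distrib]
            ring
          map_smul' c x := by
            simp only [Pi.smul_apply, smul_eq_mul, RingHom.id_apply, mul_left_comm _ c,
              ← Finset.mul_sum]
            ring },
        fun ω => rfl⟩
    · exact ⟨{(p.1, (p.2.1 : ℝ≥0))},
        { toFun x := x ⟨(p.1, (p.2.1 : ℝ≥0)), by simp⟩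
          map_add' x y := by simp
          map_smul' c x := by simp }, fun ω => rfl⟩
  · exact fun t => ((hL2 _).sub (hL2 _)).aemeasurable
  · exact fun p => (hB.memLp _ _).aemeasurable
  -- For `u ≤ q` the combination has the same covariance with `B_j(u)` at times `q` and `q + t`, so
  -- the increment is uncorrelated with the past; joint Gaussianity turns this into independence.
  · rintro t ⟨j, u, hu⟩
    have hu' : (u : ℝ≥0) ≤ (q : ℝ≥0) := by exact_mod_cast hu
    have hmem := hB.memLp j (u : ℝ≥0)
    rw [covariance_fun_sub_left (hL2 _) (hL2 _) hmem]
    unfold unitCombination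
    rw [covariance_const_mul_left, covariance_const_mul_left,
      hB.covariance_linearCombination_left, hB.covariance_linearCombination_left,
      min_eq_right hu', min_eq_right (hu'.trans le_self_add), sub_self]

end Multidimensional

/-! ### Fluctuations of Brownian motion after stopping times and before fixed times -/

/-- The sequences `v` with `vₙ + β/(n+1) ≥ -1/(M+1)` for `N ≤ n ≤ M`. -/
def barrierSet (β : ℝ) (N M : ℕ) : Set (ℕ → ℝ) :=
  {v | ∀ n : ℕ, N ≤ n → n ≤ M →
    -(1 / ((M : ℝ) + 1)) ≤ v n + β * (1 / ((n : ℝ) + 1))}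

theorem measurableSet_barrierSet (β : ℝ) (N M : ℕ) : MeasurableSet (barrierSet β N M) := by
  have h : barrierSet β N M = ⋂ n : ℕ, ⋂ _ : N ≤ n, ⋂ _ : n ≤ M,
      {v | -(1 / ((M : ℝ) + 1)) ≤ v n + β * (1 / ((n : ℝ) + 1))} := by
    ext; simp [barrierSet]
  rw [h]
  exact .iInter fun n => .iInter fun _ => .iInter fun _ =>
    measurableSet_le measurable_const (by fun_prop)

theorem antitone_barrierSet (β : ℝ) (N : ℕ) : Antitone (barrierSet β N) := by
  intro M M' h v hv n hn hnM
  refine le_trans ?_ (hv n hn (hnM.trans h))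
  have : (M : ℝ) ≤ M' := by exact_mod_cast h
  have := one_div_le_one_div_of_le (show (0 : ℝ) < M + 1 by positivity)
    (show (M : ℝ) + 1 ≤ M' + 1 by linarith)
  linarith

section PreBrownian

variable {Ω : Type*} [MeasurableSpace Ω] {P : Measure Ω} {V V' : ℝ≥0 → Ω → ℝ}

theorem ProbabilityTheory.IsPreBrownianReal.identDistrib_sequence (hV : IsPreBrownianReal V P)
    (hV' : IsPreBrownianReal V' P) (τ : ℕ → ℝ≥0) :
    IdentDistrib (fun ω n => V (τ n) ω) (fun ω n => V' (τ n) ω) P P := by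
  classical
  have : IsProbabilityMeasure P := hV.isGaussianProcess.isProbabilityMeasure
  rw [identDistrib_iff_forall_finset_identDistrib
    (aemeasurable_pi_lambda _ fun n => hV.aemeasurable (τ n))
    (aemeasurable_pi_lambda _ fun n => hV'.aemeasurable (τ n))]
  intro I
  have h := (hV.hasLaw (I.image τ)).identDistrib (hV'.hasLaw (I.image τ))
  exact h.comp (u := fun (v : I.image τ → ℝ) (n : I) => v ⟨τ n, Finset.mem_image_of_mem _ n.2⟩)
    (by fun_prop)

/-- The barrier events decrease in `M`. Their intersection would keep `V` above the line of slope
`-β` at all times `1/(n + 1)` with `n ≥ N`, which is almost surely impossible. -/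
theorem ProbabilityTheory.IsPreBrownianReal.tendsto_measure_barrierSet
    (hV : IsPreBrownianReal V P) (β : ℝ) (N : ℕ) :
    Tendsto (fun M => P {ω | (fun n : ℕ => V (1 / ((n : ℝ≥0) + 1)) ω) ∈ barrierSet β N M}) atTop (𝓝 0) := by
  have : IsProbabilityMeasure P := hV.isGaussianProcess.isProbabilityMeasure
  have hnull : P (⋂ M, {ω | (fun n : ℕ => V (1 / ((n : ℝ≥0) + 1)) ω) ∈ barrierSet β N M}) = 0 := by
    rw [measure_eq_zero_iff_ae_notMem]
    filter_upwards [hV.ae_exists_lt_near_zero] with ω hω hmem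
    obtain ⟨n, hn, hlt⟩ := hω (-β) N
    rw [Set.mem_iInter] at hmem
    obtain ⟨M, hM⟩ := exists_nat_one_div_lt
      (show 0 < -(V (1 / ((n : ℝ≥0) + 1)) ω + β * (1 / ((n : ℝ) + 1))) by linarith)
    have h2 := hmem (max M n) n hn (le_max_right _ _)
    have h3 : (1 : ℝ) / (((max M n : ℕ) : ℝ) + 1) ≤ 1 / ((M : ℝ) + 1) := by
      refine one_div_le_one_div_of_le (by positivity) ?_
      have : (M : ℝ) ≤ (max M n : ℕ) := by exact_mod_cast le_max_left M n
      linarith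
    linarith
  rw [← hnull]
  refine tendsto_measure_iInter_atTop (fun M => ?_) (fun M M' h ω hω => ?_)
    ⟨0, measure_ne_top _ _⟩
  · exact (aemeasurable_pi_lambda _ fun n => hV.aemeasurable _).nullMeasurableSet_preimage
      (measurableSet_barrierSet β N M)
  · simp only [Set.mem_ofPred_eq] at hω ⊢
    exact antitone_barrierSet β N h hω

/-- Just before a fixed time, a Brownian motion with drift is below its value at that time. -/
theorem ProbabilityTheory.IsPreBrownianReal.ae_exists_lt_before (hV : IsPreBrownianReal V P)
    (β : ℝ) {t : ℝ≥0} :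
    ∀ᵐ ω ∂P, ∀ r < t, ∃ u, r ≤ u ∧ u ≤ t ∧ V u ω + β * u < V t ω + β * t := by
  -- The negated reversal at `δ ≤ t` is `V (t - δ) - V t`; it drops below `βδ` for arbitrarily small
  -- `δ`.
  filter_upwards [(hV.reversal t).neg.ae_exists_lt_near_zero] with ω hω r hr
  obtain ⟨N, hN⟩ := exists_nat_one_div_lt (show (0 : ℝ) < t - r from sub_pos.2 hr)
  obtain ⟨n, hn, hlt⟩ := hω β N
  have hnN : (N : ℝ) ≤ n := by exact_mod_cast hn
  have hle : (1 : ℝ) / (n + 1) ≤ 1 / (N + 1) :=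
    one_div_le_one_div_of_le (by positivity) (by linarith)
  set δ : ℝ≥0 := 1 / ((n : ℝ≥0) + 1) with hδ
  have hδ' : (δ : ℝ) = 1 / ((n : ℝ) + 1) := by simp [hδ]
  have hr0 : (0 : ℝ) ≤ r := r.2
  have hδt : δ ≤ t := by
    rw [← NNReal.coe_le_coe, hδ']; linarith
  refine ⟨t - δ, ?_, tsub_le_self, ?_⟩
  · rw [← NNReal.coe_le_coe, NNReal.coe_sub hδt, hδ']; linarith
  · simp only [Pi.neg_apply, max_eq_left hδt] at hlt
    rw [NNReal.coe_sub hδt, hδ']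
    linarith

end PreBrownian

/-! ### Fluctuations of Brownian motion after stopping times -/

/-- The increments of `unitCombination B w` between `q` and `q + 1/(n+1)`. -/
noncomputable def incrementSequence {Ω : Type*} {d : ℕ} (B : Fin d → ℝ≥0 → Ω → ℝ) (w : Fin d → ℝ) (q : ℝ≥0) (ω : Ω)
    (n : ℕ) : ℝ :=
  unitCombination B w (q + 1 / ((n : ℝ≥0) + 1)) ω - unitCombination B w q ω

/-- `T` is, up to null sets, a stopping time for the past of `B` at rational times. -/
def IsRationalStoppingTime {Ω : Type*} [MeasurableSpace Ω] {d : ℕ} (B : Fin d → ℝ≥0 → Ω → ℝ)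
    (P : Measure Ω) (T : Ω → ℝ≥0∞) : Prop :=
  ∀ r : ℚ≥0, ∃ G, MeasurableSet[pastAlgebra B r] G ∧ ∀ᵐ ω ∂P, T ω ≤ (r : ℝ≥0) ↔ ω ∈ G

/-- Transfers a lower barrier from `s` to a nearby grid time `q`, at the cost of the slack `1/(M +
1)`. The length `2/(N + 1)` leaves room for both `q - s` and the increment `1/(n + 1)`. -/
theorem barrier_of_le {v : ℝ≥0 → ℝ} {β : ℝ} {s : ℝ≥0} {N M j : ℕ}
    (hbad : ∀ u, s ≤ u → u ≤ s + 2 / ((N : ℝ≥0) + 1) → v s + β * s ≤ v u + β * u)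
    (hclose : ∀ u, s ≤ u → u ≤ s + 1 / ((j : ℝ≥0) + 1) →
      v u + β * u ≤ v s + β * s + 1 / ((M : ℝ) + 1)) (hj : N ≤ j) {q : ℝ≥0} (hsq : s ≤ q)
    (hqs : q ≤ s + 1 / ((j : ℝ≥0) + 1)) :
    (fun n : ℕ => v (q + 1 / ((n : ℝ≥0) + 1)) - v q) ∈ barrierSet β N M := by
  intro n hn _
  have hle : ∀ k : ℕ, N ≤ k → (1 : ℝ≥0) / ((k : ℝ≥0) + 1) ≤ 1 / ((N : ℝ≥0) + 1) := fun k hk =>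
    one_div_le_one_div_of_le (by positivity) (by gcongr)
  have h1 := hbad (q + 1 / ((n : ℝ≥0) + 1)) (hsq.trans le_self_add) (by
    calc q + 1 / ((n : ℝ≥0) + 1)
        ≤ s + 1 / ((N : ℝ≥0) + 1) + 1 / ((N : ℝ≥0) + 1) :=
          add_le_add (hqs.trans (add_le_add le_rfl (hle j hj))) (hle n hn)
      _ = s + 2 / ((N : ℝ≥0) + 1) := by rw [add_assoc, ← add_div]; norm_num)
  have h2 := hclose q hsq hqs
  push_cast at h1
  linarith

/-! ### The Markov property on a grid and its limit -/

section StrongMarkov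

variable {Ω : Type*} [MeasurableSpace Ω] {P : Measure Ω} [IsProbabilityMeasure P] {d : ℕ}
  {B : Fin d → ℝ≥0 → Ω → ℝ} {w : Fin d → ℝ}

theorem IsStandardBrownian.measure_inter_incrementSequence (hB : IsStandardBrownian B P)
    (hw : w ≠ 0) {q : ℚ≥0} {G : Set Ω} (hG : MeasurableSet[pastAlgebra B q] G) {S : Set (ℕ → ℝ)}
    (hS : MeasurableSet S) :
    P (G ∩ incrementSequence B w q ⁻¹' S) = P G *
      P {ω | (fun n : ℕ => unitCombination B w (1 / ((n : ℝ≥0) + 1)) ω) ∈ S} := by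
  obtain ⟨G', hG', rfl⟩ := hG
  have h1 : IndepFun (incrementSequence B w q) (observation B q) P :=
    (hB.indepFun_shift w q).comp
      (φ := fun (v : ℝ≥0 → ℝ) (n : ℕ) => v (1 / ((n : ℝ≥0) + 1))) (by fun_prop) measurable_id
  have hV := hB.isPreBrownianReal_unitCombination hw
  rw [Set.inter_comm, h1.measure_inter_preimage_eq_mul S G' hS hG', mul_comm]
  congr 1
  exact ((hV.shift q).identDistrib_sequence hV fun n => 1 / ((n : ℝ≥0) + 1)).measure_mem_eq hS

/-- The disjoint pieces of `G` record the first grid index at which the event `G m` occurs. On each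
piece the increments after `q m` are independent of the past with the same law, and the pieces have
total mass at most one. -/
theorem IsStandardBrownian.measure_iUnion_inter_incrementSequence_le
    (hB : IsStandardBrownian B P) (hw : w ≠ 0) {q : ℕ → ℚ≥0} (hq : Monotone q) {G : ℕ → Set Ω}
    (hG : ∀ m, MeasurableSet[pastAlgebra B (q m)] (G m)) {S : Set (ℕ → ℝ)}
    (hS : MeasurableSet S) :
    P (⋃ m, disjointed G m ∩ incrementSequence B w (q m) ⁻¹' S) ≤
      P {ω | (fun n : ℕ => unitCombination B w (1 / ((n : ℝ≥0) + 1)) ω) ∈ S} := by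
  have hD : ∀ m, MeasurableSet[pastAlgebra B (q m)] (disjointed G m) := fun m => by
    rw [disjointed_eq_inter_compl]
    exact @MeasurableSet.inter _ (pastAlgebra B (q m)) _ _ (hG m)
      (@MeasurableSet.iInter _ _ (pastAlgebra B (q m)) _ _ fun k =>
        @MeasurableSet.iInter _ _ (pastAlgebra B (q m)) _ _ fun hk =>
          @MeasurableSet.compl _ _ (pastAlgebra B (q m))
            (pastAlgebra_mono B (hq hk.le) _ (hG k)))
  calc P (⋃ m, disjointed G m ∩ incrementSequence B w (q m) ⁻¹' S)
      ≤ ∑' m, P (disjointed G m ∩ incrementSequence B w (q m) ⁻¹' S) := measure_iUnion_le _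
    _ = (∑' m, P (disjointed G m)) *
        P {ω | (fun n : ℕ => unitCombination B w (1 / ((n : ℝ≥0) + 1)) ω) ∈ S} := by
      simp_rw [hB.measure_inter_incrementSequence hw (hD _) hS, ENNReal.tsum_mul_right]
    _ ≤ 1 * P {ω | (fun n : ℕ => unitCombination B w (1 / ((n : ℝ≥0) + 1)) ω) ∈ S} := by
      gcongr
      rw [← measure_univ (μ := P)]
      exact tsum_measure_le_measure_univ (fun m => hB.nullMeasurableSet (hD m))
        fun i j hij => (disjoint_disjointed G hij).aedisjoint
    _ = _ := one_mul _

/-- Just after a stopping time, a Brownian motion with drift goes below its value at that time. -/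
theorem IsStandardBrownian.ae_exists_lt_after (hB : IsStandardBrownian B P) (hw : w ≠ 0) (β : ℝ)
    {T : Ω → ℝ≥0∞} (hT : IsRationalStoppingTime B P T) :
    ∀ᵐ ω ∂P, ∀ s : ℝ≥0, T ω = s → ∀ t, s < t → ∃ u, s ≤ u ∧ u ≤ t ∧
      unitCombination B w u ω + β * u < unitCombination B w s ω + β * s := by
  choose G hGm hG using hT
  have hcont : ∀ᵐ ω ∂P, Continuous fun u => unitCombination B w u ω := by
    filter_upwards [ae_all_iff.2 fun i => (hB.brownian i).cont] with ω h
    unfold unitCombination linearCombination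
    fun_prop
  -- The drifted path does not go below its value at `T` during the next `2/(N + 1)` units of time.
  -- No measurability of this set is needed: it is bounded by barrier probabilities that tend to
  -- zero.
  set bad : ℕ → Set Ω := fun N => {ω | Continuous (fun u => unitCombination B w u ω) ∧
    (∀ r : ℚ≥0, T ω ≤ (r : ℝ≥0) ↔ ω ∈ G r) ∧ ∃ s : ℝ≥0, T ω = s ∧
      ∀ u, s ≤ u → u ≤ s + 2 / ((N : ℝ≥0) + 1) →
        unitCombination B w s ω + β * s ≤ unitCombination B w u ω + β * u} with hbad
  suffices h : ∀ N, P (bad N) = 0 by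
    filter_upwards [hcont, ae_all_iff.2 hG, ae_all_iff.2 fun N => measure_eq_zero_iff_ae_notMem.1 (h N)]
      with ω h1 h2 h3 s hs t hst
    by_contra! hcon
    obtain ⟨N, hN⟩ := exists_nat_one_div_lt (show (0 : ℝ) < (t - s) / 2 from
      half_pos (sub_pos.2 hst))
    refine h3 N ⟨h1, h2, s, hs, fun u hsu hu => hcon u hsu (hu.trans ?_)⟩
    rw [← NNReal.coe_le_coe]
    push_cast
    have : (2 : ℝ) / (N + 1) = 2 * (1 / (N + 1)) := by ring
    linarith
  intro N
  set p : ℕ → ℝ≥0∞ := fun M =>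
    P {ω | (fun n : ℕ => unitCombination B w (1 / ((n : ℝ≥0) + 1)) ω) ∈ barrierSet β N M}
  suffices h : ∀ M, P (bad N) ≤ p M from
    le_antisymm (ge_of_tendsto'
      ((hB.isPreBrownianReal_unitCombination hw).tendsto_measure_barrierSet β N) h) zero_le
  intro M
  -- On this event, rounding `T` up by at most `1/(j + N + 1)` raises the drifted path by at most
  -- `1/(M + 1)`; by continuity these events exhaust `bad N`. The index `j + N` makes the mesh at
  -- most `1/(N + 1)`.
  set close : ℕ → Set Ω := fun j => {ω | ∀ s : ℝ≥0, T ω = s →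
    ∀ u, s ≤ u → u ≤ s + 1 / (((j + N : ℕ) : ℝ≥0) + 1) →
      unitCombination B w u ω + β * u ≤ unitCombination B w s ω + β * s + 1 / ((M : ℝ) + 1)}
    with hclose
  have hmono : Monotone fun j => bad N ∩ close j := by
    intro j k hjk ω hω
    refine ⟨hω.1, fun s hs u hsu hu => hω.2 s hs u hsu (hu.trans ?_)⟩
    have : ((j + N : ℕ) : ℝ≥0) ≤ (k + N : ℕ) := by exact_mod_cast (by linarith)
    exact add_le_add le_rfl (one_div_le_one_div_of_le (by positivity) (by gcongr))
  have hcover : bad N ⊆ ⋃ j, bad N ∩ close j := by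
    intro ω hω
    obtain ⟨hc, -, s, hs, -⟩ := id hω
    have hev : ∀ᶠ u in 𝓝 s, unitCombination B w u ω + β * u <
        unitCombination B w s ω + β * s + 1 / ((M : ℝ) + 1) := by
      refine Tendsto.eventually_lt_const ?_
        ((hc.add (continuous_const.mul NNReal.continuous_coe)).tendsto s)
      exact lt_add_of_pos_right (unitCombination B w s ω + β * s) (by positivity)
    obtain ⟨ε, hε, hball⟩ := Metric.eventually_nhds_iff.1 hev
    obtain ⟨j, hj⟩ := exists_nat_one_div_lt hε
    refine Set.mem_iUnion.2 ⟨j, hω, fun s' hs' u hsu hu => ?_⟩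
    obtain rfl : s' = s := by rw [hs] at hs'; exact_mod_cast hs'.symm
    refine (hball ?_).le
    rw [NNReal.dist_eq, abs_of_nonneg (sub_nonneg.2 (NNReal.coe_le_coe.2 hsu))]
    rw [← NNReal.coe_le_coe] at hu
    push_cast at hu
    have : (1 : ℝ) / (j + N + 1) ≤ 1 / (j + 1) :=
      one_div_le_one_div_of_le (by positivity) (by linarith [(Nat.cast_nonneg N : (0 : ℝ) ≤ N)])
    linarith
  refine (measure_mono hcover).trans ?_
  rw [hmono.measure_iUnion]
  refine iSup_le fun j => ?_
  set c : ℕ := j + N + 1 with hc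
  set q : ℕ → ℚ≥0 := fun m => (m : ℚ≥0) / c with hq
  have hcpos : (0 : ℝ≥0) < c := by rw [hc]; positivity
  have hqc : ∀ m, ((q m : ℚ≥0) : ℝ≥0) = (m : ℝ≥0) / c := fun m => by simp [hq]
  have hqmono : Monotone q := fun m k hmk => by
    simp only [hq]
    gcongr
  refine (measure_mono ?_).trans (hB.measure_iUnion_inter_incrementSequence_le hw hqmono
    (fun m => hGm (q m)) (measurableSet_barrierSet β N M))
  rintro ω ⟨⟨-, hGω, s, hs, hb⟩, hcl⟩
  -- `q m` is the first grid time at or after `T`, so `ω` lies in exactly the `m`-th disjoint piece.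
  set m : ℕ := ⌈s * c⌉₊ with hm
  have hsq : s ≤ q m := by
    rw [hqc, le_div_iff₀ hcpos]
    exact Nat.le_ceil _
  have hlt : ∀ k < m, ((q k : ℚ≥0) : ℝ≥0) < s := fun k hk => by
    rw [hqc, div_lt_iff₀ hcpos]
    exact Nat.lt_ceil.1 hk
  refine Set.mem_iUnion.2 ⟨m, ?_, ?_⟩
  · rw [disjointed_eq_inter_compl]
    refine ⟨(hGω _).1 (by rw [hs]; exact_mod_cast hsq), Set.mem_iInter₂.2 fun k hk hmem => ?_⟩
    have := (hGω _).2 hmem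
    rw [hs] at this
    exact absurd (hlt k hk) (not_lt.2 (by exact_mod_cast this))
  · refine barrier_of_le (v := fun u => unitCombination B w u ω) (j := j + N) hb (hcl s hs)
      (Nat.le_add_left _ _) hsq ?_
    rw [hqc, div_le_iff₀ hcpos, add_mul]
    have : (1 : ℝ≥0) / (((j + N : ℕ) : ℝ≥0) + 1) * c = 1 := by
      rw [hc]; push_cast; field_simp
    rw [this]
    exact (Nat.ceil_lt_add_one zero_le).le

end StrongMarkov

/-! ### The reflected Brownian motion at epochs and at fixed times -/

section Adapted

variable {Ω : Type*} [MeasurableSpace Ω] {d : ℕ} {X : Ω → ℝ≥0 → Fin d → ℝ} {r : ℚ≥0}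

/-- At a rational time the supremum defining `runMax` runs over rational earlier times only, so
adaptedness survives each Picard step without completing or augmenting the filtration. -/
theorem measurable_runMax {g : Ω → ℝ≥0 → ℝ}
    (hg : ∀ u : ℚ≥0, u ≤ r → Measurable fun ω => g ω u) {u : ℚ≥0} (hu : u ≤ r) :
    Measurable fun ω => runMax (g ω) u := by
  refine Measurable.iSup fun q => ?_
  have h := hg (min q 1 * u) ((mul_le_of_le_one_left zero_le (min_le_right _ _)).trans hu)
  push_cast at h
  exact h.max measurable_const

theorem measurable_mulVec_apply (A : Matrix (Fin d) (Fin d) ℝ) {f : Ω → Fin d → ℝ}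
    (hf : ∀ j, Measurable fun ω => f ω j) (i : Fin d) : Measurable fun ω => (A *ᵥ f ω) i := by
  unfold Matrix.mulVec dotProduct
  exact Finset.measurable_sum _ fun j _ => (hf j).const_mul _

theorem measurable_picard (Q : Matrix (Fin d) (Fin d) ℝ) (y : Fin d → ℝ)
    (hX : ∀ u : ℚ≥0, u ≤ r → ∀ i, Measurable fun ω => X ω u i) (n : ℕ) {u : ℚ≥0} (hu : u ≤ r)
    (i : Fin d) : Measurable fun ω => picard Q y (X ω) n u i := by
  induction n generalizing u i with
  | zero => exact measurable_const
  | succ n ih =>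
    simp_rw [picard_succ_apply]
    refine measurable_runMax (g := fun ω s => (Qᵀ *ᵥ picard Q y (X ω) n s) i - y i - X ω s i)
      (fun u hu => ?_) hu
    exact ((measurable_mulVec_apply Qᵀ (fun j => ih hu j) i).sub_const _).sub (hX u hu i)

theorem measurable_reflection (Q : Matrix (Fin d) (Fin d) ℝ) (y : Fin d → ℝ)
    (hX : ∀ u : ℚ≥0, u ≤ r → ∀ i, Measurable fun ω => X ω u i) {u : ℚ≥0} (hu : u ≤ r)
    (i : Fin d) : Measurable fun ω => reflection Q y (X ω) u i := by
  exact (measurable_const.add (hX u hu i)).add (measurable_mulVec_apply _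
    (fun j => Measurable.iSup fun n => measurable_picard Q y hX n hu j) i)

theorem measurableSet_near_zero (Q : Matrix (Fin d) (Fin d) ℝ) (y : Fin d → ℝ)
    (hX : ∀ u : ℚ≥0, u ≤ r → ∀ i, Measurable fun ω => X ω u i) {q : ℚ≥0} (hq : q ≤ r)
    (i : Fin d) : MeasurableSet {ω | ∀ m : ℕ, ∃ u : ℚ≥0,
      reflection Q y (X ω) (max q (min u r)) i < 1 / ((m : ℝ) + 1)} := by
  simp only [Set.ofPred_forall, Set.ofPred_exists]
  refine .iInter fun m => .iUnion fun u => measurableSet_lt ?_ measurable_const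
  have h := measurable_reflection Q y hX (max_le hq (min_le_right u r)) i
  push_cast at h
  exact h

end Adapted

/-! ### Transfer to the driving path and the reflected process -/

section Driving

variable {Ω : Type*} {d : ℕ} {B : Fin d → ℝ≥0 → Ω → ℝ} {Q R : Matrix (Fin d) (Fin d) ℝ}
  {y : Fin d → ℝ}

theorem dotProduct_drivingPath (μ : Fin d → ℝ) {C : Matrix (Fin d) (Fin d) ℝ} {v : Fin d → ℝ}
    (hv : Cᵀ *ᵥ v ≠ 0) (ω : Ω) (t : ℝ≥0) :
    v ⬝ᵥ drivingPath μ C B ω t = √(Cᵀ *ᵥ v ⬝ᵥ Cᵀ *ᵥ v) *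
      (unitCombination B (Cᵀ *ᵥ v) t ω + v ⬝ᵥ μ / √(Cᵀ *ᵥ v ⬝ᵥ Cᵀ *ᵥ v) * t) := by
  have hσ := (Real.sqrt_pos.2 (dotProduct_self_pos_of_ne_zero hv)).ne'
  rw [drivingPath, dotProduct_add, dotProduct_smul, Matrix.dotProduct_mulVec,
    ← Matrix.mulVec_transpose, unitCombination, mul_add, mul_inv_cancel_left₀ hσ, ← mul_assoc,
    mul_div_cancel₀ _ hσ, smul_eq_mul, mul_comm (t : ℝ), add_comm]
  rfl

theorem measurable_drivingPath (μ : Fin d → ℝ) (C : Matrix (Fin d) (Fin d) ℝ) {u r : ℚ≥0}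
    (h : u ≤ r) (i : Fin d) :
    Measurable[pastAlgebra B r] fun ω => drivingPath μ C B ω u i := by
  let := pastAlgebra B r
  exact measurable_const.add
    (measurable_mulVec_apply C (fun j => measurable_pastAlgebra_apply B h j) i)

variable [MeasurableSpace Ω] {P : Measure Ω}

theorem IsStandardBrownian.ae_drivingPath (hB : IsStandardBrownian B P) (μ : Fin d → ℝ) (C : Matrix (Fin d) (Fin d) ℝ) :
    ∀ᵐ ω ∂P, Continuous (drivingPath μ C B ω) ∧ drivingPath μ C B ω 0 = 0 := by
  filter_upwards [ae_all_iff.2 fun i => (hB.brownian i).cont,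
    ae_all_iff.2 fun i => (hB.brownian i).toIsPreBrownianReal.eval_zero_ae_eq_zero] with ω h h0
  constructor
  · unfold drivingPath
    exact (NNReal.continuous_coe.smul continuous_const).add
      (continuous_const.matrix_mulVec (continuous_pi h))
  · have : (fun i => B i 0 ω) = 0 := funext h0
    simp [drivingPath, this]

theorem isRationalStoppingTime_natCast (n : ℕ) :
    IsRationalStoppingTime B P fun _ => (n : ℝ≥0∞) :=
  fun r => ⟨{_ω | (n : ℝ≥0∞) ≤ (r : ℝ≥0)}, @MeasurableSet.const _ (pastAlgebra B r) _,
    Eventually.of_forall fun _ => Iff.rfl⟩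

theorem IsStandardBrownian.isRationalStoppingTime_zeroTime (hB : IsStandardBrownian B P) (μ : Fin d → ℝ)
    (C : Matrix (Fin d) (Fin d) ℝ) (hQ : IsSubstochastic Q) (hRQ : R = (1 - Q)ᵀ)
    (hR : HasNonnegInverse R) (hy : ∀ i, 0 ≤ y i) (i : Fin d) (q : ℚ≥0) (n : ℕ) :
    IsRationalStoppingTime B P fun ω =>
      zeroTime (reflection Q y (drivingPath μ C B ω)) i q + n := by
  intro r
  -- After shifting by `n`, the event depends only on the reflected path at rational times up to `r
  -- - n`; if `r < q + n` it is empty.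
  by_cases hr : q + n ≤ r
  · obtain ⟨r, rfl⟩ : ∃ r', r = r' + n :=
      ⟨r - n, (tsub_add_cancel_of_le (le_add_self.trans hr)).symm⟩
    have hqr : q ≤ r := le_of_add_le_add_right hr
    refine ⟨_, pastAlgebra_mono B le_self_add _
      (@measurableSet_near_zero _ (pastAlgebra B r) _ _ _ Q y
        (fun u hu i => measurable_drivingPath μ C hu i) _ hqr i), ?_⟩
    filter_upwards [hB.ae_drivingPath μ C] with ω ⟨hx, hx0⟩
    have hsol := isSkorokhodSolution_reflection hQ hRQ hR hx hx0 hy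
    rw [NNRat.cast_add, NNRat.cast_natCast, ENNReal.coe_add, ENNReal.coe_natCast,
      ENNReal.add_le_add_iff_right (ENNReal.natCast_ne_top n),
      zeroTime_le_iff (hsol.continuous_path hx) hsol.nonneg]
    exact and_iff_right (by exact_mod_cast hqr)
  · refine ⟨∅, @MeasurableSet.empty _ (pastAlgebra B r), Eventually.of_forall fun ω => ?_⟩
    simp only [Set.mem_empty_iff_false, iff_false]
    intro h
    refine hr ?_
    have h1 : ((q : ℝ≥0) : ℝ≥0∞) ≤ zeroTime (reflection Q y (drivingPath μ C B ω)) i q := by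
      refine le_sInf ?_
      rintro _ ⟨s, rfl, hs, -⟩
      exact_mod_cast hs
    have h2 := (add_le_add h1 le_rfl).trans h
    exact_mod_cast h2

variable [IsProbabilityMeasure P] {C : Matrix (Fin d) (Fin d) ℝ}

theorem IsStandardBrownian.ae_drivingPath_lt_after (hB : IsStandardBrownian B P) (μ : Fin d → ℝ) {i : Fin d} (hC : C i ≠ 0)
    {T : Ω → ℝ≥0∞} (hT : IsRationalStoppingTime B P T) :
    ∀ᵐ ω ∂P, ∀ s : ℝ≥0, T ω = s → ∀ t, s < t → ∃ u, s ≤ u ∧ u ≤ t ∧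
      drivingPath μ C B ω u i < drivingPath μ C B ω s i := by
  have hv : Cᵀ *ᵥ Pi.single i 1 ≠ 0 := by
    rw [Matrix.mulVec_single_one]; exact hC
  have hσ := Real.sqrt_pos.2 (dotProduct_self_pos_of_ne_zero hv)
  filter_upwards [hB.ae_exists_lt_after hv _ hT] with ω h s hs t hst
  obtain ⟨u, hsu, hut, hlt⟩ := h s hs t hst
  refine ⟨u, hsu, hut, ?_⟩
  rw [← single_one_dotProduct i (drivingPath μ C B ω u),
    ← single_one_dotProduct i (drivingPath μ C B ω s),
    dotProduct_drivingPath μ hv, dotProduct_drivingPath μ hv]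
  exact mul_lt_mul_of_pos_left hlt hσ

theorem IsStandardBrownian.ae_dotProduct_lt_before (hB : IsStandardBrownian B P) (μ : Fin d → ℝ) {v : Fin d → ℝ}
    (hv : Cᵀ *ᵥ v ≠ 0) (t : ℝ≥0) :
    ∀ᵐ ω ∂P, ∀ r < t, ∃ u, r ≤ u ∧ u ≤ t ∧
      0 < v ⬝ᵥ (drivingPath μ C B ω t - drivingPath μ C B ω u) := by
  have hσ := Real.sqrt_pos.2 (dotProduct_self_pos_of_ne_zero hv)
  filter_upwards [(hB.isPreBrownianReal_unitCombination hv).ae_exists_lt_before _]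
    with ω h r hr
  obtain ⟨u, hru, hut, hlt⟩ := h r hr
  refine ⟨u, hru, hut, ?_⟩
  rw [dotProduct_sub, dotProduct_drivingPath μ hv, dotProduct_drivingPath μ hv, sub_pos]
  exact mul_lt_mul_of_pos_left hlt hσ

/-- Countably many stopping times and finitely many coordinates give one null set valid for all
shifted zero times. -/
theorem IsStandardBrownian.ae_isPushTime (hB : IsStandardBrownian B P) (μ : Fin d → ℝ) (hC : ∀ i, C i ≠ 0)
    (hQ : IsSubstochastic Q) (hRQ : R = (1 - Q)ᵀ) (hR : HasNonnegInverse R)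
    (hy : ∀ i, 0 ≤ y i) :
    ∀ᵐ ω ∂P, ∀ s : ℝ≥0,
      IsShiftedZeroTime (reflection Q y (drivingPath μ C B ω)) s →
      IsPushTime Q y (drivingPath μ C B ω) s := by
  have h1 : ∀ᵐ ω ∂P, ∀ (i : Fin d) (n : ℕ), ∀ s : ℝ≥0, (n : ℝ≥0∞) = s → ∀ t, s < t → ∃ u,
      s ≤ u ∧ u ≤ t ∧ drivingPath μ C B ω u i < drivingPath μ C B ω s i :=
    ae_all_iff.2 fun i => ae_all_iff.2 fun n =>
      hB.ae_drivingPath_lt_after μ (hC i) (isRationalStoppingTime_natCast n)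
  have h2 : ∀ᵐ ω ∂P, ∀ (i j : Fin d) (q : ℚ≥0) (n : ℕ), ∀ s : ℝ≥0,
      zeroTime (reflection Q y (drivingPath μ C B ω)) j q + n = s → ∀ t, s < t → ∃ u,
      s ≤ u ∧ u ≤ t ∧ drivingPath μ C B ω u i < drivingPath μ C B ω s i :=
    ae_all_iff.2 fun i => ae_all_iff.2 fun j => ae_all_iff.2 fun q => ae_all_iff.2 fun n =>
      hB.ae_drivingPath_lt_after μ (hC i)
        (hB.isRationalStoppingTime_zeroTime μ C hQ hRQ hR hy j q n)
  filter_upwards [h1, h2, hB.ae_drivingPath μ C] with ω h1 h2 ⟨hx, hx0⟩ s hs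
  refine isPushTime_of_fluctuation hQ hRQ hR hx hx0 hy fun i => ?_
  obtain ⟨n, hn⟩ | ⟨j, q, n, hn⟩ := hs
  · exact h1 i n s hn.symm
  · exact h2 i j q n s hn.symm

theorem IsStandardBrownian.ae_reflection_ne_zero (hB : IsStandardBrownian B P) (μ : Fin d → ℝ) (hC : ∀ i, C i ≠ 0)
    (hQ : IsSubstochastic Q) (hRQ : R = (1 - Q)ᵀ) (hR : HasNonnegInverse R)
    (hy : ∀ i, 0 ≤ y i) {t : ℝ≥0} (ht : 0 < t) :
    ∀ᵐ ω ∂P, ∀ i, reflection Q y (drivingPath μ C B ω) t i ≠ 0 := by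
  have h : ∀ᵐ ω ∂P, ∀ (A : Set (Fin d)) (k : Fin d), Cᵀ *ᵥ (greenOn Q A).col k ≠ 0 →
      ∀ r < t, ∃ u, r ≤ u ∧ u ≤ t ∧
        0 < (greenOn Q A).col k ⬝ᵥ (drivingPath μ C B ω t - drivingPath μ C B ω u) := by
    refine ae_all_iff.2 fun A => ae_all_iff.2 fun k => ?_
    by_cases hv : Cᵀ *ᵥ (greenOn Q A).col k = 0
    · exact Eventually.of_forall fun ω hne => absurd hv hne
    · filter_upwards [hB.ae_dotProduct_lt_before μ hv t] with ω h _ using h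
  filter_upwards [h, hB.ae_drivingPath μ C] with ω h ⟨hx, hx0⟩
  exact reflection_ne_zero_of_fluctuation hQ hRQ hR hx hx0 hy hC ht h

end Driving

/-! ### The main theorem -/

theorem mem_epochs {d : ℕ} {Y : ℝ≥0 → Fin d → ℝ} {t s : ℝ≥0} :
    s ∈ epochs Y t ↔ s ≤ t ∧ ∃ i k, (s : ℝ≥0∞) = etaCoord Y i k := by
  simp [epochs]

theorem mainTheorem3 {Ω : Type*} [MeasurableSpace Ω] (P : Measure Ω) [IsProbabilityMeasure P]
    {d : ℕ} (B : Fin d → ℝ≥0 → Ω → ℝ) (hB : IsStandardBrownian B P)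
    (μ : Fin d → ℝ) (C : Matrix (Fin d) (Fin d) ℝ) (hC : ∀ i, 0 < (C * Cᵀ) i i)
    (Q R : Matrix (Fin d) (Fin d) ℝ) (hQ : IsSubstochastic Q)
    (hRQ : R = (1 - Q)ᵀ) (hR : HasNonnegInverse R)
    (y : Fin d → ℝ) (hy : ∀ i, 0 ≤ y i) :
    (∀ᵐ ω ∂P, ∀ z : Fin d → ℝ, (∀ i, 0 ≤ z i) →
      ∃! p : (ℝ≥0 → Fin d → ℝ) × (ℝ≥0 → Fin d → ℝ),
        IsSkorokhodSolution R z (drivingPath μ C B ω) p.1 p.2) ∧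
    (∀ t : ℝ≥0, ∀ᵐ ω ∂P, ∃ D : Matrix (Fin d) (Fin d) ℝ,
      IsDerivativeMatrix R y (drivingPath μ C B ω) t D ∧
      ∀ i j, D i j ≤
        (R⁻¹ * epochProduct hQ (reflectedPath R y (drivingPath μ C B ω))
          (epochs (reflectedPath R y (drivingPath μ C B ω)) t)) i j) ∧
    (∀ S : Set (Fin d), IsSubstochastic (hitMatrix hQ S)) ∧
    (∀ᵐ ω ∂P, ∀ t : ℝ≥0, ∃ D : Matrix (Fin d) (Fin d) ℝ,
      IsDerivativeMatrix R y (drivingPath μ C B ω) t D ∧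
      ∀ i j, D i j ≤
        (R⁻¹ * epochProduct hQ (reflectedPath R y (drivingPath μ C B ω))
          ((epochs (reflectedPath R y (drivingPath μ C B ω)) t).filter (· < t))) i j) := by
  have hC' : ∀ i, C i ≠ 0 := fun i h => by
    have h1 := hC i
    simp [Matrix.mul_apply, h] at h1
  -- Both bounds come from this one null set: for all `t` simultaneously `F` consists of the epochs
  -- before `t`, and for fixed `t` this is almost surely all of `Γ(t)`.
  have hbound : ∀ᵐ ω ∂P, ∀ t : ℝ≥0, ∀ F ⊆ epochs (reflectedPath R y (drivingPath μ C B ω)) t,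
      (∀ s ∈ F, s < t) → ∃ D : Matrix (Fin d) (Fin d) ℝ,
        IsDerivativeMatrix R y (drivingPath μ C B ω) t D ∧ ∀ i j, D i j ≤
          (R⁻¹ * epochProduct hQ (reflectedPath R y (drivingPath μ C B ω)) F) i j := by
    filter_upwards [hB.ae_isPushTime μ hC' hQ hRQ hR hy, hB.ae_drivingPath μ C]
      with ω h ⟨hx, hx0⟩ t F hF ht
    refine exists_isDerivativeMatrix_le hQ hRQ hR hx hx0 hy F (fun s hs => h s ?_) ht
    obtain ⟨-, i, k, hik⟩ := mem_epochs.1 (hF hs)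
    rw [hik, reflectedPath_eq_reflection hQ hRQ hR hx hx0 hy]
    exact isShiftedZeroTime_etaCoord _ i k
  refine ⟨?_, fun t => ?_, isSubstochastic_hitMatrix hQ, ?_⟩
  · filter_upwards [hB.ae_drivingPath μ C] with ω ⟨hx, hx0⟩ z hz
    exact existsUnique_skorokhodSolution hQ hRQ hR hx hx0 hz
  · suffices h : ∀ᵐ ω ∂P, t ∉ epochs (reflectedPath R y (drivingPath μ C B ω)) t by
      filter_upwards [h, hbound] with ω h hbound
      exact hbound t _ subset_rfl fun s hs =>
        lt_of_le_of_ne (mem_epochs.1 hs).1 fun hst => h (hst ▸ hs)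
    rcases eq_zero_or_pos t with rfl | ht
    -- At `t = 0` coordinates of `y` may vanish, but every epoch is at least `1`.
    · refine Eventually.of_forall fun ω h0 => ?_
      obtain ⟨-, i, k, hik⟩ := mem_epochs.1 h0
      have h1 := add_one_le_etaCoord (reflectedPath R y (drivingPath μ C B ω)) i k
      rw [← hik, ENNReal.coe_zero] at h1
      exact absurd (le_add_self.trans h1) (by simp)
    · filter_upwards [hB.ae_reflection_ne_zero μ hC' hQ hRQ hR hy ht, hB.ae_drivingPath μ C]
        with ω hne ⟨hx, hx0⟩ hmem
      obtain ⟨-, i, k, hik⟩ := mem_epochs.1 hmem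
      rw [reflectedPath_eq_reflection hQ hRQ hR hx hx0 hy] at hik
      have hsol := isSkorokhodSolution_reflection hQ hRQ hR hx hx0 hy
      exact hne i (apply_eq_zero_of_eq_etaCoord (hsol.continuous_path hx) hik)
  · filter_upwards [hbound] with ω h t
    exact h t _ (Finset.filter_subset _ _) fun s hs => (Finset.mem_filter.1 hs).2
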